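/- Let $d\in\{2,3\}$, let $B_s\subset\mathbb{R}^d$ be the open ball of radius $s$ centred at $0$, and let $N\ge 0$ be an integer. **Structure.** Let $1=r_{L+1}<r_L<\dots<r_1=2$ and let $\sigma_1,\dots,\sigma_L>0$ be constants. Let $\sigma$ be the radial conductivity in $\mathbb{R}^d$ equal to $1$ for $|x|>2$, to $\sigma_j$ for $r_{j+1}<|x|\le r_j$ ($1\le j\le L$), and to $0$ in the core $|x|\le 1$ (perfectly insulating core). For a harmonic polynomial $H$ let $u$ be the solution of $\nabla\cdot\sigma\nabla u=0$ in $\mathbb{R}^d\setminus\overline{B_1}$ with zero flux on $\partial B_1$ and $u-H=O(|x|^{-1})$ as $|x|\to\infty$. Let $\mathcal H_m$ be the space of homogeneous harmonic polynomials of degree $m$. For $H\in\mathcal H_k$, $k\ge1$, one has for $|x|$ large $$(u-H)(x)=\sum_{m\ge1}c_{d,m}\,\frac{(M_{mk}H)(x)}{|x|^{2m+d-2}},\qquad c_{2,m}=-\frac1{2\pi m},\quad c_{3,m}=\frac1{2m+1},$$ with linear maps $M_{mk}:\mathcal H_k\to\mathcal H_m$, whose matrix entries are the contracted generalized polarization tensors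 (CGPTs) of $\sigma$. Assume that $\sigma$ is a GPT-vanishing structure of order $N$, that is, $M_{mk}=0$ for all $1\le m,k\le N$. **Cloak.** For $0<\rho<\frac12$ let $(\sigma\circ\Psi_{1/\rho})(x)=\sigma(x/\rho)$, which has the insulating core $B_\rho$ and the coating in $B_{2\rho}\setminus B_\rho$. Let $F:\overline{B_1}\to\overline{B_1}$, $F(x)=g(|x|)\frac{x}{|x|}$, $F(0)=0$, where $g(t)=\frac{t}{2\rho}$ for $t\le\rho$, $g(t)=\frac12(t/\rho)^{\alpha(\rho)}$ for $\rho\le t\le\frac34$, $g(t)=t$ for $\frac34\le t\le1$, and $\alpha(\rho)=\ln\frac32/(\ln\frac34-\ln\rho)$. For a conductivity $\gamma$ put $(F_*\gamma)(y)=\frac{DF(x)\,\gamma(x)\,DF(x)^T}{\det DF(x)}$ with $x=F^{-1}(y)$. **Dirichlet-to-Neumann maps.** $\Lambda_{B_1,B_{1/2}}[A]:H^{1/2}(\partial B_1)\to H^{-1/2}(\partial B_1)$ maps $\varphi$ to $A\nabla u\cdot n|_{\partial B_1}$, where $u$ is the weak solution of $\nabla\cdot A\nabla u=0$ in $B_1\setminus\overline{B_{1/2}}$,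 $A\nabla u\cdot n=0$ on $\partial B_{1/2}$, $u=\varphi$ on $\partial B_1$; and $\Lambda_{B_1}[1]$ is the Dirichlet-to-Neumann map of the Laplacian in $B_1$. **Claim.** These maps are well defined, and there is a constant $C$ independent of $\rho$ (it may depend on $d$, $N$ and $\sigma$) such that for all $0<\rho<\frac12$ $$\left\|\Lambda_{B_1,B_{1/2}}\big[F_*(\sigma\circ\Psi_{1/\rho})\big]-\Lambda_{B_1}[1]\right\|_{\mathcal L(H^{1/2}(\partial B_1),\,H^{-1/2}(\partial B_1))}\le C\rho^{2N+d}.$$ -/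

import Mathlib

noncomputable section

namespace Cloak

open MeasureTheory Metric Filter Topology Asymptotics
open scoped ContDiff InnerProductSpace

/-- Euclidean space `ℝᵈ`. -/
abbrev E (d : ℕ) : Type := EuclideanSpace ℝ (Fin d)

/-! ### Sobolev spaces, traces on the unit sphere -/

/-- A smooth compactly supported function on `ℝᵈ`. -/
def IsTest {d : ℕ} (ψ : E d → ℝ) : Prop :=
  ContDiff ℝ ∞ ψ ∧ HasCompactSupport ψ

/-- `u ∈ H¹(Ω)` with weak gradient `G`, for an open set `Ω`. -/
structure IsH1 {d : ℕ} (Ω : Set (E d)) (u : E d → ℝ) (G : E d → E d) : Prop where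
  memLp : MemLp u 2 (volume.restrict Ω)
  memLp_grad : MemLp G 2 (volume.restrict Ω)
  weak_grad : ∀ ψ : E d → ℝ, IsTest ψ → tsupport ψ ⊆ Ω → ∀ v : E d,
    ∫ x in Ω, u x * fderiv ℝ ψ x v = - ∫ x in Ω, ⟪G x, v⟫_ℝ * ψ x

/-- The unit ball with a closed core `K` removed. -/
def dom {d : ℕ} (K : Set (E d)) : Set (E d) := ball 0 1 \ K

/-- Surface measure on the unit sphere `∂B₁`. -/
abbrev surf (d : ℕ) : Measure (sphere (0 : E d) 1) := (volume : Measure (E d)).toSphere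

/-- `u ∈ H¹(B₁ ∖ K)` (weak gradient `G`) has trace `φ ∈ L²(∂B₁)` on the outer boundary `∂B₁`.
The trace is characterised by Green's formula, tested with functions supported away from
the core `K` (no condition is imposed on `∂K`). -/
def HasTrace {d : ℕ} (K : Set (E d)) (u : E d → ℝ) (G : E d → E d)
    (φ : Lp ℝ 2 (surf d)) : Prop :=
  ∀ ψ : E d → ℝ, IsTest ψ → Disjoint (tsupport ψ) K → ∀ v : E d,
    ∫ x in dom K, (u x * fderiv ℝ ψ x v + ⟪G x, v⟫_ℝ * ψ x)
      = ∫ y, φ y * (ψ (y : E d) * ⟪(y : E d), v⟫_ℝ) ∂(surf d)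

/-- `(u, G)` is an extension of the boundary function `φ` to `H¹(B₁ ∖ K)`. -/
structure IsExt {d : ℕ} (K : Set (E d)) (φ : Lp ℝ 2 (surf d))
    (u : E d → ℝ) (G : E d → E d) : Prop where
  h1 : IsH1 (dom K) u G
  trace : HasTrace K u G φ

/-! Helper facts: extensions form a linear space. -/

lemma continuous_fderiv_test {d : ℕ} {ψ : E d → ℝ} (h : IsTest ψ) (v : E d) :
    Continuous fun x => fderiv ℝ ψ x v :=
  (h.1.continuous_fderiv (by simp)).clm_apply continuous_const

lemma integrable_mul_test {d : ℕ} {μ : Measure (E d)} [IsFiniteMeasureOnCompacts μ]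
    {f g : E d → ℝ} (hf : MemLp f 2 μ) (hg : Continuous g) (hc : HasCompactSupport g) :
    Integrable (fun x => f x * g x) μ :=
  hf.integrable_mul (q := 2) (hg.memLp_of_hasCompactSupport hc)

lemma integrable_u {d : ℕ} {Ω : Set (E d)} {u : E d → ℝ} {ψ : E d → ℝ}
    (hu : MemLp u 2 (volume.restrict Ω)) (h : IsTest ψ) (v : E d) :
    Integrable (fun x => u x * fderiv ℝ ψ x v) (volume.restrict Ω) :=
  integrable_mul_test hu (continuous_fderiv_test h v) (h.2.fderiv_apply ℝ v)

lemma integrable_G {d : ℕ} {Ω : Set (E d)} {G : E d → E d} {ψ : E d → ℝ}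
    (hG : MemLp G 2 (volume.restrict Ω)) (h : IsTest ψ) (v : E d) :
    Integrable (fun x => ⟪G x, v⟫_ℝ * ψ x) (volume.restrict Ω) :=
  integrable_mul_test (hG.inner_const v) h.1.continuous h.2

lemma integrable_phi {d : ℕ} (φ : Lp ℝ 2 (surf d)) {ψ : E d → ℝ} (h : IsTest ψ) (v : E d) :
    Integrable (fun y : sphere (0 : E d) 1 => φ y * (ψ (y : E d) * ⟪(y : E d), v⟫_ℝ))
      (surf d) := by
  have hc : Continuous fun y : sphere (0 : E d) 1 => ψ (y : E d) * ⟪(y : E d), v⟫_ℝ :=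
    (h.1.continuous.comp continuous_subtype_val).mul
      (continuous_subtype_val.inner continuous_const)
  exact (Lp.memLp φ).integrable_mul (q := 2)
    (hc.memLp_of_hasCompactSupport (HasCompactSupport.of_compactSpace _))

lemma IsExt.zero {d : ℕ} (K : Set (E d)) :
    IsExt K (0 : Lp ℝ 2 (surf d)) (fun _ => 0) (fun _ => 0) := by
  refine ⟨⟨MemLp.zero, MemLp.zero, ?_⟩, ?_⟩
  · intro ψ _ _ v; simp
  · intro ψ _ _ v
    have : ∫ y, (0 : Lp ℝ 2 (surf d)) y * (ψ (y : E d) * ⟪(y : E d), v⟫_ℝ) ∂(surf d) = 0 := by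
      rw [integral_congr_ae (g := fun _ => (0 : ℝ))]
      · simp
      · filter_upwards [Lp.coeFn_zero ℝ 2 (surf d)] with y hy
        rw [hy, Pi.zero_apply, zero_mul]
    rw [this]; simp

lemma IsExt.add {d : ℕ} {K : Set (E d)} {φ₁ φ₂ : Lp ℝ 2 (surf d)} {u₁ u₂ : E d → ℝ}
    {G₁ G₂ : E d → E d} (h₁ : IsExt K φ₁ u₁ G₁) (h₂ : IsExt K φ₂ u₂ G₂) :
    IsExt K (φ₁ + φ₂) (u₁ + u₂) (G₁ + G₂) := by
  refine ⟨⟨h₁.h1.memLp.add h₂.h1.memLp, h₁.h1.memLp_grad.add h₂.h1.memLp_grad, ?_⟩, ?_⟩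
  · intro ψ hψ hs v
    have e₁ := h₁.h1.weak_grad ψ hψ hs v
    have e₂ := h₂.h1.weak_grad ψ hψ hs v
    simp only [Pi.add_apply, inner_add_left, add_mul]
    rw [integral_add (integrable_u h₁.h1.memLp hψ v) (integrable_u h₂.h1.memLp hψ v),
      integral_add (integrable_G h₁.h1.memLp_grad hψ v) (integrable_G h₂.h1.memLp_grad hψ v),
      e₁, e₂]
    ring
  · intro ψ hψ hs v
    have e₁ := h₁.trace ψ hψ hs v
    have e₂ := h₂.trace ψ hψ hs v
    have r : ∫ y, (φ₁ + φ₂ : Lp ℝ 2 (surf d)) y * (ψ (y : E d) * ⟪(y : E d), v⟫_ℝ) ∂(surf d)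
        = (∫ y, φ₁ y * (ψ (y : E d) * ⟪(y : E d), v⟫_ℝ) ∂(surf d))
          + ∫ y, φ₂ y * (ψ (y : E d) * ⟪(y : E d), v⟫_ℝ) ∂(surf d) := by
      rw [← integral_add (integrable_phi φ₁ hψ v) (integrable_phi φ₂ hψ v)]
      refine integral_congr_ae ?_
      filter_upwards [Lp.coeFn_add φ₁ φ₂] with y hy
      simp only [hy, Pi.add_apply, add_mul]
    rw [r, ← e₁, ← e₂]
    refine Eq.trans ?_ (integral_add
      ((integrable_u h₁.h1.memLp hψ v).add (integrable_G h₁.h1.memLp_grad hψ v))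
      ((integrable_u h₂.h1.memLp hψ v).add (integrable_G h₂.h1.memLp_grad hψ v)))
    refine integral_congr_ae (Eventually.of_forall fun x => ?_)
    simp only [Pi.add_apply, inner_add_left]
    ring

lemma IsExt.smul {d : ℕ} {K : Set (E d)} {φ : Lp ℝ 2 (surf d)} {u : E d → ℝ}
    {G : E d → E d} (c : ℝ) (h : IsExt K φ u G) :
    IsExt K (c • φ) (c • u) (c • G) := by
  refine ⟨⟨h.h1.memLp.const_smul c, h.h1.memLp_grad.const_smul c, ?_⟩, ?_⟩
  · intro ψ hψ hs v
    have e := h.h1.weak_grad ψ hψ hs v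
    simp only [Pi.smul_apply, inner_smul_left, smul_eq_mul, mul_assoc, conj_trivial]
    rw [integral_const_mul, integral_const_mul, e]
    ring
  · intro ψ hψ hs v
    have e := h.trace ψ hψ hs v
    have r : ∫ y, (c • φ : Lp ℝ 2 (surf d)) y * (ψ (y : E d) * ⟪(y : E d), v⟫_ℝ) ∂(surf d)
        = c * ∫ y, φ y * (ψ (y : E d) * ⟪(y : E d), v⟫_ℝ) ∂(surf d) := by
      rw [← integral_const_mul]
      refine integral_congr_ae ?_
      filter_upwards [Lp.coeFn_smul c φ] with y hy
      simp only [hy, Pi.smul_apply, smul_eq_mul, mul_assoc]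
    rw [r, ← e, ← integral_const_mul]
    refine integral_congr_ae (Eventually.of_forall fun x => ?_)
    simp only [Pi.smul_apply, inner_smul_left, smul_eq_mul, conj_trivial]
    ring

/-! ### The space `H^{1/2}(∂B₁)` -/

/-- Boundary functions in `L²(∂B₁)` that are traces of functions in `H¹(B₁)`. -/
def hhalfSubmodule (d : ℕ) : Submodule ℝ (Lp ℝ 2 (surf d)) where
  carrier := {φ | ∃ u G, IsExt ∅ φ u G}
  zero_mem' := ⟨_, _, IsExt.zero ∅⟩
  add_mem' := by
    rintro a b ⟨u, G, h⟩ ⟨u', G', h'⟩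
    exact ⟨_, _, h.add h'⟩
  smul_mem' := by
    rintro c a ⟨u, G, h⟩
    exact ⟨_, _, h.smul c⟩

/-- The Sobolev space `H^{1/2}(∂B₁)`; its norm (below) is the trace norm, not the `L²` norm. -/
def Hhalf (d : ℕ) : Type := hhalfSubmodule d

instance (d : ℕ) : AddCommGroup (Hhalf d) := inferInstanceAs (AddCommGroup (hhalfSubmodule d))

instance (d : ℕ) : Module ℝ (Hhalf d) := inferInstanceAs (Module ℝ (hhalfSubmodule d))

/-- The underlying `L²(∂B₁)` function. -/
def Hhalf.toL2 {d : ℕ} : Hhalf d →ₗ[ℝ] Lp ℝ 2 (surf d) := (hhalfSubmodule d).subtype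

/-- The `L²` norm of a vector field on `B₁`. -/
def gradNorm {d : ℕ} (G : E d → E d) : ℝ :=
  (eLpNorm G 2 (volume.restrict (dom (∅ : Set (E d))))).toReal

/-- The numbers `(‖φ‖²_{L²(∂B₁)} + ‖∇u‖²_{L²(B₁)})^{1/2}`, `u ∈ H¹(B₁)` with trace `φ`. -/
def normSet {d : ℕ} (φ : Hhalf d) : Set ℝ :=
  {t | ∃ u G, IsExt ∅ φ.toL2 u G ∧ t = √(‖φ.toL2‖ ^ 2 + gradNorm G ^ 2)}

/-- `‖φ‖²_{H^{1/2}} = ‖φ‖²_{L²(∂B₁)} + min {‖∇u‖²_{L²(B₁)} : u ∈ H¹(B₁), u = φ on ∂B₁}`. -/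
instance (d : ℕ) : Norm (Hhalf d) := ⟨fun φ => sInf (normSet φ)⟩

lemma norm_def {d : ℕ} (φ : Hhalf d) : ‖φ‖ = sInf (normSet φ) := rfl

lemma normSet_nonempty {d : ℕ} (φ : Hhalf d) : (normSet φ).Nonempty := by
  obtain ⟨u, G, h⟩ := φ.2
  exact ⟨_, u, G, h, rfl⟩

lemma normSet_bddBelow {d : ℕ} (φ : Hhalf d) : BddBelow (normSet φ) :=
  ⟨0, by rintro _ ⟨u, G, _, rfl⟩; positivity⟩

lemma toL2_norm_le {d : ℕ} (φ : Hhalf d) : ‖φ.toL2‖ ≤ ‖φ‖ := by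
  refine le_csInf (normSet_nonempty φ) ?_
  rintro _ ⟨u, G, _, rfl⟩
  refine Real.le_sqrt_of_sq_le ?_
  nlinarith [sq_nonneg (gradNorm G)]

lemma gradNorm_smul {d : ℕ} (c : ℝ) (G : E d → E d) : gradNorm (c • G) = |c| * gradNorm G := by
  simp [gradNorm, eLpNorm_const_smul, ENNReal.toReal_mul]

lemma gradNorm_add_le {d : ℕ} {G G' : E d → E d}
    (h : MemLp G 2 (volume.restrict (dom (∅ : Set (E d)))))
    (h' : MemLp G' 2 (volume.restrict (dom (∅ : Set (E d))))) :
    gradNorm (G + G') ≤ gradNorm G + gradNorm G' := by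
  unfold gradNorm
  rw [← ENNReal.toReal_add h.eLpNorm_ne_top h'.eLpNorm_ne_top]
  exact ENNReal.toReal_mono (ENNReal.add_ne_top.2 ⟨h.eLpNorm_ne_top, h'.eLpNorm_ne_top⟩)
    (eLpNorm_add_le h.1 h'.1 (by norm_num))

lemma sqrt_minkowski {a b a' b' s t : ℝ} (hs : 0 ≤ s) (ht : 0 ≤ t) (hsa : s ≤ a + a') (htb : t ≤ b + b') :
    √(s ^ 2 + t ^ 2) ≤ √(a ^ 2 + b ^ 2) + √(a' ^ 2 + b' ^ 2) := by
  have h1 := Real.sq_sqrt (show (0 : ℝ) ≤ a ^ 2 + b ^ 2 by positivity)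
  have h2 := Real.sq_sqrt (show (0 : ℝ) ≤ a' ^ 2 + b' ^ 2 by positivity)
  have h3 : a * a' + b * b' ≤ √(a ^ 2 + b ^ 2) * √(a' ^ 2 + b' ^ 2) := by
    rw [← Real.sqrt_mul (by positivity)]
    exact Real.le_sqrt_of_sq_le (by nlinarith [sq_nonneg (a * b' - b * a')])
  refine Real.sqrt_le_iff.2 ⟨by positivity, ?_⟩
  have h4 : s ^ 2 ≤ (a + a') ^ 2 := pow_le_pow_left₀ hs hsa 2
  have h5 : t ^ 2 ≤ (b + b') ^ 2 := pow_le_pow_left₀ ht htb 2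
  nlinarith

lemma norm_add_le_aux {d : ℕ} (φ χ : Hhalf d) : ‖φ + χ‖ ≤ ‖φ‖ + ‖χ‖ := by
  rw [norm_def φ, norm_def χ, ← csInf_add (normSet_nonempty φ) (normSet_bddBelow φ)
    (normSet_nonempty χ) (normSet_bddBelow χ)]
  refine le_csInf ((normSet_nonempty φ).add (normSet_nonempty χ)) ?_
  rintro _ ⟨_, ⟨u, G, h, rfl⟩, _, ⟨u', G', h', rfl⟩, rfl⟩
  have hm : √(‖(φ + χ).toL2‖ ^ 2 + gradNorm (G + G') ^ 2) ∈ normSet (φ + χ) :=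
    ⟨u + u', G + G', by rw [map_add]; exact h.add h', rfl⟩
  refine (csInf_le (normSet_bddBelow _) hm).trans ?_
  refine sqrt_minkowski (norm_nonneg _) ENNReal.toReal_nonneg ?_
    (gradNorm_add_le h.h1.memLp_grad h'.h1.memLp_grad)
  rw [map_add]
  exact norm_add_le _ _

lemma norm_smul_le_aux {d : ℕ} (c : ℝ) (φ : Hhalf d) : ‖c • φ‖ ≤ |c| * ‖φ‖ := by
  have key : ∀ t ∈ normSet φ, ‖c • φ‖ ≤ |c| * t := by
    rintro _ ⟨u, G, h, rfl⟩
    refine csInf_le (normSet_bddBelow _) ⟨c • u, c • G, by rw [map_smul]; exact h.smul c, ?_⟩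
    rw [map_smul, norm_smul, gradNorm_smul, Real.norm_eq_abs, mul_pow, mul_pow, ← mul_add,
      Real.sqrt_mul (sq_nonneg _), Real.sqrt_sq (abs_nonneg c)]
  rcases eq_or_ne c 0 with rfl | hc
  · obtain ⟨t, ht⟩ := normSet_nonempty φ
    simpa using key t ht
  · have hc' : 0 < |c| := abs_pos.2 hc
    rw [← div_le_iff₀' hc']
    exact le_csInf (normSet_nonempty φ) fun t ht => (div_le_iff₀' hc').2 (key t ht)

lemma hhalf_core (d : ℕ) : NormedSpace.Core ℝ (Hhalf d) where
  norm_nonneg φ := (norm_nonneg φ.toL2).trans (toL2_norm_le φ)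
  norm_smul c φ := by
    refine le_antisymm (norm_smul_le_aux c φ) ?_
    rcases eq_or_ne c 0 with rfl | hc
    · simpa using (norm_nonneg _).trans (toL2_norm_le ((0 : ℝ) • φ))
    · have h := norm_smul_le_aux c⁻¹ (c • φ)
      rw [inv_smul_smul₀ hc, abs_inv] at h
      rw [Real.norm_eq_abs]
      exact (le_inv_mul_iff₀ (abs_pos.2 hc)).1 h
  norm_triangle := norm_add_le_aux
  norm_eq_zero_iff φ := by
    constructor
    · intro h
      have h0 : ‖φ.toL2‖ ≤ 0 := (toL2_norm_le φ).trans h.le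
      exact Subtype.ext (norm_le_zero_iff.1 h0)
    · rintro rfl
      have := norm_smul_le_aux 0 (0 : Hhalf d)
      rw [zero_smul, abs_zero, zero_mul] at this
      exact le_antisymm this ((norm_nonneg _).trans (toL2_norm_le _))

instance (d : ℕ) : NormedAddCommGroup (Hhalf d) := NormedAddCommGroup.ofCore (hhalf_core d)

instance (d : ℕ) : NormedSpace ℝ (Hhalf d) := NormedSpace.ofCore (hhalf_core d)

/-- `H^{-1/2}(∂B₁)`, the dual of `H^{1/2}(∂B₁)`. -/
abbrev HnegHalf (d : ℕ) : Type := StrongDual ℝ (Hhalf d)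

/-! ### Dirichlet-to-Neumann maps -/

/-- Weak solution `u ∈ H¹(B₁ ∖ K)`, with gradient `G`, of `∇·(A ∇u) = 0` in `B₁ ∖ K`,
`u = φ` on `∂B₁`, `A∇u · n = 0` on `∂K` (the core `K` is perfectly insulating; the Neumann
condition is the natural one, since test functions need not vanish on `∂K`). -/
structure IsWeakSol {d : ℕ} (K : Set (E d)) (A : E d → E d →L[ℝ] E d)
    (φ : Lp ℝ 2 (surf d)) (u : E d → ℝ) (G : E d → E d) : Prop where
  ext : IsExt K φ u G
  weak : ∀ w Z, IsExt K 0 w Z → ∫ x in dom K, ⟪A x (G x), Z x⟫_ℝ = 0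

/-- `Λ : H^{1/2}(∂B₁) → H^{-1/2}(∂B₁)` is the Dirichlet-to-Neumann map `φ ↦ A∇u · n` on `∂B₁`
of the conductivity `A` in `B₁` with insulating core `K` (no core if `K = ∅`): boundary
functions extend to `H¹(B₁ ∖ K)`, the boundary value problem is solvable for all data, and the flux of its solution acts as
`⟨Λ φ, ψ⟩ = ∫ A∇u·∇w` for any `w ∈ H¹(B₁ ∖ K)` with `w = ψ` on `∂B₁`. -/
def IsDtN {d : ℕ} (K : Set (E d)) (A : E d → E d →L[ℝ] E d)
    (Λ : Hhalf d →L[ℝ] HnegHalf d) : Prop :=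
  (∀ ψ : Hhalf d, ∃ w Z, IsExt K ψ.toL2 w Z) ∧
  ∀ φ : Hhalf d, (∃ u G, IsWeakSol K A φ.toL2 u G) ∧
    ∀ u G, IsWeakSol K A φ.toL2 u G →
      ∀ (ψ : Hhalf d) (w : E d → ℝ) (Z : E d → E d), IsExt K ψ.toL2 w Z →
        Λ φ ψ = ∫ x in dom K, ⟪A x (G x), Z x⟫_ℝ

/-- The scalar (isotropic) conductivity `γ`. -/
def iso {d : ℕ} (γ : E d → ℝ) (x : E d) : E d →L[ℝ] E d := γ x • ContinuousLinearMap.id ℝ (E d)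

/-! ### Coated structures and their contracted generalized polarization tensors -/

/-- A radial coating of the insulating core `B₁` inside `B₂`: radii
`2 = r 0 > r 1 > ⋯ > r L = 1` and positive conductivities `s j` in `r (j+1) < |x| ≤ r j`. -/
structure Coating where
  L : ℕ
  r : Fin (L + 1) → ℝ
  s : Fin L → ℝ
  r_anti : StrictAnti r
  r_outer : r 0 = 2
  r_core : r (Fin.last L) = 1
  s_pos : ∀ j, 0 < s j

/-- The conductivity distribution: `1` outside `B₂`, `s j` in the layers, `0` in the core. -/
def Coating.sigma (S : Coating) {d : ℕ} (x : E d) : ℝ :=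
  {x : E d | 2 < ‖x‖}.indicator 1 x
    + ∑ j : Fin S.L, {x : E d | S.r j.succ < ‖x‖ ∧ ‖x‖ ≤ S.r j.castSucc}.indicator
        (fun _ => S.s j) x

/-- Laplacian of a polynomial in `d` variables. -/
def polyLaplacian (d : ℕ) : MvPolynomial (Fin d) ℝ →ₗ[ℝ] MvPolynomial (Fin d) ℝ :=
  ∑ i : Fin d, ((MvPolynomial.pderiv i).toLinearMap ∘ₗ (MvPolynomial.pderiv i).toLinearMap)

/-- Homogeneous harmonic polynomials of degree `k`: the span of `rᵏ cos kθ`, `rᵏ sin kθ` for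
`d = 2`, and of the solid harmonics `rᵏ Y_k^l`, `|l| ≤ k`, for `d = 3`. -/
def Harm (d k : ℕ) : Submodule ℝ (MvPolynomial (Fin d) ℝ) :=
  MvPolynomial.homogeneousSubmodule (Fin d) ℝ k ⊓ LinearMap.ker (polyLaplacian d)

/-- The value of a harmonic polynomial at a point. -/
def harmVal {d k : ℕ} (P : Harm d k) (x : E d) : ℝ := MvPolynomial.eval (fun i => x i) P.1

/-- `u` solves `∇·(σ∇u) = 0` in `ℝᵈ` in the presence of the background field `H`:
`u` is locally `H¹` up to the insulating core `B₁`, with zero flux there (test functions need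
not vanish on the core), and `u - H = O(|x|⁻¹)` at infinity. Outside the closed structure, where
`u` is harmonic, its continuous representative is taken. -/
def IsFieldSol {d : ℕ} (S : Coating) (H u : E d → ℝ) : Prop :=
  ∃ G : E d → E d,
    (∀ R : ℝ, IsH1 (ball 0 R \ closedBall 0 1) u G) ∧
    (∀ ψ : E d → ℝ, IsTest ψ →
      ∫ x in (closedBall (0 : E d) 1)ᶜ, S.sigma x * fderiv ℝ ψ x (G x) = 0) ∧
    ContinuousOn u {x | 2 < ‖x‖} ∧
    (fun x => u x - H x) =O[Bornology.cobounded (E d)] fun x => ‖x‖⁻¹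

/-- Normalising factor of the order `m` term in the multipole expansion. -/
def cgptFactor (d m : ℕ) : ℝ :=
  if d = 2 then -1 / (2 * Real.pi * m) else 1 / (2 * m + 1)

/-- Multipole expansion `w(x) = ∑_{m ≥ 1} c_m h_m(x) / |x|^{2m+d-2}` for large `|x|`, with `h_m` a
homogeneous harmonic polynomial of degree `m`: so `h_m(x) / |x|^{2m+d-2}` is a combination of
`cos mθ / rᵐ`, `sin mθ / rᵐ` for `d = 2`, and of `Y_m^n / r^{m+1}` for `d = 3`. (The summation
index below is `m - 1`.) -/
def IsMultipole {d : ℕ} (w : E d → ℝ) (h : ∀ m, Harm d m) : Prop :=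
  ∀ᶠ x in Bornology.cobounded (E d),
    HasSum (fun m : ℕ => cgptFactor d (m + 1) * (harmVal (h (m + 1)) x / ‖x‖ ^ (2 * m + d))) (w x)

/-- `M` is the block of order `(m, k)` of contracted generalized polarization tensors (CGPTs),
as a linear map: in bases of `Harm d k` and `Harm d m` its entries are the CGPTs
`M_{mk}^{cc}, M_{mk}^{cs}, …` (`d = 2`) or `M_{mk}^{nl}` (`d = 3`). It maps a background
field `H` of degree `k` to the order `m` coefficient of the multipole expansion of `u - H`. -/
def IsCGPTBlock (S : Coating) {d : ℕ} (m k : ℕ) (M : Harm d k →ₗ[ℝ] Harm d m) : Prop :=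
  ∀ (H : Harm d k) (u : E d → ℝ), IsFieldSol S (harmVal H) u →
    ∀ h : ∀ m, Harm d m, IsMultipole (fun x => u x - harmVal H x) h → h m = M H

/-- GPT-vanishing structure of order `N` in `ℝᵈ`: all CGPTs of orders `1 ≤ m, k ≤ N` vanish. -/
def GPTVanishing (S : Coating) (d N : ℕ) : Prop :=
  ∀ m k : ℕ, 1 ≤ m → m ≤ N → 1 ≤ k → k ≤ N →
    IsCGPTBlock S m k (0 : Harm d k →ₗ[ℝ] Harm d m)

/-! ### The blow-up map and the push-forward -/

/-- The exponent `α(ρ) = ln(3/2) / (ln(3/4) - ln ρ)`. -/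
def blowExp (ρ : ℝ) : ℝ := Real.log (3 / 2) / (Real.log (3 / 4) - Real.log ρ)

/-- The radial profile `g` of the blow-up map. -/
def blowProfile (ρ t : ℝ) : ℝ :=
  if t ≤ ρ then t / (2 * ρ)
  else if t ≤ 3 / 4 then 1 / 2 * (t / ρ) ^ blowExp ρ
  else t

/-- The blow-up map `F(x) = g(|x|) x / |x|`, `F(0) = 0`. -/
def blowUp {d : ℕ} (ρ : ℝ) (x : E d) : E d := (blowProfile ρ ‖x‖ / ‖x‖) • x

/-- Push-forward `(F_* A)(y) = DF(x) A(x) DF(x)ᵀ / det DF(x)`, `x = F⁻¹(y)`, of a conductivity by a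
bijection `F` of the closed unit ball. -/
def pushForward {d : ℕ} (F : E d → E d) (A : E d → E d →L[ℝ] E d) (y : E d) : E d →L[ℝ] E d :=
  let x := Function.invFunOn F (closedBall 0 1) y
  let DF := fderiv ℝ F x
  DF.det⁻¹ • (DF ∘L A x ∘L ContinuousLinearMap.adjoint DF)

/-- The conductivity `σ ∘ Ψ_{1/ρ}`, `Ψ_{1/ρ}(x) = x / ρ`: insulating core `B_ρ`, coating in
`B_{2ρ} ∖ B_ρ`, and `1` elsewhere. -/
def scaledSigma (S : Coating) {d : ℕ} (ρ : ℝ) (x : E d) : ℝ := S.sigma (ρ⁻¹ • x)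

end Cloak

end

noncomputable section
namespace Cloak

open MeasureTheory Metric Filter Topology Asymptotics
open scoped ContDiff InnerProductSpace

/-! ### Weak gradients and traces -/

/-! Write `e = d - 2`. The structure, the dilation and the blow-up map are all radial, so both
Dirichlet-to-Neumann maps are diagonal in spherical harmonics, and the estimate reduces to a
comparison of eigenvalues. On a harmonic polynomial `p` of degree `k`, the Laplacian has eigenvalue
`k`, by Euler's identity.

In the unscaled structure the field attached to `p` is `v(r) r^{-k} p(x)`, and its flux is governed
by a potential `c`. The pair solves `r v' = k(k+e) c / (σ r^e)`, `r c' = σ r^e v`, starting from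
`v(1) = 1`, `c(1) = 0`; the second condition says that no flux enters the insulating core
(`Profile`, `Coating.exists_profile`). Dilation and push-forward only change the radial variable, so
composing `v` and `c` with `cloakTau` gives the solution in the cloak, and the eigenvalue there is
`λ_k = k(k+e) ρ^e c(1/ρ) / v(1/ρ)` (`IsDtN.apply_cloak`). Outside the coating `v = A r^k + B
r^{-(k+e)}`, hence `λ_k - k = -(2k+e) B ρ^{2k+e} / (A + B ρ^{2k+e})`.

Up to a normalising factor, `B/A` is what the diagonal CGPT block of order `k` measures, so it
vanishes for `1 ≤ k ≤ N` (`GPTVanishing.coeff_eq_zero`). For `k > N`, the signs `v > 0` and `c ≥ 0`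
propagate from the core through the layers and force `|B| ≤ 2^{2k+e} A` (`lay_invariants`,
`lay_coeff`). Therefore `|λ_k - k|` is at most a constant times `k (2ρ)^{2N+2+e}`, and `2N+2+e =
2N+d`. The denominator is controlled this way for `ρ ≤ 1/4`; for larger `ρ` the bound `0 ≤ λ_k ≤ M
k` suffices, because `ρ^{2N+d}` is then bounded below.

To pass to the operator norm, `|λ_k - k| ≤ ε k` for all `k` yields `|(Λ - Λ₁)(φ, φ)| ≤ ε Λ₁(φ, φ) ≤
ε ‖φ‖²` on finite sums of harmonics. These are dense in `H^{1/2}` (`harmTrace_dense`), and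
polarisation of symmetric forms finishes the argument (`norm_sub_le_of_eigenvalues`).

Well-posedness is Lax–Milgram on the space of gradients of functions with zero outer trace, which is
closed by a Poincaré inequality (`poincare`). The ellipticity constants of the cloak depend on `ρ`,
but they serve only for existence at fixed `ρ`. Since traces are defined by Green's formula,
separated fields are shown to have the right trace by a divergence theorem for Lipschitz functions
(`integral_ball_lineDeriv`), and their fluxes are tested against arbitrary `H¹` functions by
smoothing (`IsPW.integral_flux`). -/

lemma inner_eq_sum {d : ℕ} (x y : E d) : ⟪x, y⟫_ℝ = ∑ i, x i * y i := by
  rw [PiLp.inner_apply]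
  exact Finset.sum_congr rfl fun i _ => by simp [mul_comm]

lemma inner_single {d : ℕ} (x : E d) (i : Fin d) :
    ⟪x, EuclideanSpace.single i (1 : ℝ)⟫_ℝ = x i := by
  simp [EuclideanSpace.inner_single_right]

lemma dom_subset {d : ℕ} (K : Set (E d)) : dom K ⊆ ball 0 1 := Set.sdiff_subset

lemma measurableSet_dom {d : ℕ} {K : Set (E d)} (hK : IsClosed K) : MeasurableSet (dom K) :=
  measurableSet_ball.diff hK.measurableSet

instance {d : ℕ} (K : Set (E d)) : IsFiniteMeasure ((volume : Measure (E d)).restrict (dom K)) :=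
  ⟨by
    rw [Measure.restrict_apply_univ]
    exact (measure_mono (dom_subset K)).trans_lt measure_ball_lt_top⟩

/-- Green's formula with a boundary term contains the defining property of the weak gradient. -/
lemma IsExt.of_trace {d : ℕ} {K : Set (E d)} {φ : Lp ℝ 2 (surf d)} {u : E d → ℝ}
    {G : E d → E d} (hu : MemLp u 2 (volume.restrict (dom K)))
    (hG : MemLp G 2 (volume.restrict (dom K))) (h : HasTrace K u G φ) : IsExt K φ u G := by
  refine ⟨⟨hu, hG, fun ψ hψ hs v => ?_⟩, h⟩
  have hd : Disjoint (tsupport ψ) K := Set.disjoint_left.2 fun x hx => (hs hx).2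
  have e := h ψ hψ hd v
  rw [integral_add (integrable_u hu hψ v) (integrable_G hG hψ v)] at e
  have z : ∫ y, φ y * (ψ (y : E d) * ⟪(y : E d), v⟫_ℝ) ∂(surf d) = 0 := by
    rw [integral_congr_ae (g := fun _ => (0 : ℝ)) (Eventually.of_forall fun y => ?_)]
    · simp
    · have : ψ (y : E d) = 0 := by
        by_contra hne
        have := dom_subset K (hs (subset_tsupport _ (Function.mem_support.2 hne)))
        have hy := y.2
        rw [mem_ball] at this
        rw [mem_sphere] at hy
        linarith
      simp [this]
  linarith [e.trans z]

lemma IsExt.congr {d : ℕ} {K : Set (E d)} {φ : Lp ℝ 2 (surf d)} {u u' : E d → ℝ}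
    {G G' : E d → E d} (h : IsExt K φ u G) (hu : u =ᵐ[volume.restrict (dom K)] u')
    (hG : G =ᵐ[volume.restrict (dom K)] G') : IsExt K φ u' G' := by
  refine IsExt.of_trace (h.h1.memLp.ae_eq hu) (h.h1.memLp_grad.ae_eq hG) fun ψ hψ hs v => ?_
  rw [← h.trace ψ hψ hs v]
  refine integral_congr_ae ?_
  filter_upwards [hu, hG] with x h1 h2
  rw [h1, h2]

lemma IsExt.sub {d : ℕ} {K : Set (E d)} {φ₁ φ₂ : Lp ℝ 2 (surf d)} {u₁ u₂ : E d → ℝ}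
    {G₁ G₂ : E d → E d} (h₁ : IsExt K φ₁ u₁ G₁) (h₂ : IsExt K φ₂ u₂ G₂) :
    IsExt K (φ₁ - φ₂) (u₁ - u₂) (G₁ - G₂) := by
  have := h₁.add (h₂.smul (-1))
  simpa [sub_eq_add_neg] using this

/-- A function with a trace on the ball restricts to the ball minus a core. -/
lemma IsExt.restrict {d : ℕ} {K : Set (E d)} {φ : Lp ℝ 2 (surf d)}
    {u : E d → ℝ} {G : E d → E d} (h : IsExt ∅ φ u G) : IsExt K φ u G := by
  have hsub : dom K ⊆ dom (∅ : Set (E d)) := Set.sdiff_subset_sdiff_right (Set.empty_subset K)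
  refine IsExt.of_trace (h.h1.memLp.mono_measure (Measure.restrict_mono_set _ hsub))
    (h.h1.memLp_grad.mono_measure (Measure.restrict_mono_set _ hsub)) fun ψ hψ hs v => ?_
  rw [← h.trace ψ hψ (Set.disjoint_empty _) v]
  refine (setIntegral_eq_of_subset_of_forall_sdiff_eq_zero
    (measurableSet_dom isClosed_empty) hsub fun x hx => ?_).symm
  have hxK : x ∈ K := by
    by_contra hn
    exact hx.2 ⟨hx.1.1, hn⟩
  have hxs : x ∉ tsupport ψ := fun hn => Set.disjoint_left.1 hs hn hxK
  rw [image_eq_zero_of_notMem_tsupport hxs,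
    image_eq_zero_of_notMem_tsupport fun hn => hxs (tsupport_fderiv_subset ℝ hn)]
  simp

/-- The divergence of a vector field. -/
def divg {d : ℕ} (J : E d → E d) (x : E d) : ℝ :=
  ∑ i, fderiv ℝ (fun z => J z i) x (EuclideanSpace.single i 1)

/-- Green's formula for smooth vector fields vanishing near the core. -/
lemma IsExt.divergence {d : ℕ} {K : Set (E d)} (hK : IsClosed K) {φ : Lp ℝ 2 (surf d)} {u : E d → ℝ}
    {G : E d → E d} (h : IsExt K φ u G) {J : E d → E d} (hJ : ContDiff ℝ ∞ J)
    (hs : Disjoint (tsupport J) K) :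
    ∫ x in dom K, (u x * divg J x + ⟪G x, J x⟫_ℝ)
      = ∫ y, φ y * ⟪J (y : E d), (y : E d)⟫_ℝ ∂(surf d) := by
  -- The trace identity needs compactly supported test functions. The cutoff is `1` near the closed
  -- unit ball, so it changes neither the integrands nor the boundary values.
  let χ : ContDiffBump (0 : E d) := ⟨2, 3, by norm_num, by norm_num⟩
  have hJi : ∀ i, ContDiff ℝ ∞ fun x => J x i := contDiff_euclidean.1 hJ
  let ψ : Fin d → E d → ℝ := fun i x => χ x * J x i
  have hψ : ∀ i, IsTest (ψ i) := fun i => ⟨χ.contDiff.mul (hJi i), χ.hasCompactSupport.mul_right⟩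
  have hψs : ∀ i, Disjoint (tsupport (ψ i)) K := fun i => by
    refine hs.mono_left (closure_mono fun x hx => ?_)
    rw [Function.mem_support] at hx ⊢
    intro h0
    exact hx (by simp [ψ, h0])
  have hχ : ∀ x : E d, ‖x‖ ≤ 1 → χ =ᶠ[𝓝 x] 1 := fun x hx =>
    χ.eventuallyEq_one_of_mem_ball (by rw [mem_ball_zero_iff]; exact lt_of_le_of_lt hx (by norm_num [χ]))
  have e := Finset.sum_congr (rfl : (Finset.univ : Finset (Fin d)) = Finset.univ) fun i _ =>
    h.trace (ψ i) (hψ i) (hψs i) (EuclideanSpace.single i 1)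
  have hIntg : ∀ i, Integrable (fun x => u x * fderiv ℝ (ψ i) x (EuclideanSpace.single i 1)
      + ⟪G x, EuclideanSpace.single i 1⟫_ℝ * ψ i x) (volume.restrict (dom K)) := fun i =>
    (integrable_u h.h1.memLp (hψ i) _).add (integrable_G h.h1.memLp_grad (hψ i) _)
  rw [← integral_finsetSum _ fun i _ => hIntg i,
    ← integral_finsetSum _ fun i _ => integrable_phi φ (hψ i) _] at e
  have e1 : ∫ x in dom K, (u x * divg J x + ⟪G x, J x⟫_ℝ) = ∫ x in dom K, ∑ i,
      (u x * fderiv ℝ (ψ i) x (EuclideanSpace.single i 1)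
        + ⟪G x, EuclideanSpace.single i 1⟫_ℝ * ψ i x) := by
    refine setIntegral_congr_fun (measurableSet_dom hK) fun x hx => ?_
    have hx1 : ‖x‖ ≤ 1 := (mem_ball_zero_iff.1 (dom_subset K hx)).le
    have hf : ∀ i, fderiv ℝ (ψ i) x = fderiv ℝ (fun z => J z i) x := fun i => by
      refine Filter.EventuallyEq.fderiv_eq ?_
      filter_upwards [hχ x hx1] with z hz
      simp [ψ, hz]
    have hv : ∀ i, ψ i x = J x i := fun i => by simp [ψ, (hχ x hx1).self_of_nhds]
    simp only [hf, hv, inner_single, divg, inner_eq_sum (G x) (J x), Finset.mul_sum,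
      Finset.sum_add_distrib]
  rw [e1, e]
  refine integral_congr_ae (Eventually.of_forall fun y => ?_)
  have hy1 : ‖(y : E d)‖ ≤ 1 := (mem_sphere_zero_iff_norm.1 y.2).le
  have hv : ∀ i, ψ i (y : E d) = J y i := fun i => by simp [ψ, (hχ _ hy1).self_of_nhds]
  simp only [hv, inner_single, inner_eq_sum (J y) y, Finset.mul_sum]

/-! ### Polynomial functions -/

/-- The polynomial function of `p`. -/
def pv {d : ℕ} (p : MvPolynomial (Fin d) ℝ) (x : E d) : ℝ := MvPolynomial.eval (fun i => x i) p

/-- The gradient of the polynomial function of `p`. -/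
def pg {d : ℕ} (p : MvPolynomial (Fin d) ℝ) (x : E d) : E d :=
  WithLp.toLp 2 fun i => pv (MvPolynomial.pderiv i p) x

@[simp] lemma pg_apply {d : ℕ} (p : MvPolynomial (Fin d) ℝ) (x : E d) (i : Fin d) :
    pg p x i = pv (MvPolynomial.pderiv i p) x := rfl

@[simp] lemma pv_add {d : ℕ} (p q : MvPolynomial (Fin d) ℝ) (x : E d) :
    pv (p + q) x = pv p x + pv q x := by simp [pv]

@[simp] lemma pv_mul {d : ℕ} (p q : MvPolynomial (Fin d) ℝ) (x : E d) :
    pv (p * q) x = pv p x * pv q x := by simp [pv]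

@[simp] lemma pv_smul {d : ℕ} (c : ℝ) (q : MvPolynomial (Fin d) ℝ) (x : E d) :
    pv (c • q) x = c * pv q x := by simp [pv, MvPolynomial.smul_eval]

@[simp] lemma pv_X {d : ℕ} (i : Fin d) (x : E d) : pv (MvPolynomial.X i) x = x i := by simp [pv]

@[simp] lemma pv_C {d : ℕ} (c : ℝ) (x : E d) : pv (MvPolynomial.C c) x = c := by simp [pv]

@[simp] lemma pv_zero {d : ℕ} (x : E d) : pv (0 : MvPolynomial (Fin d) ℝ) x = 0 := by simp [pv]

lemma pv_sum {d : ℕ} {ι : Type*} (s : Finset ι) (f : ι → MvPolynomial (Fin d) ℝ) (x : E d) :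
    pv (∑ i ∈ s, f i) x = ∑ i ∈ s, pv (f i) x := by simp [pv]

lemma contDiff_pv {d : ℕ} (p : MvPolynomial (Fin d) ℝ) : ContDiff ℝ ∞ (pv p) := by
  induction p using MvPolynomial.induction_on with
  | C a => simpa [funext (pv_C a)] using contDiff_const
  | add p q hp hq => simpa [funext (pv_add p q)] using hp.add hq
  | mul_X p i hp =>
    have : ContDiff ℝ ∞ fun x : E d => x i := by fun_prop
    simpa [funext (pv_mul p _)] using hp.mul this

lemma contDiff_pg {d : ℕ} (p : MvPolynomial (Fin d) ℝ) : ContDiff ℝ ∞ (pg p) :=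
  contDiff_euclidean.2 fun _ => contDiff_pv _

lemma hasFDerivAt_pv {d : ℕ} (p : MvPolynomial (Fin d) ℝ) (x : E d) :
    HasFDerivAt (pv p) (innerSL ℝ (pg p x)) x := by
  induction p using MvPolynomial.induction_on with
  | C a =>
    have : innerSL ℝ (pg (MvPolynomial.C a) x) = 0 := by
      ext v; simp [inner_eq_sum]
    rw [this, funext (pv_C a)]
    exact hasFDerivAt_const _ _
  | add p q hp hq =>
    have : innerSL ℝ (pg (p + q) x) = innerSL ℝ (pg p x) + innerSL ℝ (pg q x) := by
      ext v; simp [inner_eq_sum, add_mul, Finset.sum_add_distrib]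
    rw [this, funext (pv_add p q)]
    exact hp.add hq
  | mul_X p i hp =>
    have hX : HasFDerivAt (fun z : E d => z i) (EuclideanSpace.proj i : E d →L[ℝ] ℝ) x :=
      (EuclideanSpace.proj i : E d →L[ℝ] ℝ).hasFDerivAt
    have := hp.mul hX
    have e : innerSL ℝ (pg (p * MvPolynomial.X i) x)
        = pv p x • (EuclideanSpace.proj i : E d →L[ℝ] ℝ) + x i • innerSL ℝ (pg p x) := by
      ext v
      have h1 : ∀ j, pv (MvPolynomial.pderiv j (p * MvPolynomial.X i)) x * v j
          = x i * (pv (MvPolynomial.pderiv j p) x * v j) + pv p x * (if j = i then v j else 0) := by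
        intro j
        rw [Derivation.leibniz]
        by_cases hji : j = i
        · subst hji
          simp
          ring
        · simp [MvPolynomial.pderiv_X_of_ne (Ne.symm hji), hji]
          ring
      have h2 : innerSL ℝ (pg (p * MvPolynomial.X i) x) v
          = ∑ j, pv (MvPolynomial.pderiv j (p * MvPolynomial.X i)) x * v j := inner_eq_sum _ _
      have h3 : innerSL ℝ (pg p x) v = ∑ j, pv (MvPolynomial.pderiv j p) x * v j :=
        inner_eq_sum _ _
      rw [h2, Finset.sum_congr rfl fun j _ => h1 j, Finset.sum_add_distrib, ← Finset.mul_sum,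
        ← Finset.mul_sum, ← h3]
      simp [add_comm]
    rw [e, show pv (p * MvPolynomial.X i) = pv p * fun z => z i from funext fun z => by simp]
    exact this

lemma fderiv_pv {d : ℕ} (p : MvPolynomial (Fin d) ℝ) (x v : E d) :
    fderiv ℝ (pv p) x v = ⟪pg p x, v⟫_ℝ := by
  rw [(hasFDerivAt_pv p x).fderiv]; rfl

lemma polyLaplacian_apply {d : ℕ} (p : MvPolynomial (Fin d) ℝ) :
    polyLaplacian d p = ∑ i, MvPolynomial.pderiv i (MvPolynomial.pderiv i p) := by
  simp [polyLaplacian]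

lemma divg_pg {d : ℕ} (p : MvPolynomial (Fin d) ℝ) (x : E d) :
    divg (pg p) x = pv (polyLaplacian d p) x := by
  simp only [divg, pg_apply, polyLaplacian_apply, pv_sum]
  refine Finset.sum_congr rfl fun i _ => ?_
  rw [show (fun z => pv (MvPolynomial.pderiv i p) z) = pv (MvPolynomial.pderiv i p) from rfl,
    fderiv_pv, inner_single, pg_apply]

lemma harmVal_eq {d k : ℕ} (H : Harm d k) : harmVal H = pv H.1 := rfl

lemma Harm.homog {d k : ℕ} (H : Harm d k) : H.1.IsHomogeneous k :=
  (MvPolynomial.mem_homogeneousSubmodule _ _).1 H.2.1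

lemma Harm.lap {d k : ℕ} (H : Harm d k) : polyLaplacian d H.1 = 0 := H.2.2

/-- Euler's identity. -/
lemma inner_pg_self {d k : ℕ} {p : MvPolynomial (Fin d) ℝ} (hp : p.IsHomogeneous k) (x : E d) :
    ⟪pg p x, x⟫_ℝ = k * pv p x := by
  have := congrArg (fun q => pv q x) hp.sum_X_mul_pderiv
  simp only [pv_sum, pv_mul, pv_X] at this
  rw [inner_eq_sum]
  simp only [pg_apply]
  rw [← nsmul_eq_mul, show k • pv p x = pv (k • p) x by simp [pv], ← this]
  exact Finset.sum_congr rfl fun i _ => mul_comm _ _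

end Cloak

noncomputable section
namespace Cloak

open MeasureTheory Metric Filter Topology Asymptotics
open scoped ContDiff InnerProductSpace

/-! ### The divergence theorem on the unit ball for Lipschitz functions -/

/-- Integration in polar coordinates of a product of an angular and a radial function. -/
lemma integral_polar_mul {d : ℕ} [NeZero d] (h : E d → ℝ) (g : ℝ → ℝ) :
    ∫ x : E d, h (‖x‖⁻¹ • x) * g ‖x‖
      = (∫ y, h (y : E d) ∂(surf d)) * ∫ r in Set.Ioi (0 : ℝ), r ^ (d - 1) * g r := by
  have : Nontrivial (E d) := by
    have : Nonempty (Fin d) := ⟨0⟩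
    infer_instance
  calc
    ∫ x : E d, h (‖x‖⁻¹ • x) * g ‖x‖
      = ∫ x : ({(0)}ᶜ : Set (E d)), h (‖(x : E d)‖⁻¹ • (x : E d)) * g ‖(x : E d)‖
          ∂(volume.comap (Subtype.val : ({(0)}ᶜ : Set (E d)) → E d)) := by
      rw [integral_subtype_comap (measurableSet_singleton _).compl
        fun x : E d ↦ h (‖x‖⁻¹ • x) * g ‖x‖, restrict_compl_singleton]
    _ = ∫ x, h (x.1 : E d) * g (x.2 : ℝ) ∂(surf d).prod (.volumeIoiPow (d - 1)) := by
      have := (volume : Measure (E d)).measurePreserving_homeomorphUnitSphereProd.integral_comp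
        (Homeomorph.measurableEmbedding _) fun x => h (x.1 : E d) * g (x.2 : ℝ)
      simpa using this
    _ = _ := by
      rw [integral_prod_mul (fun y : sphere (0 : E d) 1 => h y) (fun r : Set.Ioi (0 : ℝ) => g r)]
      congr 1
      simp only [Measure.volumeIoiPow, ENNReal.ofReal]
      rw [integral_withDensity_eq_integral_smul,
        integral_subtype_comap measurableSet_Ioi fun a ↦ Real.toNNReal (a ^ (d - 1)) • g a,
        setIntegral_congr_fun measurableSet_Ioi fun x hx ↦ ?_]
      · rw [NNReal.smul_def, Real.coe_toNNReal _ (pow_nonneg hx.out.le _), smul_eq_mul]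
      · exact (measurable_subtype_coe.pow_const _).real_toNNReal

/-- The radial cutoff which is `1` in the ball of radius `1 - 1/n` and `0` outside the unit ball. -/
def ramp (n : ℕ) (r : ℝ) : ℝ := max 0 (min 1 ((n + 1) * (1 - r)))

lemma ramp_lipschitz (n : ℕ) : LipschitzWith (n + 1) (ramp n) := by
  have h : LipschitzWith (n + 1) fun r : ℝ => (n + 1 : ℝ) * (1 - r) := by
    refine LipschitzWith.of_dist_le_mul fun x y => ?_
    simp only [Real.dist_eq]
    rw [show ((n : ℝ) + 1) * (1 - x) - (n + 1) * (1 - y) = (n + 1) * (y - x) by ring, abs_mul,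
      abs_of_pos (by positivity : (0 : ℝ) < n + 1), abs_sub_comm]
    simp
  exact (h.const_min 1).const_max 0

lemma ramp_of_one_le {n : ℕ} {r : ℝ} (h : 1 ≤ r) : ramp n r = 0 := by
  refine max_eq_left ((min_le_right _ _).trans ?_)
  nlinarith [(by positivity : (0 : ℝ) ≤ n)]

lemma ramp_of_le {n : ℕ} {r : ℝ} (h : r ≤ 1 - 1 / (n + 1)) : ramp n r = 1 := by
  have hn : (0 : ℝ) < n + 1 := by positivity
  have : 1 ≤ (n + 1 : ℝ) * (1 - r) := by
    have h2 : 1 / (n + 1 : ℝ) ≤ 1 - r := by linarith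
    rwa [div_le_iff₀' hn] at h2
  rw [ramp, min_eq_left this]; simp

lemma ramp_of_mem {n : ℕ} {r : ℝ} (h : 1 - 1 / (n + 1) ≤ r) (h' : r ≤ 1) :
    ramp n r = (n + 1) * (1 - r) := by
  have hn : (0 : ℝ) < n + 1 := by positivity
  have : (n + 1 : ℝ) * (1 - r) ≤ 1 := by
    have h2 : 1 - r ≤ 1 / (n + 1 : ℝ) := by linarith
    rwa [le_div_iff₀' hn] at h2
  rw [ramp, min_eq_right this, max_eq_right]
  exact mul_nonneg hn.le (by linarith)

lemma ramp_mem_Icc (n : ℕ) (r : ℝ) : ramp n r ∈ Set.Icc (0 : ℝ) 1 :=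
  ⟨le_max_left _ _, max_le zero_le_one (min_le_left _ _)⟩

/-- The cutoff falls with slope `n + 1` across a thin shell and is constant elsewhere. The direction
`-v` is the one produced by integration by parts. The excluded points, where the norm or the cutoff
may fail to be differentiable, form a null set. -/
lemma lineDeriv_ramp {d : ℕ} (n : ℕ) {x : E d} (v : E d) (h1 : ‖x‖ ≠ 1)
    (h2 : ‖x‖ ≠ 1 - 1 / (n + 1)) (h0 : x ≠ 0) :
    lineDeriv ℝ (fun x : E d => ramp n ‖x‖) x (-v)
      = ⟪‖x‖⁻¹ • x, v⟫_ℝ * (Set.Ioo (1 - 1 / (n + 1 : ℝ)) 1).indicator (fun _ => (n + 1 : ℝ)) ‖x‖ := by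
  have hcn : Tendsto (fun x : E d => ‖x‖) (𝓝 x) (𝓝 ‖x‖) := continuous_norm.continuousAt
  have hconst : ∀ c : ℝ, (fun x : E d => ramp n ‖x‖) =ᶠ[𝓝 x] (fun _ => c) →
      lineDeriv ℝ (fun x : E d => ramp n ‖x‖) x (-v) = 0 := fun c hc => by
    have : HasFDerivAt (fun x : E d => ramp n ‖x‖) (0 : E d →L[ℝ] ℝ) x :=
      (hasFDerivAt_const c x).congr_of_eventuallyEq hc
    simpa using (this.hasLineDerivAt (-v)).lineDeriv
  rcases lt_or_gt_of_ne h1 with h1 | h1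
  · rcases lt_or_gt_of_ne h2 with h2 | h2
    · rw [hconst 1, Set.indicator_of_notMem (fun hm => by linarith [hm.1]), mul_zero]
      filter_upwards [hcn.eventually_lt_const h2] with z hz
      exact ramp_of_le hz.le
    · have hd : HasFDerivAt (fun z : E d => ((n : ℝ) + 1) * (1 - ‖z‖))
          (((n : ℝ) + 1) • -(‖x‖⁻¹ • innerSL ℝ x)) x := by
        refine (HasFDerivAt.const_sub ?_ 1).const_mul _
        have := (hasStrictFDerivAt_norm_sq x).hasFDerivAt.sqrt (by simpa using h0)
        have h3 : (fun z : E d => √(‖z‖ ^ 2)) = fun z => ‖z‖ := by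
          funext z; exact Real.sqrt_sq (norm_nonneg _)
        rw [h3] at this
        refine this.congr_fderiv ?_
        ext w
        simp [Real.sqrt_sq (norm_nonneg x)]
        field_simp
      have := hd.congr_of_eventuallyEq (f₁ := fun z : E d => ramp n ‖z‖) (by
        filter_upwards [hcn.eventually_lt_const h1, hcn.eventually_const_lt h2] with z hz hz'
        exact ramp_of_mem hz'.le hz.le)
      rw [(this.hasLineDerivAt (-v)).lineDeriv, Set.indicator_of_mem (Set.mem_Ioo.2 ⟨h2, h1⟩)]
      simp [inner_smul_left]
      ring
  · rw [hconst 0, Set.indicator_of_notMem (fun hm => by linarith [hm.2]), mul_zero]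
    filter_upwards [hcn.eventually_const_lt h1] with z hz
    exact ramp_of_one_le hz.le

/-- The weight concentrates at `r = 1` with total mass tending to one: up to the factor `1/d`, the
integral is the difference quotient at `0` of `-(1 - t)^d`. -/
lemma tendsto_mul_one_sub_pow (d : ℕ) [NeZero d] :
    Tendsto (fun n : ℕ => ∫ r in Set.Ioi (0 : ℝ), r ^ (d - 1) *
      (Set.Ioo (1 - 1 / (n + 1 : ℝ)) 1).indicator (fun _ => (n + 1 : ℝ)) r) atTop (𝓝 1) := by
  have hd : d - 1 + 1 = d := Nat.sub_add_cancel (NeZero.one_le)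
  have hd0 : (d : ℝ) ≠ 0 := NeZero.ne _
  have key : ∀ n : ℕ, ∫ r in Set.Ioi (0 : ℝ), r ^ (d - 1) *
      (Set.Ioo (1 - 1 / (n + 1 : ℝ)) 1).indicator (fun _ => (n + 1 : ℝ)) r
      = (d : ℝ)⁻¹ * ((1 / (n + 1 : ℝ))⁻¹ * (1 - (1 - 1 / (n + 1 : ℝ)) ^ d)) := fun n => by
    have hn : (0 : ℝ) < n + 1 := by positivity
    have hle : 1 / (n + 1 : ℝ) ≤ 1 := by rw [div_le_one hn]; linarith [(by positivity : (0 : ℝ) ≤ n)]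
    have e : (fun r : ℝ => r ^ (d - 1) *
        (Set.Ioo (1 - 1 / (n + 1 : ℝ)) 1).indicator (fun _ => (n + 1 : ℝ)) r)
        = (Set.Ioo (1 - 1 / (n + 1 : ℝ)) 1).indicator fun r => r ^ (d - 1) * (n + 1 : ℝ) := by
      funext r
      by_cases hr : r ∈ Set.Ioo (1 - 1 / (n + 1 : ℝ)) 1
      · rw [Set.indicator_of_mem hr, Set.indicator_of_mem hr]
      · rw [Set.indicator_of_notMem hr, Set.indicator_of_notMem hr, mul_zero]
    have hsub : Set.Ioi (0 : ℝ) ∩ Set.Ioo (1 - 1 / (n + 1 : ℝ)) 1 = Set.Ioo (1 - 1 / (n + 1 : ℝ)) 1 :=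
      Set.inter_eq_right.2 fun r hr => lt_of_le_of_lt (by linarith) hr.1
    rw [e, setIntegral_indicator measurableSet_Ioo, hsub, ← integral_Ioc_eq_integral_Ioo,
      ← intervalIntegral.integral_of_le (by linarith [one_div_pos.2 hn]),
      intervalIntegral.integral_mul_const, integral_pow]
    have : ((d - 1 : ℕ) : ℝ) + 1 = d := by exact_mod_cast hd
    rw [hd, this, one_pow]
    field_simp
  simp_rw [key]
  have hder : HasDerivAt (fun t : ℝ => -(1 - t) ^ d) (d : ℝ) 0 := by
    have := ((((hasDerivAt_id (0 : ℝ)).const_sub 1).pow d)).neg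
    simpa [Function.comp_def, Pi.neg_def, Pi.pow_def] using this
  have hs : Tendsto (fun n : ℕ => 1 / (n + 1 : ℝ)) atTop (𝓝[≠] 0) :=
    tendsto_nhdsWithin_iff.2 ⟨tendsto_one_div_add_atTop_nhds_zero_nat,
      Eventually.of_forall fun n => by
        simp only [Set.mem_compl_iff, Set.mem_singleton_iff]; positivity⟩
  have := (hder.tendsto_slope_zero.comp hs).const_mul (d : ℝ)⁻¹
  rw [inv_mul_cancel₀ hd0] at this
  refine this.congr fun n => ?_
  simp
  ring_nf
  simp

/-- The divergence theorem on the unit ball. -/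
theorem integral_ball_lineDeriv {d : ℕ} [NeZero d] {C : NNReal} {w : E d → ℝ}
    (hw : LipschitzWith C w) (v : E d) :
    ∫ x in ball (0 : E d) 1, lineDeriv ℝ w x v
      = ∫ y, w (y : E d) * ⟪(y : E d), v⟫_ℝ ∂(surf d) := by
  let χ : ℕ → E d → ℝ := fun n x => ramp n ‖x‖
  have hχL : ∀ n : ℕ, LipschitzWith ((n + 1) * 1) (χ n) := fun n =>
    (ramp_lipschitz n).comp lipschitzWith_one_norm
  have hχ0 : ∀ n x, 1 ≤ ‖x‖ → χ n x = 0 := fun n x hx => ramp_of_one_le hx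
  have hχc : ∀ n, HasCompactSupport (χ n) := fun n =>
    HasCompactSupport.intro (isCompact_closedBall (0 : E d) 1) fun x hx => hχ0 n x (by
      rw [mem_closedBall_zero_iff, not_le] at hx; exact hx.le)
  have hibp : ∀ n, ∫ x, lineDeriv ℝ w x v * χ n x = ∫ x, lineDeriv ℝ (χ n) x (-v) * w x :=
    fun n => hw.integral_lineDeriv_mul_eq (hχL n) (hχc n) v
  have hwm : AEStronglyMeasurable (fun x => lineDeriv ℝ w x v) volume :=
    aestronglyMeasurable_lineDeriv hw.continuous _
  have hleft : Tendsto (fun n => ∫ x, lineDeriv ℝ w x v * χ n x) atTop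
      (𝓝 (∫ x in ball (0 : E d) 1, lineDeriv ℝ w x v)) := by
    rw [← integral_indicator measurableSet_ball]
    refine tendsto_integral_of_dominated_convergence
      ((ball (0 : E d) 1).indicator fun _ => C * ‖v‖) (fun n => ?_) ?_ (fun n => ?_) ?_
    · exact hwm.mul (hχL n).continuous.aestronglyMeasurable
    · exact (integrable_indicator_iff measurableSet_ball).2 (integrableOn_const measure_ball_lt_top.ne)
    · refine Eventually.of_forall fun x => ?_
      by_cases hx : x ∈ ball (0 : E d) 1
      · rw [Set.indicator_of_mem hx, norm_mul]
        have h1 : ‖χ n x‖ ≤ 1 := by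
          rw [Real.norm_eq_abs, abs_of_nonneg (ramp_mem_Icc n _).1]; exact (ramp_mem_Icc n _).2
        calc _ ≤ (C * ‖v‖) * 1 := mul_le_mul (norm_lineDeriv_le_of_lipschitz ℝ hw) h1
              (norm_nonneg _) (by positivity)
          _ = _ := mul_one _
      · rw [Set.indicator_of_notMem hx, hχ0 n x (by simpa using hx)]; simp
    · refine Eventually.of_forall fun x => ?_
      by_cases hx : x ∈ ball (0 : E d) 1
      · rw [Set.indicator_of_mem hx]
        have hx1 : 0 < 1 - ‖x‖ := by simpa using hx
        refine tendsto_const_nhds.congr' ?_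
        filter_upwards [(tendsto_one_div_add_atTop_nhds_zero_nat (𝕜 := ℝ)).eventually_lt_const hx1]
          with n hn
        simp only [χ]
        rw [ramp_of_le (by linarith), mul_one]
      · rw [Set.indicator_of_notMem hx]
        refine tendsto_const_nhds.congr fun n => ?_
        rw [hχ0 n x (by simpa using hx), mul_zero]
  let gn : ℕ → ℝ → ℝ := fun n =>
    (Set.Ioo (1 - 1 / (n + 1 : ℝ)) 1).indicator (fun _ => (n + 1 : ℝ))
  have hrew : ∀ n, ∫ x, lineDeriv ℝ (χ n) x (-v) * w x
      = ∫ x : E d, (⟪‖x‖⁻¹ • x, v⟫_ℝ * gn n ‖x‖) * w x := fun n => by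
    refine integral_congr_ae ?_
    have n1 := Measure.addHaar_sphere (volume : Measure (E d)) 0 1
    have n2 := Measure.addHaar_sphere (volume : Measure (E d)) 0 (1 - 1 / (n + 1))
    have n3 := Measure.addHaar_sphere (volume : Measure (E d)) 0 0
    filter_upwards [compl_mem_ae_iff.2 n1, compl_mem_ae_iff.2 n2, compl_mem_ae_iff.2 n3] with x h1 h2 h3
    rw [lineDeriv_ramp n v (by simpa using h1) (by simpa using h2) (by simpa using h3)]
  let h : E d → ℝ := fun y => w y * ⟪y, v⟫_ℝ
  have hmain : Tendsto (fun n => ∫ x : E d, h (‖x‖⁻¹ • x) * gn n ‖x‖) atTop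
      (𝓝 (∫ y, h (y : E d) ∂(surf d))) := by
    simp_rw [integral_polar_mul h]
    have := (tendsto_mul_one_sub_pow d).const_mul (∫ y, h (y : E d) ∂(surf d))
    rwa [mul_one] at this
  have hunit : ∀ x : E d, ‖‖x‖⁻¹ • x‖ ≤ 1 := fun x => by
    rw [norm_smul, norm_inv, norm_norm]
    exact inv_mul_le_one
  have hgm : ∀ n, Measurable fun x : E d => gn n ‖x‖ := fun n =>
    (measurable_const.indicator measurableSet_Ioo).comp measurable_norm
  have hum : Measurable fun x : E d => ‖x‖⁻¹ • x := measurable_norm.inv.smul measurable_id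
  have hhc : Continuous h := hw.continuous.mul (continuous_id.inner continuous_const)
  have hB : ∀ n, Integrable fun x : E d => h (‖x‖⁻¹ • x) * gn n ‖x‖ := fun n => by
    have hb : Integrable ((ball (0 : E d) 1).indicator fun _ => (|w 0| + C) * ‖v‖ * (n + 1)) :=
      (integrable_indicator_iff measurableSet_ball).2 (integrableOn_const measure_ball_lt_top.ne)
    refine hb.mono' ((hhc.measurable.comp hum).mul (hgm n)).aestronglyMeasurable
      (Eventually.of_forall fun x => ?_)
    by_cases hx : ‖x‖ ∈ Set.Ioo (1 - 1 / (n + 1 : ℝ)) 1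
    · rw [Set.indicator_of_mem (mem_ball_zero_iff.2 hx.2)]
      simp only [gn, Set.indicator_of_mem hx, h]
      have h1 : |w (‖x‖⁻¹ • x)| ≤ |w 0| + C := by
        have := hw.dist_le_mul (‖x‖⁻¹ • x) 0
        rw [Real.dist_eq, dist_zero_right] at this
        have h2 := abs_sub_abs_le_abs_sub (w (‖x‖⁻¹ • x)) (w 0)
        have h3 : (C : ℝ) * ‖‖x‖⁻¹ • x‖ ≤ C * 1 := by gcongr; exact hunit x
        linarith
      have h2 : |⟪‖x‖⁻¹ • x, v⟫_ℝ| ≤ ‖v‖ := (abs_real_inner_le_norm _ _).trans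
        (by simpa using mul_le_mul_of_nonneg_right (hunit x) (norm_nonneg v))
      rw [norm_mul, norm_mul, Real.norm_eq_abs, Real.norm_eq_abs, Real.norm_eq_abs,
        abs_of_pos (by positivity : (0 : ℝ) < n + 1)]
      gcongr
    · simp only [gn, Set.indicator_of_notMem hx, mul_zero, norm_zero]
      exact Set.indicator_nonneg (fun _ _ => by positivity) _
  -- The error made by replacing `w x` with its value at the radial projection `x/|x|`. In the shell
  -- that difference is at most `C(1 - |x|) ≤ C/(n+1)`, which absorbs the factor `n + 1`; every
  -- fixed point eventually leaves the shell, so dominated convergence gives limit zero.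
  let D : ℕ → E d → ℝ := fun n x => ⟪‖x‖⁻¹ • x, v⟫_ℝ * (w x - w (‖x‖⁻¹ • x)) * gn n ‖x‖
  have hDm : ∀ n, AEStronglyMeasurable (D n) volume := fun n => by
    have h1 : Measurable fun x : E d => ⟪‖x‖⁻¹ • x, v⟫_ℝ := hum.inner_const
    have h2 : Measurable fun x : E d => w x - w (‖x‖⁻¹ • x) :=
      hw.continuous.measurable.sub (hw.continuous.measurable.comp hum)
    exact ((h1.mul h2).mul (hgm n)).aestronglyMeasurable
  have hbint : Integrable ((ball (0 : E d) 1).indicator fun _ => ‖v‖ * C) :=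
    (integrable_indicator_iff measurableSet_ball).2 (integrableOn_const measure_ball_lt_top.ne)
  have hDb : ∀ n x, ‖D n x‖ ≤ (ball (0 : E d) 1).indicator (fun _ => ‖v‖ * C) x := fun n x => by
    by_cases hx : ‖x‖ ∈ Set.Ioo (1 - 1 / (n + 1 : ℝ)) 1
    · rw [Set.indicator_of_mem (mem_ball_zero_iff.2 hx.2)]
      simp only [D, gn, Set.indicator_of_mem hx]
      have hn : (0 : ℝ) < n + 1 := by positivity
      have hx0 : 0 < ‖x‖ := lt_of_le_of_lt (by
        rw [sub_nonneg, div_le_one hn]; linarith [(by positivity : (0 : ℝ) ≤ n)]) hx.1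
      have h2 : |⟪‖x‖⁻¹ • x, v⟫_ℝ| ≤ ‖v‖ := (abs_real_inner_le_norm _ _).trans
        (by simpa using mul_le_mul_of_nonneg_right (hunit x) (norm_nonneg v))
      have h1 : |w x - w (‖x‖⁻¹ • x)| ≤ C * (1 - ‖x‖) := by
        have := hw.dist_le_mul x (‖x‖⁻¹ • x)
        rw [Real.dist_eq] at this
        refine this.trans (le_of_eq ?_)
        congr 1
        rw [dist_eq_norm, show x - ‖x‖⁻¹ • x = (1 - ‖x‖⁻¹) • x by rw [sub_smul, one_smul], norm_smul,
          Real.norm_eq_abs, ← abs_of_pos hx0, ← abs_mul, abs_of_pos hx0, sub_mul, one_mul,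
          inv_mul_cancel₀ hx0.ne', abs_sub_comm, abs_of_pos (by linarith [hx.2])]
      have h3 : (1 - ‖x‖) * (n + 1) ≤ 1 := by
        have : 1 - ‖x‖ ≤ 1 / (n + 1 : ℝ) := by linarith [hx.1]
        rwa [le_div_iff₀ hn] at this
      rw [norm_mul, norm_mul, Real.norm_eq_abs, Real.norm_eq_abs, Real.norm_eq_abs,
        abs_of_pos hn]
      calc _ ≤ ‖v‖ * (C * (1 - ‖x‖)) * (n + 1) := by gcongr
        _ = ‖v‖ * C * ((1 - ‖x‖) * (n + 1)) := by ring
        _ ≤ ‖v‖ * C * 1 := by gcongr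
        _ = _ := mul_one _
    · simp only [D, gn, Set.indicator_of_notMem hx, mul_zero, norm_zero]
      exact Set.indicator_nonneg (fun _ _ => by positivity) _
  have hDint : ∀ n, Integrable (D n) := fun n =>
    hbint.mono' (hDm n) (Eventually.of_forall (hDb n))
  have hDlim : Tendsto (fun n => ∫ x, D n x) atTop (𝓝 0) := by
    have := tendsto_integral_of_dominated_convergence (f := fun _ => (0 : ℝ)) (F := D) (μ := volume)
      _ hDm hbint (fun n => Eventually.of_forall (hDb n)) (Eventually.of_forall fun x => ?_)
    · simpa using this
    · refine tendsto_const_nhds.congr' ?_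
      by_cases hx : ‖x‖ < 1
      · filter_upwards [(tendsto_one_div_add_atTop_nhds_zero_nat (𝕜 := ℝ)).eventually_lt_const
          (sub_pos.2 hx)] with n hn
        simp only [D, gn]
        rw [Set.indicator_of_notMem (fun hm => by linarith [hm.1]), mul_zero]
      · refine Eventually.of_forall fun n => ?_
        simp only [D, gn]
        rw [Set.indicator_of_notMem (fun hm => hx hm.2), mul_zero]
  have hright : Tendsto (fun n => ∫ x, lineDeriv ℝ (χ n) x (-v) * w x) atTop
      (𝓝 (∫ y, h (y : E d) ∂(surf d))) := by
    have hsum := hmain.add hDlim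
    rw [add_zero] at hsum
    refine hsum.congr fun n => ?_
    rw [hrew n, ← integral_add (hB n) (hDint n)]
    refine integral_congr_ae (Eventually.of_forall fun x => ?_)
    simp only [h, D]
    ring
  exact tendsto_nhds_unique (hleft.congr hibp) hright

end Cloak

noncomputable section
namespace Cloak

open MeasureTheory Metric Filter Topology Asymptotics
open scoped ContDiff InnerProductSpace

/-! ### Piecewise smooth radial profiles -/

/-- A bounded Lipschitz function with derivative `f'`, continuous off a finite set. -/
structure IsPW (f f' : ℝ → ℝ) : Prop where
  lip : ∃ C, LipschitzWith C f
  bdd : ∃ B, ∀ r, |f r| ≤ B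
  der : ∃ T : Set ℝ, T.Finite ∧ ∀ r, r ∉ T → HasDerivAt f (f' r) r ∧ ContinuousAt f' r

/-- Continuity rules out jumps at the exceptional points, so the fundamental theorem of calculus
survives a countable exceptional set. It is applied to `deriv f`, which is measurable automatically.
-/
lemma abs_sub_le_of_hasDerivAt_off_finite {f f' : ℝ → ℝ} {a b M : ℝ} (hab : a ≤ b)
    (hc : ContinuousOn f (Set.Icc a b)) {T : Set ℝ} (hT : T.Finite)
    (hd : ∀ r ∈ Set.Ioo a b \ T, HasDerivAt f (f' r) r)
    (hM : ∀ r ∈ Set.Ioo a b \ T, |f' r| ≤ M) : |f b - f a| ≤ M * |b - a| := by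
  have hd' : ∀ r ∈ Set.Ioo a b \ T, HasDerivAt f (deriv f r) r := fun r hr =>
    (hd r hr).differentiableAt.hasDerivAt
  have hnull : ∀ᵐ r : ℝ, r ∉ T ∪ {b} :=
    (hT.union (Set.finite_singleton b)).countable.ae_notMem _
  have hb : ∀ᵐ r : ℝ, r ∈ Set.Ioc a b → ‖deriv f r‖ ≤ M := by
    filter_upwards [hnull] with r hr hr'
    have hrm : r ∈ Set.Ioo a b \ T :=
      ⟨⟨hr'.1, lt_of_le_of_ne hr'.2 fun h => hr (Or.inr h)⟩, fun h => hr (Or.inl h)⟩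
    rw [(hd r hrm).deriv]
    exact hM r hrm
  have hIntg : IntervalIntegrable (deriv f) volume a b := by
    rw [intervalIntegrable_iff_integrableOn_Ioc_of_le hab]
    refine Measure.integrableOn_of_bounded (M := M) measure_Ioc_lt_top.ne
      (measurable_deriv f).aestronglyMeasurable ?_
    rwa [ae_restrict_iff' measurableSet_Ioc]
  rw [← integral_eq_of_hasDerivAt_off_countable_of_le f (deriv f) hab hT.countable hc hd' hIntg]
  exact intervalIntegral.norm_integral_le_of_norm_le_const_ae (f := deriv f)
    (by rwa [Set.uIoc_of_le hab])

/-- A piecewise smooth function on an interval, extended by constants. -/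
lemma isPW_clamp {f f' : ℝ → ℝ} {a R M : ℝ} (haR : a < R) (hc : ContinuousOn f (Set.Icc a R))
    {T : Set ℝ} (hT : T.Finite)
    (hd : ∀ r ∈ Set.Ioo a R \ T, HasDerivAt f (f' r) r ∧ ContinuousAt f' r)
    (hM : ∀ r ∈ Set.Ioo a R \ T, |f' r| ≤ M) :
    IsPW (fun r => f (max a (min r R))) ((Set.Ioo a R).indicator f') := by
  have hmem : ∀ r, max a (min r R) ∈ Set.Icc a R := fun r =>
    ⟨le_max_left _ _, max_le haR.le (min_le_right _ _)⟩
  have hcl : ∀ x y : ℝ, |max a (min x R) - max a (min y R)| ≤ |x - y| := fun x y =>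
    (abs_max_sub_max_le_max a (min x R) a (min y R)).trans (by
      simpa using (abs_min_sub_min_le_max x R y R))
  have hle : ∀ x ∈ Set.Icc a R, ∀ y ∈ Set.Icc a R, x ≤ y → |f y - f x| ≤ |M| * |y - x| :=
    fun x hx y hy hxy => by
      have hsub : Set.Ioo x y ⊆ Set.Ioo a R := Set.Ioo_subset_Ioo hx.1 hy.2
      exact abs_sub_le_of_hasDerivAt_off_finite hxy (hc.mono (Set.Icc_subset_Icc hx.1 hy.2)) hT
        (fun r hr => (hd r ⟨hsub hr.1, hr.2⟩).1)
        (fun r hr => (hM r ⟨hsub hr.1, hr.2⟩).trans (le_abs_self M))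
  refine ⟨⟨Real.toNNReal |M|, LipschitzWith.of_dist_le_mul fun x y => ?_⟩, ?_, T ∪ {a, R},
    hT.union (by simp), fun r hr => ?_⟩
  · rw [Real.dist_eq, Real.dist_eq, Real.coe_toNNReal _ (abs_nonneg M)]
    have h1 : |f (max a (min x R)) - f (max a (min y R))|
        ≤ |M| * |max a (min x R) - max a (min y R)| := by
      rcases le_total (max a (min x R)) (max a (min y R)) with h | h
      · rw [abs_sub_comm, abs_sub_comm (max a (min x R))]
        exact hle _ (hmem x) _ (hmem y) h
      · exact hle _ (hmem y) _ (hmem x) h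
    exact h1.trans (mul_le_mul_of_nonneg_left (hcl x y) (abs_nonneg M))
  · obtain ⟨B, hB⟩ := isCompact_Icc.exists_bound_of_continuousOn hc
    exact ⟨B, fun r => hB _ (hmem r)⟩
  · simp only [Set.mem_union, Set.mem_insert_iff, Set.mem_singleton_iff, not_or] at hr
    obtain ⟨hrT, hra, hrR⟩ := hr
    have hconst : ∀ s ∈ 𝓝 r, ∀ c : ℝ, (∀ z ∈ s, f (max a (min z R)) = c ∧ z ∉ Set.Ioo a R) →
        HasDerivAt (fun r => f (max a (min r R))) ((Set.Ioo a R).indicator f' r) r ∧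
          ContinuousAt ((Set.Ioo a R).indicator f') r := fun s hs c h => by
      rw [Set.indicator_of_notMem (h r (mem_of_mem_nhds hs)).2]
      refine ⟨(hasDerivAt_const r c).congr_of_eventuallyEq ?_, ?_⟩
      · filter_upwards [hs] with z hz using (h z hz).1
      · refine (continuousAt_const (y := (0 : ℝ))).congr ?_
        filter_upwards [hs] with z hz
        rw [Set.indicator_of_notMem (h z hz).2]
    rcases lt_or_gt_of_ne hra with h1 | h1
    · refine hconst _ (Iio_mem_nhds h1) (f a) fun z hz => ⟨?_, fun hz' => lt_asymm hz hz'.1⟩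
      rw [max_eq_left ((min_le_left _ _).trans (le_of_lt hz))]
    rcases lt_or_gt_of_ne hrR with h2 | h2
    · have hI : Set.Ioo a R ∈ 𝓝 r := Ioo_mem_nhds h1 h2
      rw [Set.indicator_of_mem (Set.mem_Ioo.2 ⟨h1, h2⟩)]
      refine ⟨(hd r ⟨⟨h1, h2⟩, hrT⟩).1.congr_of_eventuallyEq ?_,
        (hd r ⟨⟨h1, h2⟩, hrT⟩).2.congr ?_⟩
      · filter_upwards [hI] with z hz
        rw [min_eq_left hz.2.le, max_eq_right hz.1.le]
      · filter_upwards [hI] with z hz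
        rw [Set.indicator_of_mem hz]
    · refine hconst _ (Ioi_mem_nhds h2) (f R) fun z hz => ⟨?_, fun hz' => lt_asymm hz hz'.2⟩
      rw [min_eq_right (le_of_lt hz), max_eq_right haR.le]

/-- The gradient of the function `f(|x|) p(x)`. -/
def rg {d : ℕ} (f f' : ℝ → ℝ) (p : MvPolynomial (Fin d) ℝ) (x : E d) : E d :=
  f ‖x‖ • pg p x + (f' ‖x‖ * ‖x‖⁻¹ * pv p x) • x

lemma hasFDerivAt_norm' {d : ℕ} {x : E d} (h0 : x ≠ 0) :
    HasFDerivAt (fun z : E d => ‖z‖) (‖x‖⁻¹ • innerSL ℝ x) x := by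
  have := (hasStrictFDerivAt_norm_sq x).hasFDerivAt.sqrt (by simpa using h0)
  have h3 : (fun z : E d => √(‖z‖ ^ 2)) = fun z => ‖z‖ := by
    funext z; exact Real.sqrt_sq (norm_nonneg _)
  rw [h3] at this
  refine this.congr_fderiv ?_
  ext w
  simp [Real.sqrt_sq (norm_nonneg x)]
  field_simp

lemma hasFDerivAt_radial {d : ℕ} {f f' : ℝ → ℝ} (p : MvPolynomial (Fin d) ℝ) {x : E d}
    (h0 : x ≠ 0) (hf : HasDerivAt f (f' ‖x‖) ‖x‖) :
    HasFDerivAt (fun z : E d => f ‖z‖ * pv p z) (innerSL ℝ (rg f f' p x)) x := by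
  have h1 := hf.comp_hasFDerivAt x (hasFDerivAt_norm' h0)
  refine (h1.mul (hasFDerivAt_pv p x)).congr_fderiv ?_
  ext w
  simp [rg]
  ring

lemma ae_norm_notMem {d : ℕ} [NeZero d] {T : Set ℝ} (hT : T.Finite) :
    ∀ᵐ x : E d, ‖x‖ ∉ T := by
  have : {x : E d | ¬ ‖x‖ ∉ T} = ⋃ r ∈ T, sphere (0 : E d) r := by
    ext x; simp
  rw [ae_iff, this, measure_biUnion_null_iff hT.countable]
  intro r _
  have : Nontrivial (E d) := by
    have : Nonempty (Fin d) := ⟨0⟩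
    infer_instance
  exact Measure.addHaar_sphere _ _ _

lemma IsPW.ae_hasFDerivAt {d : ℕ} [NeZero d] {f f' : ℝ → ℝ} (h : IsPW f f')
    (p : MvPolynomial (Fin d) ℝ) :
    ∀ᵐ x : E d, HasFDerivAt (fun z : E d => f ‖z‖ * pv p z) (innerSL ℝ (rg f f' p x)) x := by
  obtain ⟨T, hT, hd⟩ := h.der
  filter_upwards [ae_norm_notMem (d := d) hT, ae_norm_notMem (d := d) (Set.finite_singleton 0)]
    with x h1 h2
  exact hasFDerivAt_radial p (by simpa using h2) (hd _ h1).1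

/-- Measurability of `f'` is not part of `IsPW`. Almost everywhere the field is the gradient of an
actual function, and the `fderiv` of any function is measurable. -/
lemma IsPW.aestronglyMeasurable_rg {d : ℕ} [NeZero d] {f f' : ℝ → ℝ} (h : IsPW f f')
    (p : MvPolynomial (Fin d) ℝ) : AEStronglyMeasurable (rg f f' p) volume := by
  have hm : Measurable fun x : E d =>
      (InnerProductSpace.toDual ℝ (E d)).symm (fderiv ℝ (fun z : E d => f ‖z‖ * pv p z) x) :=
    (InnerProductSpace.toDual ℝ (E d)).symm.continuous.measurable.comp (measurable_fderiv ℝ _)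
  refine hm.aestronglyMeasurable.congr ?_
  filter_upwards [h.ae_hasFDerivAt p] with x hx
  rw [hx.fderiv]
  exact (InnerProductSpace.toDual ℝ (E d)).symm_apply_apply _

lemma IsPW.ae_abs_le {d : ℕ} [NeZero d] {f f' : ℝ → ℝ} (h : IsPW f f') :
    ∃ C, ∀ᵐ x : E d, |f' ‖x‖| ≤ C := by
  obtain ⟨C, hC⟩ := h.lip
  obtain ⟨T, hT, hd⟩ := h.der
  refine ⟨C, ?_⟩
  filter_upwards [ae_norm_notMem (d := d) hT] with x h1
  rw [← (hd _ h1).1.deriv]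
  exact norm_deriv_le_of_lipschitz hC

lemma norm_inv_smul_le {d : ℕ} (c : ℝ) (x : E d) : ‖(c * ‖x‖⁻¹) • x‖ ≤ |c| := by
  rw [norm_smul, norm_mul, norm_inv, norm_norm, mul_assoc, Real.norm_eq_abs]
  exact mul_le_of_le_one_right (abs_nonneg c) inv_mul_le_one

/-- Radial gradients are bounded on bounded sets. -/
lemma IsPW.ae_norm_rg_le {d : ℕ} [NeZero d] {f f' : ℝ → ℝ} (h : IsPW f f')
    (p : MvPolynomial (Fin d) ℝ) (R : ℝ) :
    ∃ C, ∀ᵐ x : E d, ‖x‖ ≤ R → ‖rg f f' p x‖ ≤ C := by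
  obtain ⟨B, hB⟩ := h.bdd
  obtain ⟨C, hC⟩ := h.ae_abs_le (d := d)
  obtain ⟨P, hP⟩ := (isCompact_closedBall (0 : E d) R).exists_bound_of_continuousOn
    (contDiff_pv p).continuous.continuousOn
  obtain ⟨Q, hQ⟩ := (isCompact_closedBall (0 : E d) R).exists_bound_of_continuousOn
    (contDiff_pg p).continuous.continuousOn
  refine ⟨B * Q + C * P, ?_⟩
  filter_upwards [hC] with x hx hxR
  have hxm : x ∈ closedBall (0 : E d) R := mem_closedBall_zero_iff.2 hxR
  have hB0 : 0 ≤ B := (abs_nonneg _).trans (hB 0)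
  have hC0 : 0 ≤ C := (abs_nonneg _).trans hx
  refine (norm_add_le _ _).trans (add_le_add ?_ ?_)
  · rw [norm_smul]
    exact mul_le_mul (hB _) (hQ x hxm) (norm_nonneg _) hB0
  · rw [mul_comm, ← smul_smul, norm_smul, mul_comm]
    exact mul_le_mul ((norm_inv_smul_le _ _).trans hx) (hP x hxm) (norm_nonneg _) hC0

lemma lipschitz_mul {d : ℕ} {f g : E d → ℝ} {C D : NNReal} (hf : LipschitzWith C f)
    (hg : LipschitzWith D g) {A B : ℝ} (hA : ∀ x, |f x| ≤ A) (hB : ∀ x, |g x| ≤ B) :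
    ∃ L, LipschitzWith L fun x => f x * g x := by
  have hA0 : 0 ≤ A := (abs_nonneg _).trans (hA 0)
  have hB0 : 0 ≤ B := (abs_nonneg _).trans (hB 0)
  refine ⟨Real.toNNReal (A * D + B * C), LipschitzWith.of_dist_le_mul fun x y => ?_⟩
  rw [Real.coe_toNNReal _ (by positivity), Real.dist_eq]
  have h1 := hf.dist_le_mul x y
  have h2 := hg.dist_le_mul x y
  rw [Real.dist_eq] at h1 h2
  calc |f x * g x - f y * g y| = |f x * (g x - g y) + g y * (f x - f y)| := by congr 1; ring
    _ ≤ |f x| * |g x - g y| + |g y| * |f x - f y| := by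
      refine (abs_add_le _ _).trans ?_
      rw [abs_mul, abs_mul]
    _ ≤ A * (D * dist x y) + B * (C * dist x y) := by
      gcongr
      · exact hA x
      · exact hB y
    _ = _ := by ring

lemma IsPW.lipschitz_mul_test {d : ℕ} {f f' : ℝ → ℝ} (h : IsPW f f')
    (p : MvPolynomial (Fin d) ℝ) {ψ : E d → ℝ} (hψ : IsTest ψ) :
    ∃ L, LipschitzWith L fun x => f ‖x‖ * (pv p x * ψ x) := by
  obtain ⟨B, hB⟩ := h.bdd
  obtain ⟨C, hC⟩ := h.lip
  have hs : ContDiff ℝ ∞ fun x => pv p x * ψ x := (contDiff_pv p).mul hψ.1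
  have hc : HasCompactSupport fun x => pv p x * ψ x := hψ.2.mul_left
  obtain ⟨D, hD⟩ := hs.lipschitzWith_of_hasCompactSupport hc (by simp)
  obtain ⟨A, hA⟩ := hc.exists_bound_of_continuous hs.continuous
  exact lipschitz_mul (hC.comp lipschitzWith_one_norm) hD (fun x => hB _) hA

lemma IsPW.ae_lineDeriv {d : ℕ} [NeZero d] {f f' : ℝ → ℝ} (h : IsPW f f')
    (p : MvPolynomial (Fin d) ℝ) {ψ : E d → ℝ} (hψ : IsTest ψ) (v : E d) :
    ∀ᵐ x : E d, lineDeriv ℝ (fun x => f ‖x‖ * (pv p x * ψ x)) x v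
      = (f ‖x‖ * pv p x) * fderiv ℝ ψ x v + ⟪rg f f' p x, v⟫_ℝ * ψ x := by
  filter_upwards [h.ae_hasFDerivAt p] with x hx
  have := hx.mul (hψ.1.differentiable (by simp) x).hasFDerivAt
  have e : (fun x => f ‖x‖ * (pv p x * ψ x)) = (fun z : E d => f ‖z‖ * pv p z) * ψ := by
    funext z; simp [mul_assoc]
  rw [e, (this.hasLineDerivAt v).lineDeriv]
  simp
  ring

lemma memLp_of_ae_bound {d : ℕ} {F : Type*} [NormedAddCommGroup F] {u : E d → F} {Ω : Set (E d)}
    {R : ℝ} (hΩ : MeasurableSet Ω) (hR : Ω ⊆ ball 0 R) (hm : AEStronglyMeasurable u volume) {C : ℝ}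
    (hC : ∀ᵐ x : E d, ‖x‖ ≤ R → ‖u x‖ ≤ C) : MemLp u 2 (volume.restrict Ω) := by
  have : IsFiniteMeasure ((volume : Measure (E d)).restrict Ω) := ⟨by
    rw [Measure.restrict_apply_univ]
    exact (measure_mono hR).trans_lt measure_ball_lt_top⟩
  refine MemLp.of_bound hm.restrict C ?_
  rw [ae_restrict_iff' hΩ]
  filter_upwards [hC] with x hx hxΩ
  exact hx (mem_ball_zero_iff.1 (hR hxΩ)).le

lemma IsPW.memLp {d : ℕ} [NeZero d] {f f' : ℝ → ℝ} (h : IsPW f f') (p : MvPolynomial (Fin d) ℝ)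
    {Ω : Set (E d)} {R : ℝ} (hΩ : MeasurableSet Ω) (hR : Ω ⊆ ball 0 R) :
    MemLp (fun x => f ‖x‖ * pv p x) 2 (volume.restrict Ω) ∧
      MemLp (rg f f' p) 2 (volume.restrict Ω) := by
  obtain ⟨L, hL⟩ := h.lip
  have hcont : Continuous fun x : E d => f ‖x‖ * pv p x :=
    (hL.continuous.comp continuous_norm).mul (contDiff_pv p).continuous
  obtain ⟨C, hC⟩ := h.ae_norm_rg_le p R
  obtain ⟨P, hP⟩ := (isCompact_closedBall (0 : E d) R).exists_bound_of_continuousOn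
    hcont.continuousOn
  exact ⟨memLp_of_ae_bound hΩ hR hcont.aestronglyMeasurable
      (Eventually.of_forall fun x hx => hP x (mem_closedBall_zero_iff.2 hx)),
    memLp_of_ae_bound hΩ hR (h.aestronglyMeasurable_rg p) hC⟩

/-- `f(|x|) p(x)` has the expected gradient and trace. -/
theorem IsPW.isExt {d : ℕ} [NeZero d] {f f' : ℝ → ℝ} (h : IsPW f f') (p : MvPolynomial (Fin d) ℝ)
    {φ : Lp ℝ 2 (surf d)} (hφ : φ =ᵐ[surf d] fun y => f 1 * pv p (y : E d)) (K : Set (E d)) :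
    IsExt K φ (fun x => f ‖x‖ * pv p x) (rg f f' p) := by
  refine IsExt.restrict ?_
  obtain ⟨m1, m2⟩ := h.memLp p (measurableSet_dom (isClosed_empty (X := E d))) (dom_subset _)
  refine IsExt.of_trace m1 m2 fun ψ hψ _ v => ?_
  obtain ⟨L, hL⟩ := h.lipschitz_mul_test p hψ
  -- Green's formula for `f p` against `ψ` is the divergence theorem for the single Lipschitz
  -- function `f p ψ`.
  have e := integral_ball_lineDeriv hL v
  rw [integral_congr_ae (ae_restrict_of_ae (h.ae_lineDeriv p hψ v))] at e
  rw [show dom (∅ : Set (E d)) = ball 0 1 by simp [dom], e]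
  refine integral_congr_ae ?_
  filter_upwards [hφ] with y hy
  rw [hy, mem_sphere_zero_iff_norm.1 y.2]
  ring

/-- `f(|x|) p(x)` has the expected weak gradient on bounded open sets. -/
theorem IsPW.isH1 {d : ℕ} [NeZero d] {f f' : ℝ → ℝ} (h : IsPW f f') (p : MvPolynomial (Fin d) ℝ)
    {Ω : Set (E d)} {R : ℝ} (hΩ : MeasurableSet Ω) (hR : Ω ⊆ ball 0 R) :
    IsH1 Ω (fun x => f ‖x‖ * pv p x) (rg f f' p) := by
  obtain ⟨m1, m2⟩ := h.memLp p hΩ hR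
  refine ⟨m1, m2, fun ψ hψ hs v => ?_⟩
  obtain ⟨L, hL⟩ := h.lipschitz_mul_test p hψ
  have hc : HasCompactSupport fun x => f ‖x‖ * (pv p x * ψ x) := (hψ.2.mul_left).mul_left
  -- Integrating by parts against the constant `1` says that a directional derivative of a compactly
  -- supported Lipschitz function has integral zero.
  have e := (LipschitzWith.const (1 : ℝ)).integral_lineDeriv_mul_eq (μ := volume) hL hc (-v)
  have h0 : ∀ x w : E d, lineDeriv ℝ (fun _ : E d => (1 : ℝ)) x w = 0 := fun x w => by
    simp [lineDeriv]
  simp only [h0, zero_mul, integral_zero, neg_neg, mul_one] at e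
  rw [integral_congr_ae (h.ae_lineDeriv p hψ v)] at e
  rw [← setIntegral_eq_integral_of_forall_compl_eq_zero (s := Ω), integral_add
    (integrable_u m1 hψ v) (integrable_G m2 hψ v)] at e
  · linarith
  · intro x hx
    have hxs : x ∉ tsupport ψ := fun hn => hx (hs hn)
    rw [image_eq_zero_of_notMem_tsupport hxs,
      image_eq_zero_of_notMem_tsupport fun hn => hxs (tsupport_fderiv_subset ℝ hn)]
    simp

end Cloak

noncomputable section
namespace Cloak

open MeasureTheory Metric Filter Topology Asymptotics
open scoped ContDiff InnerProductSpace Convolution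

/-! ### Divergence free radial fluxes -/

/-- Smoothing of a piecewise smooth profile vanishing on `(-∞, a]`. -/
lemma IsPW.exists_smooth {b b' : ℝ → ℝ} (h : IsPW b b') {a : ℝ} (hb : ∀ r ≤ a, b r = 0) :
    ∃ B : ℕ → ℝ → ℝ, (∀ n, ContDiff ℝ ∞ (B n)) ∧ (∀ n, ∃ a' > a, ∀ r < a', B n r = 0) ∧
      (∀ r, Tendsto (fun n => B n r) atTop (𝓝 (b r))) ∧
      (∃ C, ∀ n r, |B n r| ≤ C ∧ |deriv (B n) r| ≤ C) ∧
      ∃ T : Set ℝ, T.Finite ∧ ∀ r, r ∉ T → Tendsto (fun n => deriv (B n) r) atTop (𝓝 (b' r)) := by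
  obtain ⟨C, hC⟩ := h.lip
  obtain ⟨M, hM⟩ := h.bdd
  obtain ⟨T, hT, hd⟩ := h.der
  let ε : ℕ → ℝ := fun n => 1 / (n + 1)
  have hε : ∀ n, 0 < ε n := fun n => by positivity
  have hε0 : Tendsto ε atTop (𝓝 0) := tendsto_one_div_add_atTop_nhds_zero_nat
  let η : ℕ → ContDiffBump (0 : ℝ) := fun n => ⟨ε n / 2, ε n, by simpa using hε n, by linarith [hε n]⟩
  let L := ContinuousLinearMap.lsmul ℝ ℝ (E := ℝ)
  let V : ℕ → ℝ → ℝ := fun n => (η n).normed volume ⋆[L, volume] b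
  have hbc : Continuous b := hC.continuous
  have hVdef : ∀ n r, V n r = ∫ t, (η n).normed volume t * b (r - t) := fun n r => rfl
  have hηi : ∀ n, Integrable ((η n).normed volume) := fun n => (η n).integrable_normed
  have hη1 : ∀ n, ∫ t, (η n).normed volume t = 1 := fun n => (η n).integral_normed
  have hη0 : ∀ n t, 0 ≤ (η n).normed volume t := fun n t => (η n).nonneg_normed t
  have hIntg : ∀ n r, Integrable fun t => (η n).normed volume t * b (r - t) := fun n r => by
    refine ((hηi n).mul_const M).mono' ?_ (Eventually.of_forall fun t => ?_)
    · exact ((η n).continuous_normed.mul (hbc.comp (continuous_const.sub continuous_id))).aestronglyMeasurable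
    · rw [norm_mul, Real.norm_of_nonneg (hη0 n t)]
      exact mul_le_mul_of_nonneg_left (hM _) (hη0 n t)
  have hVs : ∀ n, ContDiff ℝ ∞ (V n) := fun n =>
    ((η n).hasCompactSupport_normed).contDiff_convolution_left L (η n).contDiff_normed
      hbc.locallyIntegrable
  have hVL : ∀ n, LipschitzWith C (V n) := fun n => LipschitzWith.of_dist_le_mul fun x y => by
    rw [Real.dist_eq, hVdef, hVdef, ← integral_sub (hIntg n x) (hIntg n y)]
    have : ‖∫ t, ((η n).normed volume t * b (x - t) - (η n).normed volume t * b (y - t))‖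
        ≤ ∫ t, (η n).normed volume t * (C * dist x y) := by
      refine norm_integral_le_of_norm_le ((hηi n).mul_const _) (Eventually.of_forall fun t => ?_)
      rw [← mul_sub, norm_mul, Real.norm_of_nonneg (hη0 n t)]
      refine mul_le_mul_of_nonneg_left ?_ (hη0 n t)
      have := hC.dist_le_mul (x - t) (y - t)
      rwa [dist_sub_right] at this
    rw [integral_mul_const, hη1, one_mul] at this
    exact this
  have hVB : ∀ n r, |V n r| ≤ M := fun n r => by
    rw [hVdef]
    have : ‖∫ t, (η n).normed volume t * b (r - t)‖ ≤ ∫ t, (η n).normed volume t * M := by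
      refine norm_integral_le_of_norm_le ((hηi n).mul_const _) (Eventually.of_forall fun t => ?_)
      rw [norm_mul, Real.norm_of_nonneg (hη0 n t)]
      exact mul_le_mul_of_nonneg_left (hM _) (hη0 n t)
    rwa [integral_mul_const, hη1, one_mul] at this
  have hdm : Measurable (deriv b) := measurable_deriv b
  -- The difference quotients of the Lipschitz function `b` are dominated, so the derivative of the
  -- mollification is the mollification of `deriv b`. It therefore converges wherever `b'` is
  -- continuous.
  have hVd : ∀ n r, HasDerivAt (V n) (((η n).normed volume ⋆[L, volume] deriv b) r) r := fun n r => by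
    refine (hasDerivAt_integral_of_dominated_loc_of_lip (μ := volume)
      (F := fun x t => (η n).normed volume t * b (x - t))
      (F' := fun t => (η n).normed volume t * deriv b (r - t))
      (bound := fun t => (η n).normed volume t * C) (s := Set.univ) univ_mem
      (Eventually.of_forall fun x => (hIntg n x).aestronglyMeasurable) (hIntg n r) ?_ ?_
      ((hηi n).mul_const _) ?_).2
    · exact ((η n).continuous_normed.measurable.mul
        (hdm.comp (measurable_const.sub measurable_id))).aestronglyMeasurable
    · refine Eventually.of_forall fun t => LipschitzWith.lipschitzOnWith ?_
      refine LipschitzWith.of_dist_le_mul fun x y => ?_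
      rw [Real.dist_eq, ← mul_sub, abs_mul, abs_of_nonneg (hη0 n t), Real.coe_nnabs,
        abs_of_nonneg (mul_nonneg (hη0 n t) (NNReal.coe_nonneg C)), mul_assoc]
      refine mul_le_mul_of_nonneg_left ?_ (hη0 n t)
      have := hC.dist_le_mul (x - t) (y - t)
      rwa [dist_sub_right] at this
    · have hfin : ((fun t => r - t) ⁻¹' T).Finite :=
        hT.preimage (fun x _ y _ hxy => by simpa using hxy)
      filter_upwards [hfin.countable.ae_notMem volume] with t ht
      have h1 : HasDerivAt b (deriv b (r - t)) (r - t) := (hd _ ht).1.differentiableAt.hasDerivAt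
      exact (h1.comp_sub_const r t).const_mul _
  -- The mollification has kernel of radius `ε n`, so unshifted it could be nonzero already at `a -
  -- ε n`. Translating it by `2 ε n` makes it vanish up to `a + ε n`, hence near the whole core.
  have hshift : ∀ r, Tendsto (fun n => r - 2 * ε n) atTop (𝓝 r) := fun r => by
    simpa using (hε0.const_mul 2).const_sub r
  have hconv : ∀ (g : ℝ → ℝ) (r : ℝ), AEStronglyMeasurable g volume → ContinuousAt g r →
      Tendsto (fun n => ((η n).normed volume ⋆[L, volume] g) (r - 2 * ε n)) atTop (𝓝 (g r)) :=
    fun g r hg hgc => ContDiffBump.convolution_tendsto_right (φ := η) (g := fun _ => g)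
      (k := fun n => r - 2 * ε n) hε0 (Eventually.of_forall fun _ => hg)
      (hgc.tendsto.comp tendsto_snd) (hshift r)
  refine ⟨fun n r => V n (r - 2 * ε n), fun n => (hVs n).comp (contDiff_id.sub contDiff_const),
    fun n => ⟨a + ε n, by linarith [hε n], fun r hr => ?_⟩,
    fun r => hconv b r hbc.aestronglyMeasurable hbc.continuousAt, ⟨max M C, fun n r => ⟨?_, ?_⟩⟩,
    T, hT, fun r hr => ?_⟩
  · change V n (r - 2 * ε n) = 0
    rw [hVdef]
    refine integral_eq_zero_of_ae (Eventually.of_forall fun t => ?_)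
    by_cases ht : t ∈ Function.support ((η n).normed volume)
    · rw [(η n).support_normed_eq, mem_ball_zero_iff, Real.norm_eq_abs] at ht
      have : -ε n < t := (abs_lt.1 ht).1
      simp [hb (r - 2 * ε n - t) (by linarith)]
    · simp [Function.notMem_support.1 ht]
  · exact (hVB n _).trans (le_max_left _ _)
  · rw [deriv_comp_sub_const]
    exact (norm_deriv_le_of_lipschitz (hVL n)).trans (le_max_right _ _)
  · have e : ∀ n, deriv (fun r => V n (r - 2 * ε n)) r
        = ((η n).normed volume ⋆[L, volume] deriv b) (r - 2 * ε n) := fun n => by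
      rw [deriv_comp_sub_const, (hVd n _).deriv]
    simp_rw [e]
    rw [← (hd r hr).1.deriv]
    refine hconv (deriv b) r hdm.aestronglyMeasurable ?_
    refine (hd r hr).2.congr ?_
    filter_upwards [hT.isClosed.isOpen_compl.mem_nhds hr] with z hz
    exact (hd z hz).1.deriv.symm

lemma contDiff_radial {d : ℕ} {f : ℝ → ℝ} {a : ℝ} (ha : 0 < a)
    (hf : ∀ r > 0, ContDiffAt ℝ ∞ f r) (h0 : ∀ r < a, f r = 0) :
    ContDiff ℝ ∞ fun x : E d => f ‖x‖ := by
  refine contDiff_iff_contDiffAt.2 fun x => ?_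
  by_cases hx : x = 0
  · refine (contDiffAt_const (c := (0 : ℝ))).congr_of_eventuallyEq ?_
    filter_upwards [ball_mem_nhds x ha] with z hz
    exact h0 _ (by simpa [hx] using hz)
  · exact (hf _ (norm_pos_iff.2 hx)).comp x (contDiffAt_norm ℝ hx)

/-- The polynomial `|x|²`. -/
def sqX (d : ℕ) : MvPolynomial (Fin d) ℝ := ∑ i, MvPolynomial.X i ^ 2

lemma pv_pow {d : ℕ} (p : MvPolynomial (Fin d) ℝ) (n : ℕ) (x : E d) :
    pv (p ^ n) x = pv p x ^ n := by simp [pv]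

lemma pv_sqX {d : ℕ} (x : E d) : pv (sqX d) x = ‖x‖ ^ 2 := by
  simp [sqX, pv_sum, pv_pow, EuclideanSpace.real_norm_sq_eq]

lemma pderiv_sqX {d : ℕ} (i : Fin d) :
    MvPolynomial.pderiv i (sqX d) = MvPolynomial.C 2 * MvPolynomial.X i := by
  rw [sqX, map_sum, Finset.sum_eq_single i]
  · rw [Derivation.leibniz_pow]
    simp
    rfl
  · intro j _ hj
    rw [Derivation.leibniz_pow, MvPolynomial.pderiv_X_of_ne hj]; simp
  · simp

/-- The flux `k' b ∇p + (b'/r) (r² ∇p - k p x)`, `k' = k + d - 2`, which is the divergence of the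
antisymmetric tensor `b(|x|) (∇p ∧ x)`. -/
def rj {d : ℕ} (k : ℕ) (b b' : ℝ → ℝ) (p : MvPolynomial (Fin d) ℝ) (x : E d) : E d :=
  ((k + d - 2 : ℝ) * b ‖x‖) • pg p x
    + (b' ‖x‖ * ‖x‖⁻¹) • (‖x‖ ^ 2 • pg p x - (k * pv p x) • x)

lemma inner_rj_self {d k : ℕ} (b b' : ℝ → ℝ) {p : MvPolynomial (Fin d) ℝ}
    (hp : p.IsHomogeneous k) (x : E d) :
    ⟪rj k b b' p x, x⟫_ℝ = k * (k + d - 2) * b ‖x‖ * pv p x := by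
  simp only [rj, inner_add_left, inner_smul_left, inner_sub_left, inner_pg_self hp,
    real_inner_self_eq_norm_sq, conj_trivial]
  ring

/-- The polynomial field `r² ∇p - k p x`. -/
def tanPoly {d : ℕ} (k : ℕ) (p : MvPolynomial (Fin d) ℝ) (i : Fin d) : MvPolynomial (Fin d) ℝ :=
  sqX d * MvPolynomial.pderiv i p - MvPolynomial.C (k : ℝ) * (p * MvPolynomial.X i)

lemma pv_sub {d : ℕ} (p q : MvPolynomial (Fin d) ℝ) (x : E d) :
    pv (p - q) x = pv p x - pv q x := by simp [pv]

lemma rj_apply {d : ℕ} (k : ℕ) (b b' : ℝ → ℝ) (p : MvPolynomial (Fin d) ℝ) (x : E d) (i : Fin d) :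
    rj k b b' p x i = (k + d - 2) * (b ‖x‖ * pv (MvPolynomial.pderiv i p) x)
      + (b' ‖x‖ * ‖x‖⁻¹) * pv (tanPoly k p i) x := by
  simp only [rj, tanPoly, pv_sub, pv_sqX, pv_mul, pv_C, pv_X, PiLp.add_apply, PiLp.smul_apply,
    PiLp.sub_apply, pg_apply, smul_eq_mul]
  ring

/-- Harmonicity removes the second derivatives and Euler's identity collects the rest: `2k - k² - kd
= -k(k+d-2)`. This is the term that balances the radial derivative of `b` in `divg_rj`. -/
lemma sum_pderiv_tanPoly {d k : ℕ} {p : MvPolynomial (Fin d) ℝ} (hp : p.IsHomogeneous k)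
    (hl : polyLaplacian d p = 0) (x : E d) :
    ∑ i, pv (MvPolynomial.pderiv i (tanPoly k p i)) x = -(k * (k + d - 2)) * pv p x := by
  have h1 : ∀ i, pv (MvPolynomial.pderiv i (tanPoly k p i)) x
      = 2 * (pg p x i * x i) + ‖x‖ ^ 2 * pv (MvPolynomial.pderiv i (MvPolynomial.pderiv i p)) x
        - k * (pg p x i * x i) - k * pv p x := fun i => by
    simp only [tanPoly, map_sub, Derivation.leibniz, pderiv_sqX, MvPolynomial.pderiv_X_self,
      MvPolynomial.pderiv_C, pv_sub, pv_add, pv_mul, smul_eq_mul, pv_X, pv_C, pv_sqX, pg_apply,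
      mul_one, pv_zero]
    ring
  have h2 := inner_pg_self hp x
  have h3 : ∑ i, pv (MvPolynomial.pderiv i (MvPolynomial.pderiv i p)) x = 0 := by
    rw [← pv_sum, ← polyLaplacian_apply, hl, pv_zero]
  rw [inner_eq_sum] at h2
  simp only [h1, Finset.sum_add_distrib, Finset.sum_sub_distrib, ← Finset.mul_sum, h2, h3]
  simp
  ring

/-- By Euler's identity the field is tangential to spheres, so a radial coefficient multiplying it
contributes nothing to the divergence when differentiated. -/
lemma sum_tanPoly_mul {d k : ℕ} {p : MvPolynomial (Fin d) ℝ} (hp : p.IsHomogeneous k) (x : E d) :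
    ∑ i, pv (tanPoly k p i) x * x i = 0 := by
  have h1 : ∀ i, pv (tanPoly k p i) x * x i
      = ‖x‖ ^ 2 * (pg p x i * x i) - k * pv p x * (x i * x i) := fun i => by
    simp only [tanPoly, pv_sub, pv_mul, pv_sqX, pv_C, pv_X, pg_apply]; ring
  have h2 := inner_pg_self hp x
  have h3 : ∑ i, x i * x i = ‖x‖ ^ 2 := by
    rw [← inner_eq_sum, real_inner_self_eq_norm_sq]
  rw [inner_eq_sum] at h2
  simp only [h1, Finset.sum_sub_distrib, ← Finset.mul_sum, h2, h3]
  ring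

lemma inner_rg_single {d : ℕ} (f f' : ℝ → ℝ) (p : MvPolynomial (Fin d) ℝ) (x : E d) (i : Fin d) :
    ⟪rg f f' p x, EuclideanSpace.single i 1⟫_ℝ
      = f ‖x‖ * pv (MvPolynomial.pderiv i p) x + f' ‖x‖ * ‖x‖⁻¹ * (pv p x * x i) := by
  rw [inner_single]; simp [rg]; ring

/-- No equation for `b` is needed. The first summand has divergence `k(k+d-2)(b'/r) p` because `p`
is harmonic, and the tangential summand has the opposite one. Vanishing of `b` near `0` takes care
of the origin. -/
lemma divg_rj {d k : ℕ} {b : ℝ → ℝ} (hb : ContDiff ℝ ∞ b) {a : ℝ} (ha : 0 < a)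
    (h0 : ∀ r < a, b r = 0) {p : MvPolynomial (Fin d) ℝ} (hp : p.IsHomogeneous k)
    (hl : polyLaplacian d p = 0) (x : E d) : divg (rj k b (deriv b) p) x = 0 := by
  have h0' : ∀ r < a, deriv b r = 0 := fun r hr => by
    have : b =ᶠ[𝓝 r] fun _ => 0 := by
      filter_upwards [Iio_mem_nhds hr] with z hz using h0 z hz
    rw [this.deriv_eq, deriv_const]
  by_cases hx : x = 0
  · refine Finset.sum_eq_zero fun i _ => ?_
    have : (fun z => rj k b (deriv b) p z i) =ᶠ[𝓝 x] fun _ => 0 := by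
      filter_upwards [ball_mem_nhds x ha] with z hz
      have hz' : ‖z‖ < a := by simpa [hx] using hz
      simp [rj_apply, h0 _ hz', h0' _ hz']
    rw [this.fderiv_eq]; simp
  · have hr : ‖x‖ ≠ 0 := norm_ne_zero_iff.2 hx
    let g : ℝ → ℝ := fun r => deriv b r * r⁻¹
    have hg : HasDerivAt g (deriv g ‖x‖) ‖x‖ := by
      refine DifferentiableAt.hasDerivAt ?_
      have h1 : Differentiable ℝ (deriv b) := (contDiff_infty_iff_deriv.1 hb).2.differentiable (by simp)
      exact (h1 _).mul (differentiableAt_inv hr)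
    have hbd : HasDerivAt b (deriv b ‖x‖) ‖x‖ := (hb.differentiable (by simp) _).hasDerivAt
    have hi : ∀ i, fderiv ℝ (fun z => rj k b (deriv b) p z i) x (EuclideanSpace.single i 1)
        = (k + d - 2) * ⟪rg b (deriv b) (MvPolynomial.pderiv i p) x, EuclideanSpace.single i 1⟫_ℝ
          + ⟪rg g (deriv g) (tanPoly k p i) x, EuclideanSpace.single i 1⟫_ℝ := fun i => by
      have e : (fun z => rj k b (deriv b) p z i) = fun z =>
          (k + d - 2) * (b ‖z‖ * pv (MvPolynomial.pderiv i p) z) + g ‖z‖ * pv (tanPoly k p i) z :=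
        funext fun z => rj_apply _ _ _ _ _ _
      have h2 := ((hasFDerivAt_radial (MvPolynomial.pderiv i p) hx hbd).const_mul
        (k + d - 2 : ℝ)).add (hasFDerivAt_radial (tanPoly k p i) hx hg)
      rw [e]
      refine (congrArg (fun T => T (EuclideanSpace.single i (1 : ℝ))) h2.fderiv).trans ?_
      simp
    have h3 : ∑ i, pv (MvPolynomial.pderiv i (MvPolynomial.pderiv i p)) x = 0 := by
      rw [← pv_sum, ← polyLaplacian_apply, hl, pv_zero]
    have h4 := inner_pg_self hp x
    rw [inner_eq_sum] at h4
    simp only [pg_apply] at h4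
    simp only [divg, hi, inner_rg_single, Finset.sum_add_distrib, ← Finset.mul_sum, h3, h4,
      sum_pderiv_tanPoly hp hl, sum_tanPoly_mul hp, g]
    ring

lemma contDiff_rj {d : ℕ} (k : ℕ) {b : ℝ → ℝ} (hb : ContDiff ℝ ∞ b) {a : ℝ} (ha : 0 < a)
    (h0 : ∀ r < a, b r = 0) (p : MvPolynomial (Fin d) ℝ) : ContDiff ℝ ∞ (rj k b (deriv b) p) := by
  have h0' : ∀ r < a, deriv b r = 0 := fun r hr => by
    have : b =ᶠ[𝓝 r] fun _ => 0 := by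
      filter_upwards [Iio_mem_nhds hr] with z hz using h0 z hz
    rw [this.deriv_eq, deriv_const]
  refine contDiff_euclidean.2 fun i => ?_
  simp_rw [rj_apply]
  have h1 : ContDiff ℝ ∞ fun x : E d => b ‖x‖ :=
    contDiff_radial ha (fun r _ => hb.contDiffAt) h0
  have h2 : ContDiff ℝ ∞ fun x : E d => deriv b ‖x‖ * ‖x‖⁻¹ :=
    contDiff_radial (f := fun r => deriv b r * r⁻¹) ha
      (fun r hr => (contDiff_infty_iff_deriv.1 hb).2.contDiffAt.mul (contDiffAt_inv ℝ hr.ne'))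
      fun r hr => by simp [h0' r hr]
  exact (contDiff_const.mul (h1.mul (contDiff_pv _))).add (h2.mul (contDiff_pv _))

end Cloak

noncomputable section
namespace Cloak

open MeasureTheory Metric Filter Topology Asymptotics
open scoped ContDiff InnerProductSpace

/-! ### Green's formula for radial fluxes by smooth approximation. -/

lemma norm_rj_le {d : ℕ} (k : ℕ) {b b' : ℝ → ℝ} (p : MvPolynomial (Fin d) ℝ) {x : E d} {C : ℝ}
    (h1 : |b ‖x‖| ≤ C) (h2 : |b' ‖x‖| ≤ C) :
    ‖rj k b b' p x‖ ≤ C * (|(k + d - 2 : ℝ)| * ‖pg p x‖ + (‖x‖ * ‖pg p x‖ + k * |pv p x|)) := by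
  have hC : 0 ≤ C := (abs_nonneg _).trans h1
  -- The factor `‖x‖⁻¹` is grouped with `x`, or cancelled against `‖x‖ ^ 2`, so the resulting bound
  -- has no singularity at the origin.
  have e : (b' ‖x‖ * ‖x‖⁻¹) • (‖x‖ ^ 2 • pg p x - (k * pv p x) • x)
      = (b' ‖x‖ * ‖x‖) • pg p x - (k * pv p x) • ((b' ‖x‖ * ‖x‖⁻¹) • x) := by
    rw [smul_sub, smul_smul, smul_smul, smul_smul]
    congr 2
    · by_cases h : ‖x‖ = 0
      · simp [h]
      · field_simp
    · ring
  rw [rj, e, mul_add, mul_add]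
  refine (norm_add_le _ _).trans (add_le_add ?_ ((norm_sub_le _ _).trans (add_le_add ?_ ?_)))
  · rw [norm_smul, norm_mul, Real.norm_eq_abs, Real.norm_eq_abs]
    calc _ ≤ |(k + d - 2 : ℝ)| * C * ‖pg p x‖ := by gcongr
      _ = _ := by ring
  · rw [norm_smul, norm_mul, norm_norm, Real.norm_eq_abs, mul_assoc]
    gcongr
  · rw [norm_smul, norm_mul, Real.norm_eq_abs, Real.norm_eq_abs, Nat.abs_cast]
    calc _ ≤ k * |pv p x| * C := by
          gcongr
          exact (norm_inv_smul_le _ _).trans h2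
      _ = _ := by ring

/-- Approximation of a piecewise smooth radial flux by smooth divergence free fields vanishing near
the core. -/
lemma IsPW.exists_smooth_flux {d k : ℕ} {b b' : ℝ → ℝ} (h : IsPW b b') {a : ℝ} (ha : 0 < a)
    (hb : ∀ r ≤ a, b r = 0) {p : MvPolynomial (Fin d) ℝ} (hp : p.IsHomogeneous k)
    (hl : polyLaplacian d p = 0) [NeZero d] :
    ∃ J : ℕ → E d → E d, (∀ n, ContDiff ℝ ∞ (J n)) ∧
      (∀ n, Disjoint (tsupport (J n)) (closedBall 0 a)) ∧ (∀ n x, divg (J n) x = 0) ∧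
      (∀ R, ∃ C, ∀ n x, ‖x‖ ≤ R → ‖J n x‖ ≤ C) ∧
      (∀ᵐ x, Tendsto (fun n => J n x) atTop (𝓝 (rj k b b' p x))) ∧
      ∃ β : ℕ → ℝ, Tendsto β atTop (𝓝 (b 1)) ∧
        ∀ n x, ‖x‖ = 1 → ⟪J n x, x⟫_ℝ = k * (k + d - 2) * β n * pv p x := by
  obtain ⟨B, hs, hz, hlim, ⟨C, hC⟩, T, hT, hd⟩ := h.exists_smooth hb
  refine ⟨fun n => rj k (B n) (deriv (B n)) p, fun n => ?_, fun n => ?_, fun n x => ?_,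
    fun R => ?_, ?_, fun n => B n 1, hlim 1, fun n x hx => ?_⟩
  · obtain ⟨a', ha', h0⟩ := hz n
    exact contDiff_rj k (hs n) (ha.trans ha') h0 p
  · obtain ⟨a', ha', h0⟩ := hz n
    have h0' : ∀ r < a', deriv (B n) r = 0 := fun r hr => by
      have : B n =ᶠ[𝓝 r] fun _ => 0 := by
        filter_upwards [Iio_mem_nhds hr] with z hz using h0 z hz
      rw [this.deriv_eq, deriv_const]
    refine Set.disjoint_left.2 fun x hx hx' => ?_
    rw [mem_closedBall_zero_iff] at hx'
    refine notMem_tsupport_iff_eventuallyEq.2 ?_ hx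
    filter_upwards [(continuous_norm.tendsto x).eventually_lt_const (lt_of_le_of_lt hx' ha')]
      with z hz
    simp [rj, h0 _ hz, h0' _ hz]
  · obtain ⟨a', ha', h0⟩ := hz n
    exact divg_rj (hs n) (ha.trans ha') h0 hp hl x
  · obtain ⟨P, hP⟩ := (isCompact_closedBall (0 : E d) R).exists_bound_of_continuousOn
      (contDiff_pv p).continuous.continuousOn
    obtain ⟨Q, hQ⟩ := (isCompact_closedBall (0 : E d) R).exists_bound_of_continuousOn
      (contDiff_pg p).continuous.continuousOn
    refine ⟨C * (|(k + d - 2 : ℝ)| * Q + (R * Q + k * P)), fun n x hx => ?_⟩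
    have hxm : x ∈ closedBall (0 : E d) R := mem_closedBall_zero_iff.2 hx
    have hC0 : 0 ≤ C := (abs_nonneg _).trans (hC 0 0).1
    have hR0 : 0 ≤ R := (norm_nonneg x).trans hx
    have hQ0 : 0 ≤ Q := (norm_nonneg _).trans (hQ x hxm)
    refine (norm_rj_le k p (hC n _).1 (hC n _).2).trans ?_
    have h1 := hQ x hxm
    have h2 : |pv p x| ≤ P := hP x hxm
    gcongr
  · filter_upwards [ae_norm_notMem (d := d) hT] with x hx
    exact ((((hlim _).const_mul _).smul_const _).add (((hd _ hx).mul_const _).smul_const _))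
  · rw [inner_rj_self _ _ hp, hx]

/-- Green's formula for radial fluxes. -/
theorem IsPW.integral_flux {d k : ℕ} [NeZero d] {b b' : ℝ → ℝ} (h : IsPW b b') {a : ℝ}
    (ha : 0 < a) (hb : ∀ r ≤ a, b r = 0) {p : MvPolynomial (Fin d) ℝ} (hp : p.IsHomogeneous k)
    (hl : polyLaplacian d p = 0) {φ : Lp ℝ 2 (surf d)} {u : E d → ℝ} {G : E d → E d}
    (hu : IsExt (closedBall 0 a) φ u G) :
    ∫ x in dom (closedBall (0 : E d) a), ⟪rj k b b' p x, G x⟫_ℝ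
      = k * (k + d - 2) * b 1 * ∫ y, φ y * pv p (y : E d) ∂(surf d) := by
  obtain ⟨J, hJ, hJs, hJd, hJb, hJl, β, hβ, hJn⟩ := h.exists_smooth_flux ha hb hp hl
  have hmeas := measurableSet_dom (isClosed_closedBall (x := (0 : E d)) (ε := a))
  have e : ∀ n, ∫ x in dom (closedBall (0 : E d) a), ⟪J n x, G x⟫_ℝ
      = k * (k + d - 2) * β n * ∫ y, φ y * pv p (y : E d) ∂(surf d) := fun n => by
    have h1 := hu.divergence isClosed_closedBall (hJ n) (hJs n)
    simp only [hJd, mul_zero, zero_add] at h1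
    simp_rw [real_inner_comm (G _)]
    rw [h1, ← integral_const_mul]
    refine integral_congr_ae (Eventually.of_forall fun y => ?_)
    change φ y * ⟪J n (y : E d), (y : E d)⟫_ℝ = _
    rw [hJn n y (mem_sphere_zero_iff_norm.1 y.2)]
    ring
  obtain ⟨C, hC⟩ := hJb 1
  have hG1 : Integrable (fun x => C * ‖G x‖) (volume.restrict (dom (closedBall (0 : E d) a))) :=
    ((hu.h1.memLp_grad.integrable (by norm_num)).norm).const_mul C
  have l1 : Tendsto (fun n => ∫ x in dom (closedBall (0 : E d) a), ⟪J n x, G x⟫_ℝ) atTop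
      (𝓝 (∫ x in dom (closedBall (0 : E d) a), ⟪rj k b b' p x, G x⟫_ℝ)) := by
    refine tendsto_integral_of_dominated_convergence _ (fun n => ?_) hG1 (fun n => ?_) ?_
    · exact (hJ n).continuous.aestronglyMeasurable.inner hu.h1.memLp_grad.1
    · rw [ae_restrict_iff' hmeas]
      refine Eventually.of_forall fun x hx => (norm_inner_le_norm _ _).trans ?_
      exact mul_le_mul_of_nonneg_right (hC n x (mem_ball_zero_iff.1 (dom_subset _ hx)).le)
        (norm_nonneg _)
    · filter_upwards [ae_restrict_of_ae hJl] with x hx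
      exact hx.inner tendsto_const_nhds
  refine tendsto_nhds_unique l1 ?_
  simp_rw [e]
  exact (hβ.const_mul _).mul_const _

/-- Radial fluxes are divergence free in the whole space. -/
theorem IsPW.integral_flux_test {d k : ℕ} [NeZero d] {b b' : ℝ → ℝ} (h : IsPW b b') {a : ℝ}
    (ha : 0 < a) (hb : ∀ r ≤ a, b r = 0) {p : MvPolynomial (Fin d) ℝ} (hp : p.IsHomogeneous k)
    (hl : polyLaplacian d p = 0) {ψ : E d → ℝ} (hψ : IsTest ψ) :
    ∫ x in (closedBall (0 : E d) a)ᶜ, fderiv ℝ ψ x (rj k b b' p x) = 0 := by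
  obtain ⟨J, hJ, hJs, hJd, hJb, hJl, -⟩ := h.exists_smooth_flux ha hb hp hl
  have hJi : ∀ n i, ContDiff ℝ ∞ fun x => J n x i := fun n => contDiff_euclidean.1 (hJ n)
  have hfc : Continuous (fderiv ℝ ψ) := hψ.1.continuous_fderiv (by simp)
  have hcs : HasCompactSupport (fderiv ℝ ψ) := hψ.2.fderiv ℝ
  have hfull : ∀ n, ∫ x, fderiv ℝ ψ x (J n x) = 0 := fun n => by
    have e1 : ∀ x, fderiv ℝ ψ x (J n x)
        = ∑ i, J n x i * fderiv ℝ ψ x (EuclideanSpace.single i 1) := fun x => by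
      conv_lhs => rw [← (EuclideanSpace.basisFun (Fin d) ℝ).sum_repr (J n x)]
      simp
    have i1 : ∀ i, Integrable fun x => J n x i * fderiv ℝ ψ x (EuclideanSpace.single i 1) :=
      fun i => ((hJi n i).continuous.mul (continuous_fderiv_test hψ _)).integrable_of_hasCompactSupport
        (hψ.2.fderiv_apply ℝ _).mul_left
    have i2 : ∀ i, Integrable fun x => fderiv ℝ (fun z => J n z i) x (EuclideanSpace.single i 1)
        * ψ x := fun i =>
      ((((hJi n i).continuous_fderiv (by simp)).clm_apply continuous_const).mul
        hψ.1.continuous).integrable_of_hasCompactSupport hψ.2.mul_left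
    have i3 : ∀ i, Integrable fun x => J n x i * ψ x := fun i =>
      ((hJi n i).continuous.mul hψ.1.continuous).integrable_of_hasCompactSupport hψ.2.mul_left
    simp_rw [e1]
    rw [integral_finsetSum _ fun i _ => i1 i, Finset.sum_congr rfl fun i _ =>
      integral_mul_fderiv_eq_neg_fderiv_mul_of_integrable (i2 i) (i1 i) (i3 i)
        (fun x _ => (hJi n i).differentiable (by simp) x)
        (fun x _ => hψ.1.differentiable (by simp) x),
      Finset.sum_neg_distrib, ← integral_finsetSum _ fun i _ => i2 i]
    simp_rw [← Finset.sum_mul]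
    have : ∀ x, ∑ i, fderiv ℝ (fun z => J n z i) x (EuclideanSpace.single i 1) = 0 := hJd n
    simp [this]
  have e : ∀ n, ∫ x in (closedBall (0 : E d) a)ᶜ, fderiv ℝ ψ x (J n x) = 0 := fun n => by
    rw [setIntegral_eq_integral_of_forall_compl_eq_zero, hfull n]
    intro x hx
    rw [Set.notMem_compl_iff] at hx
    rw [image_eq_zero_of_notMem_tsupport fun hn => Set.disjoint_left.1 (hJs n) hn hx, map_zero]
  obtain ⟨R, hR⟩ := hψ.2.isCompact.isBounded.subset_closedBall (0 : E d)
  obtain ⟨C, hC⟩ := hJb R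
  have hbd : Integrable (fun x => C * ‖fderiv ℝ ψ x‖)
      (volume.restrict (closedBall (0 : E d) a)ᶜ) :=
    ((hfc.norm.integrable_of_hasCompactSupport hcs.norm).const_mul C).restrict
  have l1 : Tendsto (fun n => ∫ x in (closedBall (0 : E d) a)ᶜ, fderiv ℝ ψ x (J n x)) atTop
      (𝓝 (∫ x in (closedBall (0 : E d) a)ᶜ, fderiv ℝ ψ x (rj k b b' p x))) := by
    refine tendsto_integral_of_dominated_convergence _ (fun n => ?_) hbd (fun n => ?_) ?_
    · exact (hfc.clm_apply (hJ n).continuous).aestronglyMeasurable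
    · refine Eventually.of_forall fun x => ?_
      by_cases hx : x ∈ tsupport ψ
      · refine ((fderiv ℝ ψ x).le_opNorm _).trans ?_
        rw [mul_comm]
        exact mul_le_mul_of_nonneg_right (hC n x (mem_closedBall_zero_iff.1 (hR hx)))
          (norm_nonneg _)
      · rw [image_eq_zero_of_notMem_tsupport fun hn => hx (tsupport_fderiv_subset ℝ hn)]
        simp
    · filter_upwards [ae_restrict_of_ae hJl] with x hx
      exact ((fderiv ℝ ψ x).continuous.tendsto _).comp hx
  refine tendsto_nhds_unique l1 ?_
  simp_rw [e]
  exact tendsto_const_nhds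

end Cloak

noncomputable section
namespace Cloak

open MeasureTheory Metric Filter Topology Asymptotics
open scoped ContDiff InnerProductSpace Convolution

/-! ### Poincaré's inequality for functions with zero trace -/

/-- The mean `∫₀¹ f(tx) t^{d-1} dt` of `f` over the segment from `0` to `x`. -/
def rayMean {d : ℕ} (f : E d → ℝ) (x : E d) : ℝ := ∫ t in (0 : ℝ)..1, f (t • x) * t ^ (d - 1)

/-- Smooth dependence on `x` is read off from a convolution in an auxiliary real variable, evaluated
at `0`. The bump `χ` gives the kernel compact support uniformly in `x` and equals `1` on the range
of integration. -/
lemma contDiff_rayMean {d : ℕ} {f : E d → ℝ} (hf : ContDiff ℝ ∞ f) : ContDiff ℝ ∞ (rayMean f) := by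
  let χ : ContDiffBump (0 : ℝ) := ⟨2, 3, by norm_num, by norm_num⟩
  let w : ℝ → ℝ := (Set.Ioc (0 : ℝ) 1).indicator fun t => t ^ (d - 1)
  let g : E d → ℝ → ℝ := fun x s => χ s * f ((-s) • x)
  have hw : LocallyIntegrable w volume :=
    (((continuous_id.pow (d - 1)).integrableOn_Ioc (a := 0) (b := 1)).integrable_indicator
      measurableSet_Ioc).locallyIntegrable
  have hg : ContDiff ℝ ∞ (fun q : E d × ℝ => g q.1 q.2) :=
    (χ.contDiff.comp contDiff_snd).mul (hf.comp (contDiff_snd.neg.smul contDiff_fst))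
  have := contDiffOn_convolution_right_with_param_comp (𝕜 := ℝ) (μ := (volume : Measure ℝ)) (n := ⊤)
    (ContinuousLinearMap.lsmul ℝ ℝ (E := ℝ)) (s := (Set.univ : Set (E d))) (v := fun _ => (0 : ℝ))
    contDiffOn_const (f := w) (g := g) (k := closedBall (0 : ℝ) 3) isOpen_univ
    (isCompact_closedBall _ _) (fun p s _ hs => by
      simp only [g]
      rw [χ.zero_of_le_dist (by rw [mem_closedBall, not_le] at hs; exact hs.le), zero_mul]) hw
    hg.contDiffOn
  rw [contDiffOn_univ] at this
  convert! this using 2 with x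
  rw [rayMean, intervalIntegral.integral_of_le zero_le_one, convolution_def,
    ← integral_indicator measurableSet_Ioc]
  refine integral_congr_ae (Eventually.of_forall fun t => ?_)
  by_cases ht : t ∈ Set.Ioc (0 : ℝ) 1
  · have h1 : χ (0 - t) = 1 := χ.one_of_mem_closedBall (by
      rw [mem_closedBall, zero_sub, dist_zero_right, norm_neg, Real.norm_eq_abs, abs_of_pos ht.1]
      exact ht.2.trans (by norm_num [χ]))
    have h2 : -(0 - t) = t := by ring
    simp only [w, g, Set.indicator_of_mem ht, h1, h2, one_mul, ContinuousLinearMap.lsmul_apply,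
      smul_eq_mul]
    ring
  · simp [w, Set.indicator_of_notMem ht]

/-- A vector field with divergence `f`. -/
def rayField {d : ℕ} (f : E d → ℝ) (x : E d) : E d := rayMean f x • x

/-- Substituting `s = t l` turns the mean at `l x` into `l^{-d} ∫₀^l f(sx) s^{d-1} ds`, to which the
product rule applies. The outcome is Euler's equation `x·∇μ + d μ = f` for the mean `μ`, i.e. `div(μ
x) = f`. -/
lemma hasDerivAt_rayMean_smul {d : ℕ} [NeZero d] {f : E d → ℝ} (hf : Continuous f) (x : E d) :
    HasDerivAt (fun l : ℝ => rayMean f (l • x)) (f x - d * rayMean f x) 1 := by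
  have hd : d - 1 + 1 = d := Nat.sub_add_cancel (NeZero.one_le)
  have hc : Continuous fun s : ℝ => f (s • x) * s ^ (d - 1) := by fun_prop
  have h1 : HasDerivAt (fun l : ℝ => ∫ s in (0 : ℝ)..l, f (s • x) * s ^ (d - 1)) (f x) 1 := by
    have := intervalIntegral.integral_hasDerivAt_right (hc.intervalIntegrable 0 1)
      hc.aestronglyMeasurable.stronglyMeasurableAtFilter hc.continuousAt
    simpa using this
  have h2 : HasDerivAt (fun l : ℝ => (l ^ d)⁻¹) (-(d : ℝ)) 1 := by
    have := (hasDerivAt_pow d (1 : ℝ)).fun_inv (by simp)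
    simpa using this
  have h3 := h2.mul h1
  have e : ∫ s in (0 : ℝ)..1, f (s • x) * s ^ (d - 1) = rayMean f x := rfl
  rw [e, one_pow, inv_one, one_mul] at h3
  refine (h3.congr_deriv (by ring)).congr_of_eventuallyEq ?_
  filter_upwards [Ioi_mem_nhds (zero_lt_one (α := ℝ))] with l hl
  have hl0 : l ≠ 0 := (ne_of_gt hl)
  change rayMean f (l • x) = (l ^ d)⁻¹ * ∫ s in (0 : ℝ)..l, f (s • x) * s ^ (d - 1)
  have := intervalIntegral.integral_comp_mul_right (a := 0) (b := 1)
    (fun s : ℝ => f (s • x) * s ^ (d - 1)) hl0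
  rw [zero_mul, one_mul] at this
  have h4 : ∫ t in (0 : ℝ)..1, f ((t * l) • x) * (t * l) ^ (d - 1)
      = l ^ (d - 1) * rayMean f (l • x) := by
    rw [rayMean, ← intervalIntegral.integral_const_mul]
    refine intervalIntegral.integral_congr fun t _ => ?_
    simp only [smul_smul, mul_pow]
    ring
  rw [h4, smul_eq_mul] at this
  have hpow : l ^ d = l ^ (d - 1) * l := by rw [← pow_succ, hd]
  rw [hpow, mul_inv, mul_assoc, ← this]
  field_simp

lemma divg_rayField {d : ℕ} [NeZero d] {f : E d → ℝ} (hf : ContDiff ℝ ∞ f) (x : E d) :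
    divg (rayField f) x = f x := by
  have hI : DifferentiableAt ℝ (rayMean f) x := (contDiff_rayMean hf).differentiable (by simp) x
  have h1 : ∀ i, fderiv ℝ (fun z => rayField f z i) x (EuclideanSpace.single i 1)
      = rayMean f x + fderiv ℝ (rayMean f) x (EuclideanSpace.single i 1) * x i := fun i => by
    have hX : HasFDerivAt (fun z : E d => z i) (EuclideanSpace.proj i : E d →L[ℝ] ℝ) x :=
      (EuclideanSpace.proj i : E d →L[ℝ] ℝ).hasFDerivAt
    have := hI.hasFDerivAt.mul hX
    rw [show (fun z => rayField f z i) = rayMean f * fun z : E d => z i from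
      funext fun z => by simp [rayField], this.fderiv]
    simp
    ring
  have h2 : fderiv ℝ (rayMean f) x x
      = ∑ i, fderiv ℝ (rayMean f) x (EuclideanSpace.single i 1) * x i := by
    have := congrArg (fderiv ℝ (rayMean f) x) ((EuclideanSpace.basisFun (Fin d) ℝ).sum_repr x)
    rw [← this, map_sum]
    exact Finset.sum_congr rfl fun i _ => by simp [mul_comm]
  have h3 : fderiv ℝ (rayMean f) x x = f x - d * rayMean f x := by
    have hl : HasDerivAt (fun l : ℝ => l • x) x 1 := by
      simpa using (hasDerivAt_id (1 : ℝ)).smul_const x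
    have hI' : HasFDerivAt (rayMean f) (fderiv ℝ (rayMean f) x) ((1 : ℝ) • x) := by
      rw [one_smul]; exact hI.hasFDerivAt
    exact (hI'.comp_hasDerivAt (f := fun l : ℝ => l • x) (1 : ℝ) hl).unique (hasDerivAt_rayMean_smul hf.continuous x)
  simp only [divg, h1, Finset.sum_add_distrib, ← h2, h3]
  simp

/-- Cauchy–Schwarz on `[0,1]`, in the form of a nonnegative variance. For `d ≥ 2` one has `t^{2d-2}
≤ t^d`, and `t^d` is the Jacobian of `x ↦ t x` required in the next estimate. -/
lemma sq_rayMean_le {d : ℕ} (hd : 2 ≤ d) {f : E d → ℝ} (hf : Continuous f) (x : E d) :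
    rayMean f x ^ 2 ≤ ∫ t in (0 : ℝ)..1, f (t • x) ^ 2 * t ^ d := by
  have hc : Continuous fun t : ℝ => f (t • x) * t ^ (d - 1) := by fun_prop
  have hc2 : Continuous fun t : ℝ => f (t • x) ^ 2 * t ^ d := by fun_prop
  set m := rayMean f x with hm
  have h0 : 0 ≤ ∫ t in (0 : ℝ)..1, (f (t • x) * t ^ (d - 1) - m) ^ 2 :=
    intervalIntegral.integral_nonneg zero_le_one fun t _ => sq_nonneg _
  have h1 : ∫ t in (0 : ℝ)..1, (f (t • x) * t ^ (d - 1) - m) ^ 2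
      = (∫ t in (0 : ℝ)..1, (f (t • x) * t ^ (d - 1)) ^ 2) - m ^ 2 := by
    have e : ∀ t : ℝ, (f (t • x) * t ^ (d - 1) - m) ^ 2
        = (f (t • x) * t ^ (d - 1)) ^ 2 - 2 * m * (f (t • x) * t ^ (d - 1)) + m ^ 2 := fun t => by ring
    simp_rw [e]
    have i1 : IntervalIntegrable (fun t : ℝ => (f (t • x) * t ^ (d - 1)) ^ 2) volume 0 1 :=
      (hc.pow 2).intervalIntegrable _ _
    have i2 : IntervalIntegrable (fun t : ℝ => 2 * m * (f (t • x) * t ^ (d - 1))) volume 0 1 :=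
      (continuous_const.mul hc).intervalIntegrable _ _
    rw [intervalIntegral.integral_add (i1.sub i2) (by simp), intervalIntegral.integral_sub i1 i2,
      intervalIntegral.integral_const_mul, ← rayMean, ← hm]
    simp
    ring
  have h2 : ∫ t in (0 : ℝ)..1, (f (t • x) * t ^ (d - 1)) ^ 2
      ≤ ∫ t in (0 : ℝ)..1, f (t • x) ^ 2 * t ^ d := by
    refine intervalIntegral.integral_mono_on zero_le_one ((hc.pow 2).intervalIntegrable _ _)
      (hc2.intervalIntegrable _ _) fun t ht => ?_
    rw [mul_pow, ← pow_mul]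
    exact mul_le_mul_of_nonneg_left (pow_le_pow_of_le_one ht.1 ht.2 (by omega)) (sq_nonneg _)
  linarith

/-- After Fubini, the slice at each `t` is at most `∫ f²` by scaling, which gives the constant `1`.
-/
lemma integral_sq_rayField_le {d : ℕ} (hd : 2 ≤ d) {f : E d → ℝ} (hf : IsTest f) {K : Set (E d)}
    (hK : IsClosed K) : ∫ x in dom K, ‖rayField f x‖ ^ 2 ≤ ∫ x, f x ^ 2 := by
  have hfc := hf.1.continuous
  have : NeZero d := ⟨by omega⟩
  obtain ⟨M, hM⟩ := hf.2.exists_bound_of_continuous hfc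
  have hmeas := measurableSet_dom hK
  have hsq : Integrable fun x => f x ^ 2 := by
    simp_rw [sq]
    exact (hfc.mul hfc).integrable_of_hasCompactSupport hf.2.mul_left
  let F : E d → ℝ → ℝ := fun x t => f (t • x) ^ 2 * t ^ d
  have hFc : Continuous fun q : E d × ℝ => F q.1 q.2 := by fun_prop
  have hFi : Integrable (Function.uncurry F)
      ((volume.restrict (dom K)).prod (volume.restrict (Set.Ioc (0 : ℝ) 1))) := by
    refine Integrable.of_bound hFc.aestronglyMeasurable (M ^ 2) ?_
    rw [Measure.prod_restrict, ae_restrict_iff' (hmeas.prod measurableSet_Ioc)]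
    refine Eventually.of_forall fun q hq => ?_
    have ht := hq.2
    change ‖f (q.2 • q.1) ^ 2 * q.2 ^ d‖ ≤ _
    rw [norm_mul, norm_pow, norm_pow, Real.norm_eq_abs q.2, abs_of_pos ht.1]
    calc _ ≤ M ^ 2 * 1 := by
          gcongr
          · exact pow_nonneg ht.1.le _
          · exact hM _
          · exact pow_le_one₀ ht.1.le ht.2
      _ = _ := mul_one _
  have hF1 : Integrable (fun x => ∫ t in (0 : ℝ)..1, F x t) (volume.restrict (dom K)) := by
    simp_rw [intervalIntegral.integral_of_le zero_le_one]
    exact hFi.integral_prod_left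
  have s1 : ∫ x in dom K, ‖rayField f x‖ ^ 2 ≤ ∫ x in dom K, ∫ t in (0 : ℝ)..1, F x t := by
    refine integral_mono_of_nonneg (Eventually.of_forall fun x => by positivity) hF1 ?_
    rw [EventuallyLE, ae_restrict_iff' hmeas]
    refine Eventually.of_forall fun x hx => ?_
    refine le_trans ?_ (sq_rayMean_le hd hfc x)
    rw [rayField, norm_smul, mul_pow, Real.norm_eq_abs, sq_abs]
    exact mul_le_of_le_one_right (sq_nonneg _)
      (pow_le_one₀ (norm_nonneg _) (mem_ball_zero_iff.1 (dom_subset K hx)).le)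
  have s2 : ∫ x in dom K, ∫ t in (0 : ℝ)..1, F x t = ∫ t in Set.Ioc (0 : ℝ) 1, ∫ x in dom K, F x t := by
    simp_rw [intervalIntegral.integral_of_le zero_le_one]
    exact integral_integral_swap hFi
  have s3 : ∀ t ∈ Set.Ioc (0 : ℝ) 1, ∫ x in dom K, F x t ≤ ∫ x, f x ^ 2 := fun t ht => by
    have ht0 : t ≠ 0 := ht.1.ne'
    have e : ∫ x, F x t = ∫ x, f x ^ 2 := by
      simp only [F]
      rw [integral_mul_const, Measure.integral_comp_smul volume (fun x : E d => f x ^ 2) t]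
      simp only [finrank_euclideanSpace, Fintype.card_fin, smul_eq_mul]
      have htd : t ^ d ≠ 0 := pow_ne_zero d ht0
      rw [abs_of_pos (inv_pos.2 (pow_pos ht.1 d)), mul_right_comm, inv_mul_cancel₀ htd, one_mul]
    rw [← e]
    refine setIntegral_le_integral ?_ (Eventually.of_forall fun x => ?_)
    · exact (hsq.comp_smul ht0).mul_const _
    · exact mul_nonneg (sq_nonneg _) (pow_nonneg ht.1.le _)
  have s4 : ∫ t in Set.Ioc (0 : ℝ) 1, ∫ x in dom K, F x t
      ≤ ∫ t in Set.Ioc (0 : ℝ) 1, ∫ x, f x ^ 2 :=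
    setIntegral_mono_on hFi.integral_prod_right (by simp) measurableSet_Ioc s3
  have s5 : ∫ t in Set.Ioc (0 : ℝ) 1, ∫ x, f x ^ 2 = ∫ x, f x ^ 2 := by simp
  exact (s1.trans_eq s2).trans (s4.trans_eq s5)

/-- A set containing with each point the segment to the origin. -/
def IsStar {d : ℕ} (K : Set (E d)) : Prop := ∀ x ∈ K, ∀ t ∈ Set.Icc (0 : ℝ) 1, t • x ∈ K

lemma isStar_empty {d : ℕ} : IsStar (∅ : Set (E d)) := fun x hx => absurd hx (Set.notMem_empty x)

lemma isStar_closedBall {d : ℕ} (r : ℝ) : IsStar (closedBall (0 : E d) r) := fun x hx t ht => by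
  rw [mem_closedBall_zero_iff] at hx ⊢
  rw [norm_smul, Real.norm_of_nonneg ht.1]
  exact (mul_le_of_le_one_left (norm_nonneg x) ht.2).trans hx

/-- If `z` is close to the star-shaped core, so is the whole segment from `0` to `z`; there `f`
vanishes and hence so does its mean. Thus the field is admissible in Green's formula, which imposes
no condition on the boundary of the core. -/
lemma disjoint_tsupport_rayField {d : ℕ} {f : E d → ℝ} (hf : IsTest f) {K : Set (E d)}
    (hK : IsClosed K) (hs : IsStar K) (hfK : Disjoint (tsupport f) K) :
    Disjoint (tsupport (rayField f)) K := by
  obtain ⟨δ, hδ, hdis⟩ := hfK.exists_thickenings hf.2.isCompact hK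
  refine Set.disjoint_left.2 fun x hx hxK => notMem_tsupport_iff_eventuallyEq.2 ?_ hx
  filter_upwards [isOpen_thickening.mem_nhds (self_subset_thickening hδ K hxK)] with z hz
  obtain ⟨y, hy, hzy⟩ := mem_thickening_iff.1 hz
  have : rayMean f z = 0 := by
    rw [rayMean, intervalIntegral.integral_congr (g := fun _ => (0 : ℝ))]
    · simp
    · intro t ht
      rw [Set.uIcc_of_le zero_le_one] at ht
      have hm : t • z ∈ thickening δ K := by
        refine mem_thickening_iff.2 ⟨t • y, hs y hy t ht, ?_⟩
        rw [dist_smul₀, Real.norm_of_nonneg ht.1]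
        exact lt_of_le_of_lt (mul_le_of_le_one_left dist_nonneg ht.2) hzy
      have hn : t • z ∉ tsupport f := fun hm' =>
        Set.disjoint_left.1 hdis (self_subset_thickening hδ _ hm') hm
      simp [image_eq_zero_of_notMem_tsupport hn]
  simp [rayField, this]

/-- The dual form of Poincaré's inequality. With `X = rayField f` one has `∫ U f = ∫ U div X = -∫
W·X`: the outer trace is zero and `X` vanishes near the core, so no boundary terms remain. -/
lemma abs_integral_mul_le {d : ℕ} (hd : 2 ≤ d) {K : Set (E d)} (hK : IsClosed K) (hs : IsStar K)
    {U : Lp ℝ 2 (volume.restrict (dom K))} {W : Lp (E d) 2 (volume.restrict (dom K))}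
    (h : IsExt K 0 U W) {f : E d → ℝ} (hf : IsTest f) (hfs : tsupport f ⊆ dom K) :
    |∫ x in dom K, U x * f x| ≤ ‖W‖ * √(∫ x, f x ^ 2) := by
  have : NeZero d := ⟨by omega⟩
  have hX : ContDiff ℝ ∞ (rayField f) := (contDiff_rayMean hf.1).smul contDiff_id
  have hdis : Disjoint (tsupport f) K := Set.disjoint_left.2 fun x hx => (hfs hx).2
  have e := h.divergence hK hX (disjoint_tsupport_rayField hf hK hs hdis)
  have z : ∫ y, (0 : Lp ℝ 2 (surf d)) y * ⟪rayField f (y : E d), (y : E d)⟫_ℝ ∂(surf d) = 0 := by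
    refine integral_eq_zero_of_ae ?_
    filter_upwards [Lp.coeFn_zero ℝ 2 (surf d)] with y hy
    rw [hy]; simp
  have hXm : MemLp (rayField f) 2 (volume.restrict (dom K)) := by
    obtain ⟨P, hP⟩ := (isCompact_closedBall (0 : E d) 1).exists_bound_of_continuousOn
      hX.continuous.continuousOn
    exact memLp_of_ae_bound (measurableSet_dom hK) (dom_subset K) hX.continuous.aestronglyMeasurable
      (Eventually.of_forall fun x hx => hP x (mem_closedBall_zero_iff.2 hx))
  have i2 : Integrable (fun x => ⟪W x, rayField f x⟫_ℝ) (volume.restrict (dom K)) :=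
    (L2.integrable_inner (𝕜 := ℝ) W hXm.toLp).congr (by
      filter_upwards [hXm.coeFn_toLp] with x hx
      rw [hx])
  simp only [divg_rayField hf.1] at e
  rw [integral_add (integrable_mul_test (Lp.memLp U) hf.1.continuous hf.2) i2, z] at e
  rw [eq_neg_of_add_eq_zero_left e, abs_neg]
  have e2 : ∫ x in dom K, ⟪W x, rayField f x⟫_ℝ = ⟪W, hXm.toLp⟫_ℝ := by
    rw [L2.inner_def]
    refine integral_congr_ae ?_
    filter_upwards [hXm.coeFn_toLp] with x hx
    rw [hx]
  rw [e2]
  refine (abs_real_inner_le_norm _ _).trans (mul_le_mul_of_nonneg_left ?_ (norm_nonneg _))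
  refine Real.le_sqrt_of_sq_le (le_trans (le_of_eq ?_) (integral_sq_rayField_le hd hf hK))
  rw [← real_inner_self_eq_norm_sq, L2.inner_def]
  refine integral_congr_ae ?_
  filter_upwards [hXm.coeFn_toLp] with x hx
  rw [hx, real_inner_self_eq_norm_sq]

/-- Test functions in `B₁ ∖ K`, as a subspace of `L²`. -/
def testLp {d : ℕ} (K : Set (E d)) : Submodule ℝ (Lp ℝ 2 ((volume : Measure (E d)).restrict (dom K))) where
  carrier := {F | ∃ f, IsTest f ∧ tsupport f ⊆ dom K ∧ F =ᵐ[volume.restrict (dom K)] f}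
  zero_mem' := ⟨0, ⟨contDiff_const, HasCompactSupport.zero⟩, by simp, Lp.coeFn_zero _ _ _⟩
  add_mem' := by
    rintro F F' ⟨f, hf, hs, e⟩ ⟨f', hf', hs', e'⟩
    refine ⟨f + f', ⟨hf.1.add hf'.1, hf.2.add hf'.2⟩,
      (tsupport_add f f').trans (Set.union_subset hs hs'), ?_⟩
    exact (Lp.coeFn_add F F').trans (e.add e')
  smul_mem' := by
    rintro c F ⟨f, hf, hs, e⟩
    refine ⟨c • f, ⟨hf.1.const_smul c, hf.2.smul_left (f := fun _ => c)⟩,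
      (closure_mono (Function.support_const_smul_subset c f)).trans hs, ?_⟩
    exact (Lp.coeFn_smul c F).trans (e.const_smul c)

lemma testLp_dense {d : ℕ} {K : Set (E d)} (hK : IsClosed K) :
    (testLp K).topologicalClosure = ⊤ := by
  rw [Submodule.topologicalClosure_eq_top_iff, Submodule.eq_bot_iff]
  intro F hF
  have hopen : IsOpen (dom K) := isOpen_ball.sdiff hK
  have hloc : LocallyIntegrableOn F (dom K) volume :=
    IntegrableOn.locallyIntegrableOn ((Lp.memLp F).integrable (by norm_num))
  have := hopen.ae_eq_zero_of_integral_contDiff_smul_eq_zero hloc fun g hg hgc hgs => ?_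
  · refine Lp.ext ?_
    filter_upwards [(ae_restrict_iff' (measurableSet_dom hK)).2 this,
      Lp.coeFn_zero ℝ 2 (volume.restrict (dom K))] with x h1 h2
    rw [h1, h2]; rfl
  · have hgm : MemLp g 2 (volume.restrict (dom K)) := hg.continuous.memLp_of_hasCompactSupport hgc
    have h0 := (Submodule.mem_orthogonal _ _).1 hF hgm.toLp ⟨g, ⟨hg, hgc⟩, hgs, hgm.coeFn_toLp⟩
    rw [L2.inner_def] at h0
    rw [← setIntegral_eq_integral_of_forall_compl_eq_zero (s := dom K), ← h0]
    · refine integral_congr_ae ?_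
      filter_upwards [hgm.coeFn_toLp] with x hx
      rw [hx]
      simp [mul_comm]
    · intro x hx
      rw [image_eq_zero_of_notMem_tsupport fun hn => hx (hgs hn), zero_smul]

/-- Poincaré's inequality. -/
theorem poincare {d : ℕ} (hd : 2 ≤ d) {K : Set (E d)} (hK : IsClosed K) (hs : IsStar K)
    {U : Lp ℝ 2 (volume.restrict (dom K))} {W : Lp (E d) 2 (volume.restrict (dom K))}
    (h : IsExt K 0 U W) : ‖U‖ ≤ ‖W‖ := by
  -- The bound on test functions is a closed condition, so it extends to all of `L²` and can be used
  -- with `F = U`.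
  have key : ∀ F ∈ (testLp K).topologicalClosure, |⟪U, F⟫_ℝ| ≤ ‖W‖ * ‖F‖ := by
    intro F hF
    refine closure_minimal (s := (testLp K : Set (Lp ℝ 2 (volume.restrict (dom K))))) (t := {F | |⟪U, F⟫_ℝ| ≤ ‖W‖ * ‖F‖}) ?_ ?_ hF
    · rintro F ⟨f, hf, hfs, e⟩
      have e1 : ⟪U, F⟫_ℝ = ∫ x in dom K, U x * f x := by
        rw [L2.inner_def]
        refine integral_congr_ae ?_
        filter_upwards [e] with x hx
        rw [hx]; simp [mul_comm]
      have e2 : ‖F‖ = √(∫ x, f x ^ 2) := by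
        rw [← Real.sqrt_sq (norm_nonneg F), ← real_inner_self_eq_norm_sq, L2.inner_def,
          ← setIntegral_eq_integral_of_forall_compl_eq_zero (s := dom K) (f := fun x => f x ^ 2)]
        · congr 1
          refine integral_congr_ae ?_
          filter_upwards [e] with x hx
          rw [hx]; simp [sq]
        · intro x hx
          rw [image_eq_zero_of_notMem_tsupport fun hn => hx (hfs hn)]; simp
      change |⟪U, F⟫_ℝ| ≤ ‖W‖ * ‖F‖
      rw [e1, e2]
      exact abs_integral_mul_le hd hK hs h hf hfs
    · exact isClosed_le (by fun_prop) (by fun_prop)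
  have := key U (by rw [testLp_dense hK]; trivial)
  rw [real_inner_self_eq_norm_sq, abs_of_nonneg (sq_nonneg _), sq] at this
  by_contra hlt
  rw [not_le] at hlt
  have hpos : 0 < ‖U‖ := (norm_nonneg W).trans_lt hlt
  exact absurd (le_of_mul_le_mul_right this hpos) (not_le.2 hlt)

end Cloak

noncomputable section
namespace Cloak

open MeasureTheory Metric Filter Topology Asymptotics
open scoped ContDiff InnerProductSpace

/-! ### The Dirichlet-to-Neumann map of a bounded coercive conductivity -/

/-- Lebesgue measure on `B₁ ∖ K`. -/
abbrev vol {d : ℕ} (K : Set (E d)) : Measure (E d) := (volume : Measure (E d)).restrict (dom K)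

lemma inner_Lp_of_ae {α F : Type*} [MeasurableSpace α] {μ : Measure α} [NormedAddCommGroup F]
    [InnerProductSpace ℝ F] {f g : Lp F 2 μ} {f' g' : α → F} (hf : f =ᵐ[μ] f') (hg : g =ᵐ[μ] g') :
    ⟪f, g⟫_ℝ = ∫ x, ⟪f' x, g' x⟫_ℝ ∂μ := by
  rw [L2.inner_def]
  refine integral_congr_ae ?_
  filter_upwards [hf, hg] with x h1 h2
  rw [h1, h2]

lemma norm_sq_Lp {α F : Type*} [MeasurableSpace α] {μ : Measure α} [NormedAddCommGroup F]
    [InnerProductSpace ℝ F] {f : Lp F 2 μ} {f' : α → F} (hf : f =ᵐ[μ] f') :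
    ‖f‖ ^ 2 = ∫ x, ⟪f' x, f' x⟫_ℝ ∂μ := by
  rw [← real_inner_self_eq_norm_sq, inner_Lp_of_ae hf hf]

/-- The trace condition is a family of continuous linear conditions. -/
lemma exists_trace_functional {d : ℕ} (K : Set (E d)) {ψ : E d → ℝ} (hψ : IsTest ψ) (v : E d) :
    ∃ (a : Lp ℝ 2 (vol K)) (b : Lp (E d) 2 (vol K)) (c : Lp ℝ 2 (surf d)),
      ∀ (U : Lp ℝ 2 (vol K)) (W : Lp (E d) 2 (vol K)) (φ : Lp ℝ 2 (surf d)),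
        (∫ x in dom K, (U x * fderiv ℝ ψ x v + ⟪W x, v⟫_ℝ * ψ x) = ⟪a, U⟫_ℝ + ⟪b, W⟫_ℝ) ∧
        ∫ y, φ y * (ψ (y : E d) * ⟪(y : E d), v⟫_ℝ) ∂(surf d) = ⟪c, φ⟫_ℝ := by
  have ha : MemLp (fun x => fderiv ℝ ψ x v) 2 (vol K) :=
    (continuous_fderiv_test hψ v).memLp_of_hasCompactSupport (hψ.2.fderiv_apply ℝ v)
  have hb : MemLp (fun x => ψ x • v) 2 (vol K) :=
    (hψ.1.continuous.smul continuous_const).memLp_of_hasCompactSupport hψ.2.smul_right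
  have hc : MemLp (fun y : sphere (0 : E d) 1 => ψ (y : E d) * ⟪(y : E d), v⟫_ℝ) 2 (surf d) :=
    ((hψ.1.continuous.comp continuous_subtype_val).mul
      (continuous_subtype_val.inner continuous_const)).memLp_of_hasCompactSupport
      (HasCompactSupport.of_compactSpace _)
  refine ⟨ha.toLp, hb.toLp, hc.toLp, fun U W φ => ⟨?_, ?_⟩⟩
  · rw [integral_add (integrable_u (Lp.memLp U) hψ v) (integrable_G (Lp.memLp W) hψ v),
      inner_Lp_of_ae ha.coeFn_toLp (ae_eq_refl U), inner_Lp_of_ae hb.coeFn_toLp (ae_eq_refl W)]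
    congr 1
    refine integral_congr_ae (Eventually.of_forall fun x => ?_)
    simp only [inner_smul_left, conj_trivial, real_inner_comm v]
    ring
  · rw [inner_Lp_of_ae hc.coeFn_toLp (ae_eq_refl φ)]
    rfl

lemma isClosed_isExt {d : ℕ} (K : Set (E d)) :
    IsClosed {q : Lp ℝ 2 (vol K) × Lp (E d) 2 (vol K) × Lp ℝ 2 (surf d) |
      IsExt K q.2.2 q.1 q.2.1} := by
  have : {q : Lp ℝ 2 (vol K) × Lp (E d) 2 (vol K) × Lp ℝ 2 (surf d) | IsExt K q.2.2 q.1 q.2.1}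
      = ⋂ ψ : {ψ : E d → ℝ // IsTest ψ ∧ Disjoint (tsupport ψ) K}, ⋂ v : E d,
        {q | ∫ x in dom K, (q.1 x * fderiv ℝ ψ.1 x v + ⟪q.2.1 x, v⟫_ℝ * ψ.1 x)
          = ∫ y, q.2.2 y * (ψ.1 (y : E d) * ⟪(y : E d), v⟫_ℝ) ∂(surf d)} := by
    ext q
    simp only [Set.mem_ofPred_eq, Set.mem_iInter]
    exact ⟨fun h ψ v => h.trace ψ.1 ψ.2.1 ψ.2.2 v, fun h =>
      IsExt.of_trace (Lp.memLp _) (Lp.memLp _) fun ψ hψ hs v => h ⟨ψ, hψ, hs⟩ v⟩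
  rw [this]
  refine isClosed_iInter fun ψ => isClosed_iInter fun v => ?_
  obtain ⟨a, b, c, h⟩ := exists_trace_functional K ψ.2.1 v
  simp only [fun q : Lp ℝ 2 (vol K) × Lp (E d) 2 (vol K) × Lp ℝ 2 (surf d) =>
    (h q.1 q.2.1 q.2.2).1, fun q : Lp ℝ 2 (vol K) × Lp (E d) 2 (vol K) × Lp ℝ 2 (surf d) =>
    (h q.1 q.2.1 q.2.2).2]
  exact isClosed_eq (by fun_prop) (by fun_prop)

lemma IsExt.toLp {d : ℕ} {K : Set (E d)} {φ : Lp ℝ 2 (surf d)} {u : E d → ℝ} {G : E d → E d}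
    (h : IsExt K φ u G) : IsExt K φ h.h1.memLp.toLp h.h1.memLp_grad.toLp :=
  h.congr h.h1.memLp.coeFn_toLp.symm h.h1.memLp_grad.coeFn_toLp.symm

/-- Linear combinations of extensions given by `Lp` classes. -/
lemma IsExt.add_Lp {d : ℕ} {K : Set (E d)} {φ₁ φ₂ : Lp ℝ 2 (surf d)} {u₁ u₂ : Lp ℝ 2 (vol K)}
    {G₁ G₂ : Lp (E d) 2 (vol K)} (h₁ : IsExt K φ₁ u₁ G₁) (h₂ : IsExt K φ₂ u₂ G₂) :
    IsExt K (φ₁ + φ₂) (u₁ + u₂ : Lp ℝ 2 (vol K)) (G₁ + G₂ : Lp (E d) 2 (vol K)) :=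
  (h₁.add h₂).congr (Lp.coeFn_add _ _).symm (Lp.coeFn_add _ _).symm

lemma IsExt.smul_Lp {d : ℕ} {K : Set (E d)} {φ : Lp ℝ 2 (surf d)} {u : Lp ℝ 2 (vol K)}
    {G : Lp (E d) 2 (vol K)} (c : ℝ) (h : IsExt K φ u G) :
    IsExt K (c • φ) (c • u : Lp ℝ 2 (vol K)) (c • G : Lp (E d) 2 (vol K)) :=
  (h.smul c).congr (Lp.coeFn_smul _ _).symm (Lp.coeFn_smul _ _).symm

lemma IsExt.sub_Lp {d : ℕ} {K : Set (E d)} {φ₁ φ₂ : Lp ℝ 2 (surf d)} {u₁ u₂ : Lp ℝ 2 (vol K)}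
    {G₁ G₂ : Lp (E d) 2 (vol K)} (h₁ : IsExt K φ₁ u₁ G₁) (h₂ : IsExt K φ₂ u₂ G₂) :
    IsExt K (φ₁ - φ₂) (u₁ - u₂ : Lp ℝ 2 (vol K)) (G₁ - G₂ : Lp (E d) 2 (vol K)) :=
  (h₁.sub h₂).congr (Lp.coeFn_sub _ _).symm (Lp.coeFn_sub _ _).symm

lemma IsExt.zero_Lp {d : ℕ} (K : Set (E d)) :
    IsExt K 0 (0 : Lp ℝ 2 (vol K)) (0 : Lp (E d) 2 (vol K)) :=
  (IsExt.zero K).congr (Lp.coeFn_zero _ _ _).symm (Lp.coeFn_zero _ _ _).symm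

/-- Gradients of the functions that vanish on the outer boundary. -/
def gradZero {d : ℕ} (K : Set (E d)) : Submodule ℝ (Lp (E d) 2 (vol K)) where
  carrier := {Z | ∃ w : Lp ℝ 2 (vol K), IsExt K 0 w Z}
  zero_mem' := ⟨0, IsExt.zero_Lp K⟩
  add_mem' := by
    rintro Z Z' ⟨w, h⟩ ⟨w', h'⟩
    exact ⟨w + w', by simpa using h.add_Lp h'⟩
  smul_mem' := by
    rintro c Z ⟨w, h⟩
    exact ⟨c • w, by simpa using h.smul_Lp c⟩

/-- Poincaré's inequality makes the functions Cauchy as soon as their gradients are, and the set of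
triples of function, gradient and trace is closed. -/
lemma isClosed_gradZero {d : ℕ} (hd : 2 ≤ d) {K : Set (E d)} (hK : IsClosed K) (hs : IsStar K) :
    IsClosed (gradZero K : Set (Lp (E d) 2 (vol K))) := by
  refine IsSeqClosed.isClosed fun Z Z₀ hZ hlim => ?_
  choose w hw using hZ
  have hc : CauchySeq w := by
    rw [Metric.cauchySeq_iff']
    intro ε hε
    obtain ⟨n, hn⟩ := Metric.cauchySeq_iff'.1 hlim.cauchySeq ε hε
    refine ⟨n, fun m hm => lt_of_le_of_lt ?_ (hn m hm)⟩
    rw [dist_eq_norm, dist_eq_norm]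
    refine poincare hd hK hs ?_
    simpa using (hw m).sub_Lp (hw n)
  obtain ⟨w₀, hw₀⟩ := cauchySeq_tendsto_of_complete hc
  refine ⟨w₀, ?_⟩
  exact (isClosed_isExt K).mem_of_tendsto
    (hw₀.prodMk_nhds (hlim.prodMk_nhds (tendsto_const_nhds (x := (0 : Lp ℝ 2 (surf d))))))
    (Eventually.of_forall hw)

/-- Measurable symmetric conductivities with ellipticity bounds `m` and `M` in `B₁ ∖ K`. -/
structure IsCond {d : ℕ} (K : Set (E d)) (A : E d → E d →L[ℝ] E d) (m M : ℝ) : Prop where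
  pos : 0 < m
  meas : AEStronglyMeasurable A (vol K)
  symm : ∀ᵐ x ∂vol K, ∀ v w, ⟪A x v, w⟫_ℝ = ⟪v, A x w⟫_ℝ
  coercive : ∀ᵐ x ∂vol K, ∀ v, m * ‖v‖ ^ 2 ≤ ⟪A x v, v⟫_ℝ
  bounded : ∀ᵐ x ∂vol K, ‖A x‖ ≤ M

namespace IsCond

variable {d : ℕ} {K : Set (E d)} {A : E d → E d →L[ℝ] E d} {m M : ℝ}

lemma memLp (hA : IsCond K A m M) {G : E d → E d} (hG : MemLp G 2 (vol K)) :
    MemLp (fun x => A x (G x)) 2 (vol K) := by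
  refine hG.of_le_mul (c := M) ?_ ?_
  · exact isBoundedBilinearMap_apply.continuous.comp_aestronglyMeasurable (hA.meas.prodMk hG.1)
  · filter_upwards [hA.bounded] with x hx
    exact (A x).le_of_opNorm_le hx _

/-- Multiplication by the conductivity. -/
def mulOp (hA : IsCond K A m M) : Lp (E d) 2 (vol K) →L[ℝ] Lp (E d) 2 (vol K) :=
  LinearMap.mkContinuous
    { toFun := fun Z => (hA.memLp (Lp.memLp Z)).toLp
      map_add' := fun Z Z' => by
        refine Lp.ext ?_
        filter_upwards [(hA.memLp (Lp.memLp (Z + Z'))).coeFn_toLp, (hA.memLp (Lp.memLp Z)).coeFn_toLp,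
          (hA.memLp (Lp.memLp Z')).coeFn_toLp, Lp.coeFn_add Z Z',
          Lp.coeFn_add (hA.memLp (Lp.memLp Z)).toLp (hA.memLp (Lp.memLp Z')).toLp] with x h1 h2 h3 h4 h5
        rw [h1, h5, Pi.add_apply, h2, h3, h4, Pi.add_apply, map_add]
      map_smul' := fun c Z => by
        refine Lp.ext ?_
        filter_upwards [(hA.memLp (Lp.memLp (c • Z))).coeFn_toLp, (hA.memLp (Lp.memLp Z)).coeFn_toLp,
          Lp.coeFn_smul c Z, Lp.coeFn_smul c (hA.memLp (Lp.memLp Z)).toLp] with x h1 h2 h3 h4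
        rw [h1, h3, RingHom.id_apply, h4, Pi.smul_apply, Pi.smul_apply, map_smul, h2] } M
    fun Z => by
      refine Lp.norm_le_mul_norm_of_ae_le_mul ?_
      filter_upwards [hA.bounded, (hA.memLp (Lp.memLp Z)).coeFn_toLp] with x hx h1
      exact (le_of_eq (congrArg norm h1)).trans ((A x).le_of_opNorm_le hx _)

lemma mulOp_ae (hA : IsCond K A m M) (Z : Lp (E d) 2 (vol K)) :
    hA.mulOp Z =ᵐ[vol K] fun x => A x (Z x) := (hA.memLp (Lp.memLp Z)).coeFn_toLp

lemma inner_mulOp (hA : IsCond K A m M) {Z Z' : Lp (E d) 2 (vol K)} {G G' : E d → E d}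
    (h : Z =ᵐ[vol K] G) (h' : Z' =ᵐ[vol K] G') :
    ⟪hA.mulOp Z, Z'⟫_ℝ = ∫ x in dom K, ⟪A x (G x), G' x⟫_ℝ := by
  refine inner_Lp_of_ae ?_ h'
  filter_upwards [hA.mulOp_ae Z, h] with x h1 h2
  rw [h1, h2]

lemma mulOp_symm (hA : IsCond K A m M) (Z Z' : Lp (E d) 2 (vol K)) :
    ⟪hA.mulOp Z, Z'⟫_ℝ = ⟪hA.mulOp Z', Z⟫_ℝ := by
  rw [hA.inner_mulOp (ae_eq_refl _) (ae_eq_refl _), hA.inner_mulOp (ae_eq_refl _) (ae_eq_refl _)]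
  refine integral_congr_ae ?_
  filter_upwards [hA.symm] with x hx
  rw [hx, real_inner_comm]

lemma mulOp_coercive (hA : IsCond K A m M) (Z : Lp (E d) 2 (vol K)) :
    m * ‖Z‖ ^ 2 ≤ ⟪hA.mulOp Z, Z⟫_ℝ := by
  rw [norm_sq_Lp (ae_eq_refl Z), ← integral_const_mul, hA.inner_mulOp (ae_eq_refl _) (ae_eq_refl _)]
  have i1 := L2.integrable_inner (𝕜 := ℝ) Z Z
  have i2 : Integrable (fun x => ⟪A x (Z x), Z x⟫_ℝ) (vol K) :=
    (L2.integrable_inner (𝕜 := ℝ) (hA.mulOp Z) Z).congr (by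
      filter_upwards [hA.mulOp_ae Z] with x hx
      rw [hx])
  refine integral_mono_ae (i1.const_mul m) i2 ?_
  filter_upwards [hA.coercive] with x hx
  simpa [real_inner_self_eq_norm_sq] using hx (Z x)

lemma mulOp_nonneg (hA : IsCond K A m M) (Z : Lp (E d) 2 (vol K)) : 0 ≤ ⟪hA.mulOp Z, Z⟫_ℝ :=
  (mul_nonneg hA.pos.le (sq_nonneg _)).trans (hA.mulOp_coercive Z)

lemma norm_mulOp_le (hA : IsCond K A m M) (Z : Lp (E d) 2 (vol K)) :
    ‖hA.mulOp Z‖ ≤ M * ‖Z‖ := by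
  refine Lp.norm_le_mul_norm_of_ae_le_mul ?_
  filter_upwards [hA.bounded, hA.mulOp_ae Z] with x hx h1
  rw [h1]
  exact (A x).le_of_opNorm_le hx _

/-- Weak solutions given by `Lp` classes. -/
lemma isWeakSol_iff (hA : IsCond K A m M) {φ : Lp ℝ 2 (surf d)} {U : Lp ℝ 2 (vol K)}
    {G : Lp (E d) 2 (vol K)} : IsWeakSol K A φ U G ↔
      IsExt K φ U G ∧ ∀ Z ∈ gradZero K, ⟪hA.mulOp G, Z⟫_ℝ = 0 := by
  refine ⟨fun h => ⟨h.ext, ?_⟩, fun h => ⟨h.1, fun w Z hZ => ?_⟩⟩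
  · rintro Z ⟨w, hw⟩
    rw [hA.inner_mulOp (ae_eq_refl _) (ae_eq_refl _)]
    exact h.weak w Z hw
  · rw [← hA.inner_mulOp (ae_eq_refl G) hZ.h1.memLp_grad.coeFn_toLp]
    exact h.2 _ ⟨_, hZ.toLp⟩

lemma _root_.Cloak.IsWeakSol.toLp {φ : Lp ℝ 2 (surf d)} {u : E d → ℝ} {G : E d → E d}
    (h : IsWeakSol K A φ u G) :
    IsWeakSol K A φ h.ext.h1.memLp.toLp h.ext.h1.memLp_grad.toLp := by
  refine ⟨h.ext.toLp, fun w Z hZ => ?_⟩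
  rw [← h.weak w Z hZ]
  refine integral_congr_ae ?_
  filter_upwards [h.ext.h1.memLp_grad.coeFn_toLp] with x hx
  rw [hx]

/-- Lax–Milgram for a correction with zero outer trace added to a given extension. The unknown is
the gradient itself, so coercivity is immediate and only completeness of `gradZero K` is needed. -/
lemma exists_isWeakSol (hA : IsCond K A m M) (hd : 2 ≤ d) (hK : IsClosed K) (hs : IsStar K)
    {φ : Lp ℝ 2 (surf d)} {U₀ : Lp ℝ 2 (vol K)} {G₀ : Lp (E d) 2 (vol K)} (h : IsExt K φ U₀ G₀) :
    ∃ (U : Lp ℝ 2 (vol K)) (G : Lp (E d) 2 (vol K)), IsWeakSol K A φ U G := by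
  have : CompleteSpace (gradZero K) := (isClosed_gradZero hd hK hs).completeSpace_coe
  let B : gradZero K →L[ℝ] gradZero K →L[ℝ] ℝ :=
    ((innerSL ℝ).comp hA.mulOp).bilinearComp (gradZero K).subtypeL (gradZero K).subtypeL
  have hB : ∀ z z' : gradZero K, B z z' = ⟪hA.mulOp z, (z' : Lp (E d) 2 (vol K))⟫_ℝ := fun _ _ => rfl
  have hco : IsCoercive B := ⟨m, hA.pos, fun z => by
    rw [hB, mul_assoc, ← sq]
    exact hA.mulOp_coercive z⟩
  let ℓ : StrongDual ℝ (gradZero K) := (innerSL ℝ (-hA.mulOp G₀)).comp (gradZero K).subtypeL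
  obtain ⟨z, hz⟩ := hco.continuousLinearEquivOfBilin.surjective
    ((InnerProductSpace.toDual ℝ (gradZero K)).symm ℓ)
  obtain ⟨w, hw⟩ := z.2
  refine ⟨U₀ + w, G₀ + z, hA.isWeakSol_iff.2 ⟨by simpa using h.add_Lp hw, fun Z hZ => ?_⟩⟩
  have e := hco.continuousLinearEquivOfBilin_apply z ⟨Z, hZ⟩
  rw [hz, InnerProductSpace.toDual_symm_apply, hB] at e
  have e' : ℓ ⟨Z, hZ⟩ = -⟪hA.mulOp G₀, Z⟫_ℝ := by
    change ⟪-hA.mulOp G₀, Z⟫_ℝ = _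
    rw [inner_neg_left]
  rw [map_add, inner_add_left, ← e, e']
  ring

lemma isWeakSol_unique (hA : IsCond K A m M) {φ : Lp ℝ 2 (surf d)} {U U' : Lp ℝ 2 (vol K)}
    {G G' : Lp (E d) 2 (vol K)} (h : IsWeakSol K A φ U G) (h' : IsWeakSol K A φ U' G') : G = G' := by
  have hz : G - G' ∈ gradZero K := ⟨U - U', by simpa using h.ext.sub_Lp h'.ext⟩
  have e := (hA.isWeakSol_iff.1 h).2 _ hz
  have e' := (hA.isWeakSol_iff.1 h').2 _ hz
  have c := hA.mulOp_coercive (G - G')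
  rw [map_sub, inner_sub_left, e, e', sub_zero] at c
  have : ‖G - G'‖ ^ 2 ≤ 0 := by
    by_contra hlt
    exact absurd c (not_le.2 (mul_pos hA.pos (not_le.1 hlt)))
  exact sub_eq_zero.1 (norm_eq_zero.1 (pow_eq_zero_iff two_ne_zero |>.1 (le_antisymm this (sq_nonneg _))))

/-- The energy of a weak solution against any extension. -/
lemma inner_sol (hA : IsCond K A m M) {φ ψ : Lp ℝ 2 (surf d)} {U U' : Lp ℝ 2 (vol K)}
    {G G' G'' : Lp (E d) 2 (vol K)} {U'' : Lp ℝ 2 (vol K)} (h : IsWeakSol K A φ U G)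
    (h' : IsExt K ψ U' G') (h'' : IsExt K ψ U'' G'') :
    ⟪hA.mulOp G, G'⟫_ℝ = ⟪hA.mulOp G, G''⟫_ℝ := by
  have hz : G' - G'' ∈ gradZero K := ⟨U' - U'', by simpa using h'.sub_Lp h''⟩
  have e := (hA.isWeakSol_iff.1 h).2 _ hz
  rw [inner_sub_right] at e
  exact sub_eq_zero.1 e

/-- Weak solutions minimise the energy. -/
lemma energy_le (hA : IsCond K A m M) {φ : Lp ℝ 2 (surf d)} {U U' : Lp ℝ 2 (vol K)}
    {G G' : Lp (E d) 2 (vol K)} (h : IsWeakSol K A φ U G) (h' : IsExt K φ U' G') :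
    ⟪hA.mulOp G, G⟫_ℝ ≤ ⟪hA.mulOp G', G'⟫_ℝ := by
  have e := hA.inner_sol h h' h.ext
  have p := hA.mulOp_nonneg (G' - G)
  rw [map_sub, inner_sub_left, inner_sub_right, inner_sub_right, hA.mulOp_symm G' G, e] at p
  linarith

end IsCond

/-! ### Existence, symmetry and energy bounds of the Dirichlet-to-Neumann map. -/

lemma Hhalf.exists_isExt {d : ℕ} (K : Set (E d)) (φ : Hhalf d) :
    ∃ (U : Lp ℝ 2 (vol K)) (G : Lp (E d) 2 (vol K)), IsExt K φ.toL2 U G := by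
  obtain ⟨u, G, h⟩ := φ.2
  exact ⟨_, _, (IsExt.restrict (K := K) h).toLp⟩

/-- A quantity bounded by the Dirichlet integral of every extension is bounded by the norm. -/
lemma Hhalf.le_norm {d : ℕ} {φ : Hhalf d} {c : ℝ}
    (h : ∀ (U : Lp ℝ 2 (vol ∅)) (G : Lp (E d) 2 (vol ∅)), IsExt ∅ φ.toL2 U G → c ≤ ‖G‖) : c ≤ ‖φ‖ := by
  rw [norm_def]
  refine le_csInf (normSet_nonempty φ) ?_
  rintro _ ⟨u, G, hG, rfl⟩
  refine (h _ _ hG.toLp).trans ?_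
  rw [Lp.norm_toLp]
  exact Real.le_sqrt_of_sq_le (by rw [gradNorm]; nlinarith [sq_nonneg ‖φ.toL2‖])

lemma norm_restrict_le {d : ℕ} {K : Set (E d)} {G : Lp (E d) 2 (vol (∅ : Set (E d)))} {W : Lp (E d) 2 (vol K)}
    (h : W =ᵐ[vol K] G) : ‖W‖ ≤ ‖G‖ := by
  have hsub : dom K ⊆ dom (∅ : Set (E d)) := Set.sdiff_subset_sdiff_right (Set.empty_subset K)
  rw [Lp.norm_def, Lp.norm_def, eLpNorm_congr_ae h]
  exact ENNReal.toReal_mono (Lp.eLpNorm_ne_top G) (eLpNorm_mono_measure _ (Measure.restrict_mono_set _ hsub))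

section Map

variable {d : ℕ} {K : Set (E d)} {A : E d → E d →L[ℝ] E d} {m M : ℝ}

/-- Coercivity bounds `m ‖G‖²` by the energy, which may be paired with any extension `G'` of the
same data. Taking for `G'` restrictions of extensions to the full ball and passing to the infimum
produces the `H^{1/2}` norm. -/
lemma IsCond.norm_sol_le (hA : IsCond K A m M) (φ : Hhalf d) {U : Lp ℝ 2 (vol K)}
    {G : Lp (E d) 2 (vol K)} (h : IsWeakSol K A φ.toL2 U G) : ‖G‖ ≤ |M| / m * ‖φ‖ := by
  have key : ∀ (U' : Lp ℝ 2 (vol K)) (G' : Lp (E d) 2 (vol K)), IsExt K φ.toL2 U' G' →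
      m * ‖G‖ ≤ |M| * ‖G'‖ := by
    intro U' G' h'
    have e := hA.inner_sol h h' h.ext
    have c := hA.mulOp_coercive G
    rw [← e, hA.mulOp_symm] at c
    have c2 := c.trans (real_inner_le_norm _ _)
    have c3 : ‖hA.mulOp G'‖ ≤ |M| * ‖G'‖ := (hA.norm_mulOp_le G').trans
      (mul_le_mul_of_nonneg_right (le_abs_self M) (norm_nonneg _))
    have c4 : m * ‖G‖ ^ 2 ≤ (|M| * ‖G'‖) * ‖G‖ := c2.trans (mul_le_mul_of_nonneg_right c3 (norm_nonneg _))
    rcases (norm_nonneg G).eq_or_lt with h0 | h0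
    · rw [← h0, mul_zero]; positivity
    · refine le_of_mul_le_mul_right ?_ h0
      rw [mul_assoc, ← sq]
      exact c4
  rcases (abs_nonneg M).eq_or_lt with h0 | h0
  · have := key _ _ h.ext
    rw [← h0, zero_mul] at this
    rw [← h0, zero_div, zero_mul]
    by_contra hlt
    exact absurd this (not_le.2 (mul_pos hA.pos (not_le.1 hlt)))
  · have : m / |M| * ‖G‖ ≤ ‖φ‖ := Hhalf.le_norm fun U' G' h' => by
      have h2 := (IsExt.restrict (K := K) h')
      have := key _ _ h2.toLp
      have h3 := norm_restrict_le h2.h1.memLp_grad.coeFn_toLp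
      rw [div_mul_eq_mul_div, div_le_iff₀ h0]
      nlinarith
    rw [div_mul_eq_mul_div, div_le_iff₀ h0] at this
    rw [div_mul_eq_mul_div, le_div_iff₀ hA.pos]
    linarith

theorem IsCond.exists_isDtN (hA : IsCond K A m M) (hd : 2 ≤ d) (hK : IsClosed K) (hs : IsStar K) :
    ∃ Λ : Hhalf d →L[ℝ] HnegHalf d, IsDtN K A Λ := by
  have hsol : ∀ φ : Hhalf d, ∃ (q : Lp ℝ 2 (vol K) × Lp (E d) 2 (vol K)),
      IsWeakSol K A φ.toL2 q.1 q.2 := fun φ => by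
    obtain ⟨U, G, h⟩ := φ.exists_isExt K
    obtain ⟨U', G', h'⟩ := hA.exists_isWeakSol hd hK hs h
    exact ⟨(U', G'), h'⟩
  choose q hq using hsol
  -- The gradients were chosen arbitrarily for each datum; linearity comes from their uniqueness.
  let T : Hhalf d →ₗ[ℝ] Lp (E d) 2 (vol K) :=
    { toFun := fun φ => (q φ).2
      map_add' := fun φ ψ => by
        refine hA.isWeakSol_unique (hq (φ + ψ)) (U' := (q φ).1 + (q ψ).1) ?_
        have h1 := hA.isWeakSol_iff.1 (hq φ)
        have h2 := hA.isWeakSol_iff.1 (hq ψ)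
        refine hA.isWeakSol_iff.2 ⟨by rw [map_add]; exact h1.1.add_Lp h2.1, fun Z hZ => ?_⟩
        rw [map_add, inner_add_left, h1.2 Z hZ, h2.2 Z hZ, add_zero]
      map_smul' := fun c φ => by
        refine hA.isWeakSol_unique (hq (c • φ)) (U' := c • (q φ).1) ?_
        have h1 := hA.isWeakSol_iff.1 (hq φ)
        refine hA.isWeakSol_iff.2 ⟨by rw [map_smul]; exact h1.1.smul_Lp c, fun Z hZ => ?_⟩
        rw [RingHom.id_apply, map_smul, inner_smul_left, h1.2 Z hZ, mul_zero] }
  have hT : ∀ φ, ‖T φ‖ ≤ |M| / m * ‖φ‖ := fun φ => hA.norm_sol_le φ (hq φ)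
  let T' : Hhalf d →L[ℝ] Lp (E d) 2 (vol K) := T.mkContinuous _ hT
  refine ⟨((innerSL ℝ).comp hA.mulOp).bilinearComp T' T', fun ψ => ?_, fun φ => ⟨⟨_, _, hq φ⟩, ?_⟩⟩
  · obtain ⟨U, G, h⟩ := ψ.exists_isExt K
    exact ⟨_, _, h⟩
  · intro u G hG ψ w Z hZ
    change ⟪hA.mulOp (q φ).2, (q ψ).2⟫_ℝ = _
    rw [hA.inner_sol (hq φ) (hq ψ).ext hZ.toLp,
      hA.isWeakSol_unique (hq φ) hG.toLp]
    exact hA.inner_mulOp hG.ext.h1.memLp_grad.coeFn_toLp hZ.h1.memLp_grad.coeFn_toLp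

variable {Λ : Hhalf d →L[ℝ] HnegHalf d}

lemma IsDtN.exists_sol (h : IsDtN K A Λ) (φ : Hhalf d) :
    ∃ (U : Lp ℝ 2 (vol K)) (G : Lp (E d) 2 (vol K)), IsWeakSol K A φ.toL2 U G := by
  obtain ⟨u, G, hG⟩ := (h.2 φ).1
  exact ⟨_, _, hG.toLp⟩

lemma IsDtN.apply_eq (hA : IsCond K A m M) (h : IsDtN K A Λ) {φ ψ : Hhalf d} {U U' : Lp ℝ 2 (vol K)}
    {G G' : Lp (E d) 2 (vol K)} (hG : IsWeakSol K A φ.toL2 U G) (hG' : IsExt K ψ.toL2 U' G') :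
    Λ φ ψ = ⟪hA.mulOp G, G'⟫_ℝ := by
  rw [(h.2 φ).2 _ _ hG ψ _ _ hG', hA.inner_mulOp (ae_eq_refl _) (ae_eq_refl _)]

lemma IsDtN.symm (hA : IsCond K A m M) (h : IsDtN K A Λ) (φ ψ : Hhalf d) : Λ φ ψ = Λ ψ φ := by
  obtain ⟨U, G, hG⟩ := h.exists_sol φ
  obtain ⟨U', G', hG'⟩ := h.exists_sol ψ
  rw [h.apply_eq hA hG hG'.ext, h.apply_eq hA hG' hG.ext, hA.mulOp_symm]

lemma IsDtN.nonneg (hA : IsCond K A m M) (h : IsDtN K A Λ) (φ : Hhalf d) : 0 ≤ Λ φ φ := by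
  obtain ⟨U, G, hG⟩ := h.exists_sol φ
  rw [h.apply_eq hA hG hG.ext]
  exact hA.mulOp_nonneg G

lemma IsDtN.apply_le (hA : IsCond K A m M) (h : IsDtN K A Λ) {φ : Hhalf d} {U : Lp ℝ 2 (vol K)}
    {G : Lp (E d) 2 (vol K)} (hG : IsExt K φ.toL2 U G) : Λ φ φ ≤ |M| * ‖G‖ ^ 2 := by
  obtain ⟨U', G', hG'⟩ := h.exists_sol φ
  rw [h.apply_eq hA hG' hG'.ext]
  refine (hA.energy_le hG' hG).trans ((real_inner_le_norm _ _).trans ?_)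
  rw [sq, ← mul_assoc]
  exact mul_le_mul_of_nonneg_right ((hA.norm_mulOp_le G).trans
      (mul_le_mul_of_nonneg_right (le_abs_self M) (norm_nonneg _))) (norm_nonneg _)

end Map

lemma isCond_iso_one {d : ℕ} : IsCond (∅ : Set (E d)) (iso fun _ => 1) 1 1 where
  pos := one_pos
  meas := by unfold iso; exact aestronglyMeasurable_const
  symm := Eventually.of_forall fun x v w => by simp [iso]
  coercive := Eventually.of_forall fun x v => by simp [iso]
  bounded := Eventually.of_forall fun x => by
    simp only [iso, one_smul]
    exact ContinuousLinearMap.norm_id_le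

end Cloak

end

noncomputable section
namespace Cloak

open MeasureTheory Metric Filter Topology Asymptotics
open scoped ContDiff InnerProductSpace

/-! ### Harmonic polynomials are dense -/

lemma polyLaplacian_sqX_mul {d n : ℕ} {t : MvPolynomial (Fin d) ℝ} (ht : t.IsHomogeneous n) :
    polyLaplacian d (sqX d * t)
      = MvPolynomial.C (2 * d + 4 * n : ℝ) * t + sqX d * polyLaplacian d t := by
  rw [polyLaplacian_apply, polyLaplacian_apply]
  have h : ∀ i : Fin d, MvPolynomial.pderiv i (MvPolynomial.pderiv i (sqX d * t))
      = MvPolynomial.C 2 * t + MvPolynomial.C 4 * (MvPolynomial.X i * MvPolynomial.pderiv i t)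
        + sqX d * MvPolynomial.pderiv i (MvPolynomial.pderiv i t) := fun i => by
    simp only [Derivation.leibniz, pderiv_sqX, map_add, smul_eq_mul, MvPolynomial.pderiv_X_self,
      MvPolynomial.pderiv_C]
    rw [show (4 : ℝ) = 2 + 2 by norm_num, map_add]
    ring
  have e := ht.sum_X_mul_pderiv
  simp only [h, Finset.sum_add_distrib, ← Finset.mul_sum, e, Finset.sum_const, Finset.card_univ,
    Fintype.card_fin, nsmul_eq_mul, map_add, map_mul, map_natCast]
  ring

lemma isHomogeneous_sqX (d : ℕ) : (sqX d).IsHomogeneous 2 :=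
  MvPolynomial.IsHomogeneous.sum _ _ _ fun i _ => by
    simpa using (MvPolynomial.isHomogeneous_X ℝ i).pow 2

lemma isHomogeneous_polyLaplacian {d n : ℕ} {p : MvPolynomial (Fin d) ℝ}
    (hp : p.IsHomogeneous n) : (polyLaplacian d p).IsHomogeneous (n - 2) := by
  rw [polyLaplacian_apply]
  exact MvPolynomial.IsHomogeneous.sum _ _ _ fun i _ => by
    simpa [Nat.sub_sub] using (hp.pderiv (i := i)).pderiv (i := i)

lemma polyLaplacian_eq_zero_of_le_one {d n : ℕ} (hn : n ≤ 1) {p : MvPolynomial (Fin d) ℝ}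
    (hp : p.IsHomogeneous n) : polyLaplacian d p = 0 := by
  rw [polyLaplacian_apply]
  refine Finset.sum_eq_zero fun i _ => ?_
  have h1 : (MvPolynomial.pderiv i p).IsHomogeneous 0 := by
    simpa [Nat.sub_eq_zero_of_le hn] using hp.pderiv (i := i)
  rw [← MvPolynomial.totalDegree_zero_iff_isHomogeneous, MvPolynomial.totalDegree_eq_zero_iff_eq_C] at h1
  rw [h1, MvPolynomial.pderiv_C]

/-- `λ + |x|² Δ` is onto the homogeneous polynomials of degree `n`. -/
lemma exists_add_sqX_mul_polyLaplacian {d : ℕ} (n : ℕ) : ∀ (l : ℝ), 0 < l →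
    ∀ q : MvPolynomial (Fin d) ℝ, q.IsHomogeneous n →
      ∃ t : MvPolynomial (Fin d) ℝ, t.IsHomogeneous n ∧
        MvPolynomial.C l * t + sqX d * polyLaplacian d t = q := by
  induction n using Nat.strong_induction_on with
  | _ n ih =>
    intro l hl q hq
    have hC : MvPolynomial.C l * MvPolynomial.C l⁻¹ = (1 : MvPolynomial (Fin d) ℝ) := by
      rw [← map_mul, mul_inv_cancel₀ hl.ne', map_one]
    rcases Nat.lt_or_ge n 2 with hn | hn
    · have ht : (MvPolynomial.C l⁻¹ * q).IsHomogeneous n := hq.C_mul _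
      refine ⟨_, ht, ?_⟩
      rw [polyLaplacian_eq_zero_of_le_one (by omega) ht, mul_zero, add_zero, ← mul_assoc, hC, one_mul]
    -- With the ansatz `t = l⁻¹ (q - |x|² s)`, the equation says `s = Δt`. Applying `Δ` turns this
    -- into `(l + 2d + 4(n-2)) s + |x|² Δs = Δq`, the same problem two degrees lower with a larger
    -- constant.
    · obtain ⟨s, hs, e⟩ := ih (n - 2) (by omega) (l + (2 * d + 4 * (n - 2 : ℕ))) (by positivity)
        (polyLaplacian d q) (isHomogeneous_polyLaplacian hq)
      have hsq : (sqX d * s).IsHomogeneous n := by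
        have := (isHomogeneous_sqX d).mul hs
        rwa [show 2 + (n - 2) = n by omega] at this
      refine ⟨MvPolynomial.C l⁻¹ * (q - sqX d * s), (hq.sub hsq).C_mul _, ?_⟩
      have e1 : polyLaplacian d (MvPolynomial.C l⁻¹ * (q - sqX d * s)) = s := by
        rw [MvPolynomial.C_mul', map_smul, map_sub, polyLaplacian_sqX_mul hs, ← e, map_add]
        rw [← MvPolynomial.C_mul']
        linear_combination s * hC
      rw [e1]
      linear_combination (q - sqX d * s) * hC

/-- Every homogeneous polynomial is a harmonic one modulo `|x|²`. -/
lemma exists_harm_add_sqX_mul {d : ℕ} (hd : 0 < d) {n : ℕ} (hn : 2 ≤ n) {q : MvPolynomial (Fin d) ℝ}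
    (hq : q.IsHomogeneous n) : ∃ h ∈ Harm d n, ∃ t : MvPolynomial (Fin d) ℝ,
      t.IsHomogeneous (n - 2) ∧ q = h + sqX d * t := by
  -- The remainder `q - |x|² t` is harmonic exactly when `(2d + 4(n-2)) t + |x|² Δt = Δq`. The
  -- constant is positive even for `n = 2` because `d > 0`.
  obtain ⟨t, ht, e⟩ := exists_add_sqX_mul_polyLaplacian (n - 2) (2 * d + 4 * (n - 2 : ℕ))
    (by positivity) (polyLaplacian d q) (isHomogeneous_polyLaplacian hq)
  have hsq : (sqX d * t).IsHomogeneous n := by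
    have := (isHomogeneous_sqX d).mul ht
    rwa [show 2 + (n - 2) = n by omega] at this
  refine ⟨q - sqX d * t, ⟨hq.sub hsq, ?_⟩, t, ht, by ring⟩
  change polyLaplacian d (q - sqX d * t) = 0
  rw [map_sub, polyLaplacian_sqX_mul ht, e, sub_self]

/-! ### Completeness of the spherical harmonics in `L²` of the sphere. -/

lemma integrable_mul_pv {d : ℕ} (φ : Lp ℝ 2 (surf d)) (q : MvPolynomial (Fin d) ℝ) :
    Integrable (fun y : sphere (0 : E d) 1 => φ y * pv q (y : E d)) (surf d) :=
  (Lp.memLp φ).integrable_mul (q := 2)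
    (((contDiff_pv q).continuous.comp continuous_subtype_val).memLp_of_hasCompactSupport
      (HasCompactSupport.of_compactSpace _))

/-- On the sphere `|x|² = 1`, so a homogeneous polynomial restricts to a harmonic one plus one of
degree two less, and induction on the degree applies. -/
lemma integral_mul_pv_eq_zero {d : ℕ} (hd : 0 < d) {φ : Lp ℝ 2 (surf d)}
    (h : ∀ k, ∀ p ∈ Harm d k, ∫ y, φ y * pv p (y : E d) ∂(surf d) = 0) (q : MvPolynomial (Fin d) ℝ) :
    ∫ y, φ y * pv q (y : E d) ∂(surf d) = 0 := by
  have hom : ∀ n, ∀ q : MvPolynomial (Fin d) ℝ, q.IsHomogeneous n →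
      ∫ y, φ y * pv q (y : E d) ∂(surf d) = 0 := by
    intro n
    induction n using Nat.strong_induction_on with
    | _ n ih =>
      intro q hq
      rcases Nat.lt_or_ge n 2 with hn | hn
      · exact h n q ⟨hq, polyLaplacian_eq_zero_of_le_one (by omega) hq⟩
      · obtain ⟨p, hp, t, ht, rfl⟩ := exists_harm_add_sqX_mul hd hn hq
        have e : ∀ y : sphere (0 : E d) 1, φ y * pv (p + sqX d * t) (y : E d)
            = φ y * pv p (y : E d) + φ y * pv t (y : E d) := fun y => by
          rw [pv_add, pv_mul, pv_sqX, mem_sphere_zero_iff_norm.1 y.2]; ring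
        simp only [e]
        rw [integral_add (integrable_mul_pv φ p) (integrable_mul_pv φ t), h n p hp,
          ih (n - 2) (by omega) t ht, add_zero]
  rw [← MvPolynomial.sum_homogeneousComponent q]
  simp only [pv_sum, Finset.mul_sum]
  rw [integral_finsetSum _ fun i _ => integrable_mul_pv φ _]
  exact Finset.sum_eq_zero fun i _ => hom i _ (MvPolynomial.homogeneousComponent_isHomogeneous i q)

/-- Polynomial functions on the sphere. -/
def polySphere (d : ℕ) : MvPolynomial (Fin d) ℝ →ₐ[ℝ] C(sphere (0 : E d) 1, ℝ) :=
  MvPolynomial.aeval fun i => ⟨fun y => (y : E d) i, by fun_prop⟩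

lemma polySphere_apply {d : ℕ} (q : MvPolynomial (Fin d) ℝ) (y : sphere (0 : E d) 1) :
    polySphere d q y = pv q (y : E d) := by
  have : ((ContinuousMap.evalAlgHom ℝ ℝ y).comp (polySphere d))
      = MvPolynomial.aeval (fun i => (y : E d) i) := by
    refine MvPolynomial.algHom_ext fun i => ?_
    simp [polySphere]
  have e := congrArg (fun f : MvPolynomial (Fin d) ℝ →ₐ[ℝ] ℝ => f q) this
  simpa [pv, MvPolynomial.aeval_eq_eval] using e

lemma polySphere_dense (d : ℕ) : (polySphere d).range.topologicalClosure = ⊤ := by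
  refine ContinuousMap.subalgebra_topologicalClosure_eq_top_of_separatesPoints _ fun y z hyz => ?_
  have : ∃ i, (y : E d) i ≠ (z : E d) i := by
    by_contra! hall
    exact hyz (Subtype.ext (by ext i; exact hall i))
  obtain ⟨i, hi⟩ := this
  exact ⟨_, ⟨polySphere d (MvPolynomial.X i), ⟨_, rfl⟩, rfl⟩, by simpa [polySphere_apply] using hi⟩

/-- A square integrable function orthogonal to the spherical harmonics vanishes. -/
lemma eq_zero_of_forall_harm {d : ℕ} (hd : 0 < d) {φ : Lp ℝ 2 (surf d)}
    (h : ∀ k, ∀ p ∈ Harm d k, ∫ y, φ y * pv p (y : E d) ∂(surf d) = 0) : φ = 0 := by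
  let T : C(sphere (0 : E d) 1, ℝ) →L[ℝ] Lp ℝ 2 (surf d) := ContinuousMap.toLp 2 (surf d) ℝ
  have h1 : ∀ f : C(sphere (0 : E d) 1, ℝ), ⟪φ, T f⟫_ℝ = 0 := by
    intro f
    have hf : f ∈ (polySphere d).range.topologicalClosure := by rw [polySphere_dense]; trivial
    refine closure_minimal (s := ((polySphere d).range : Set C(sphere (0 : E d) 1, ℝ)))
      (t := {f | ⟪φ, T f⟫_ℝ = 0}) ?_ (isClosed_eq (by fun_prop) continuous_const) hf
    rintro _ ⟨q, rfl⟩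
    change ⟪φ, T (polySphere d q)⟫_ℝ = 0
    rw [← integral_mul_pv_eq_zero hd h q,
      inner_Lp_of_ae (ae_eq_refl φ) (ContinuousMap.coeFn_toLp (𝕜 := ℝ) (surf d) (polySphere d q))]
    refine integral_congr_ae (Eventually.of_forall fun y => ?_)
    simp [polySphere_apply, mul_comm]
  have h2 : ∀ g : Lp ℝ 2 (surf d), ⟪φ, g⟫_ℝ = 0 := fun g => by
    refine closure_minimal (s := Set.range T) (t := {g | ⟪φ, g⟫_ℝ = 0}) ?_
      (isClosed_eq (by fun_prop) continuous_const)
      (ContinuousMap.toLp_denseRange ℝ (surf d) ℝ (p := 2) (by norm_num) g)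
    rintro _ ⟨f, rfl⟩
    exact h1 f
  exact inner_self_eq_zero.1 (h2 φ)

/-! ### Harmonic polynomials as solutions of Laplace's equation in the ball. -/

lemma isPW_one : IsPW (fun _ => 1) (fun _ => 0) where
  lip := ⟨0, LipschitzWith.const 1⟩
  bdd := ⟨1, fun r => by simp⟩
  der := ⟨∅, Set.finite_empty, fun r _ => ⟨hasDerivAt_const r 1, continuousAt_const⟩⟩

lemma isExt_pv {d : ℕ} [NeZero d] (p : MvPolynomial (Fin d) ℝ) {φ : Lp ℝ 2 (surf d)}
    (hφ : φ =ᵐ[surf d] fun y => pv p (y : E d)) : IsExt ∅ φ (pv p) (pg p) := by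
  have h := isPW_one.isExt p (φ := φ) (by simpa using hφ) ∅
  refine h.congr (Eventually.of_forall fun x => ?_) (Eventually.of_forall fun x => ?_)
  · simp
  · simp [rg]

/-- The restriction of a polynomial to the sphere, in `L²`. -/
def polyL2 (d : ℕ) : MvPolynomial (Fin d) ℝ →ₗ[ℝ] Lp ℝ 2 (surf d) :=
  (ContinuousMap.toLp 2 (surf d) ℝ).toLinearMap ∘ₗ (polySphere d).toLinearMap

lemma polyL2_ae {d : ℕ} (p : MvPolynomial (Fin d) ℝ) : polyL2 d p =ᵐ[surf d] fun y => pv p (y : E d) := by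
  filter_upwards [ContinuousMap.coeFn_toLp (p := 2) (𝕜 := ℝ) (surf d) (polySphere d p)] with y hy
  rw [← polySphere_apply]
  exact hy

/-- The restriction of a polynomial to the sphere, in `H^{1/2}`. -/
def polyTrace (d : ℕ) [NeZero d] : MvPolynomial (Fin d) ℝ →ₗ[ℝ] Hhalf d :=
  (polyL2 d).codRestrict (hhalfSubmodule d) fun p => ⟨_, _, isExt_pv p (polyL2_ae p)⟩

lemma polyTrace_ae {d : ℕ} [NeZero d] (p : MvPolynomial (Fin d) ℝ) :
    (polyTrace d p).toL2 =ᵐ[surf d] fun y => pv p (y : E d) := polyL2_ae p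

lemma isExt_polyTrace {d : ℕ} [NeZero d] (p : MvPolynomial (Fin d) ℝ) :
    IsExt ∅ (polyTrace d p).toL2 (pv p) (pg p) := isExt_pv p (polyTrace_ae p)

/-- Green's formula for the gradient of a polynomial. -/
lemma IsExt.integral_pg {d : ℕ} {φ : Lp ℝ 2 (surf d)} {u : E d → ℝ}
    {G : E d → E d} (h : IsExt ∅ φ u G) (p : MvPolynomial (Fin d) ℝ) :
    ∫ x in dom ∅, (u x * pv (polyLaplacian d p) x + ⟪G x, pg p x⟫_ℝ)
      = ∫ y, φ y * ⟪pg p (y : E d), (y : E d)⟫_ℝ ∂(surf d) := by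
  simpa only [divg_pg] using h.divergence isClosed_empty (contDiff_pg p) (Set.disjoint_empty _)

lemma IsExt.integral_pg_harm {d k : ℕ} {φ : Lp ℝ 2 (surf d)} {u : E d → ℝ}
    {G : E d → E d} (h : IsExt ∅ φ u G) {p : MvPolynomial (Fin d) ℝ} (hp : p ∈ Harm d k) :
    ∫ x in dom ∅, ⟪pg p x, G x⟫_ℝ = k * ∫ y, φ y * pv p (y : E d) ∂(surf d) := by
  have e := h.integral_pg p
  rw [Harm.lap ⟨p, hp⟩] at e
  rw [← integral_const_mul]
  simp only [pv_zero, mul_zero, zero_add, inner_pg_self (Harm.homog ⟨p, hp⟩)] at e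
  simp only [fun x => real_inner_comm (G x) (pg p x), e]
  exact integral_congr_ae (Eventually.of_forall fun y => by ring)

lemma integral_zero_Lp_mul {d : ℕ} (f : sphere (0 : E d) 1 → ℝ) :
    ∫ y, (0 : Lp ℝ 2 (surf d)) y * f y ∂(surf d) = 0 := by
  refine integral_eq_zero_of_ae ?_
  filter_upwards [Lp.coeFn_zero ℝ 2 (surf d)] with y hy
  rw [hy]; simp

lemma isWeakSol_harm {d k : ℕ} [NeZero d] {p : MvPolynomial (Fin d) ℝ} (hp : p ∈ Harm d k) :
    IsWeakSol ∅ (iso fun _ => 1) (polyTrace d p).toL2 (pv p) (pg p) := by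
  refine ⟨isExt_polyTrace p, fun w Z h => ?_⟩
  simp only [iso, one_smul, ContinuousLinearMap.id_apply]
  rw [h.integral_pg_harm hp, integral_zero_Lp_mul, mul_zero]

lemma IsDtN.apply_harm {d k : ℕ} [NeZero d] {Λ : Hhalf d →L[ℝ] HnegHalf d}
    (h : IsDtN ∅ (iso fun _ => 1) Λ) {p : MvPolynomial (Fin d) ℝ} (hp : p ∈ Harm d k) (ψ : Hhalf d) :
    Λ (polyTrace d p) ψ = k * ∫ y, ψ.toL2 y * pv p (y : E d) ∂(surf d) := by
  obtain ⟨U, G, hG⟩ := ψ.exists_isExt ∅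
  rw [(h.2 _).2 _ _ (isWeakSol_harm hp) ψ _ _ hG, ← hG.integral_pg_harm hp]
  simp only [iso, one_smul, ContinuousLinearMap.id_apply]

/-- The mean of a harmonic function against a harmonic polynomial is determined by its trace. -/
lemma integral_sol_mul_harm {d k : ℕ} [NeZero d] {φ : Lp ℝ 2 (surf d)} {U : Lp ℝ 2 (vol ∅)}
    {W : Lp (E d) 2 (vol ∅)} (h : IsWeakSol ∅ (iso fun _ => 1) φ U W)
    {p : MvPolynomial (Fin d) ℝ} (hp : p ∈ Harm d k) :
    (d + 2 * k) * ∫ x in dom ∅, U x * pv p x = ∫ y, φ y * pv p (y : E d) ∂(surf d) := by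
  -- The polynomial `(|x|² - 1) p` vanishes on the sphere, has normal derivative `2p` there, and its
  -- Laplacian is `(2d + 4k) p`. In Green's formula against it the gradient term drops out by the
  -- weak equation.
  set q : MvPolynomial (Fin d) ℝ := sqX d * p - p with hq
  have hl : polyLaplacian d q = MvPolynomial.C (2 * d + 4 * k : ℝ) * p := by
    rw [hq, map_sub, polyLaplacian_sqX_mul (Harm.homog ⟨p, hp⟩), Harm.lap ⟨p, hp⟩, mul_zero,
      add_zero, sub_zero]
  have hq0 : IsExt ∅ 0 (pv q) (pg q) := isExt_pv q (by
    filter_upwards [Lp.coeFn_zero ℝ 2 (surf d)] with y hy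
    rw [hy, hq, pv_sub, pv_mul, pv_sqX, mem_sphere_zero_iff_norm.1 y.2]; simp)
  have hqn : ∀ y : sphere (0 : E d) 1, ⟪pg q (y : E d), (y : E d)⟫_ℝ = 2 * pv p (y : E d) := fun y => by
    have hn : ∑ i, (y : E d) i * (y : E d) i = 1 := by
      rw [← inner_eq_sum, real_inner_self_eq_norm_sq, mem_sphere_zero_iff_norm.1 y.2]; norm_num
    have : ∀ i, pg q (y : E d) i * (y : E d) i = 2 * pv p (y : E d) * ((y : E d) i * (y : E d) i) := fun i => by
      simp only [pg_apply, hq, map_sub, Derivation.leibniz, pderiv_sqX, pv_sub, pv_add, smul_eq_mul,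
        pv_mul, pv_C, pv_X, pv_sqX, mem_sphere_zero_iff_norm.1 y.2]
      ring
    rw [inner_eq_sum, Finset.sum_congr rfl fun i _ => this i, ← Finset.mul_sum, hn, mul_one]
  have e := h.ext.integral_pg q
  have w := h.weak _ _ hq0
  simp only [iso, one_smul, ContinuousLinearMap.id_apply] at w
  simp only [hl, pv_mul, pv_C, hqn] at e
  have i1 : Integrable (fun x => U x * ((2 * d + 4 * k : ℝ) * pv p x)) (vol (∅ : Set (E d))) :=
    (Lp.memLp U).integrable_mul (q := 2) ((isExt_polyTrace p).h1.memLp.const_mul _)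
  have i2 : Integrable (fun x => ⟪W x, pg q x⟫_ℝ) (vol (∅ : Set (E d))) :=
    (L2.integrable_inner (𝕜 := ℝ) W hq0.h1.memLp_grad.toLp).congr (by
      filter_upwards [hq0.h1.memLp_grad.coeFn_toLp] with x hx
      rw [hx])
  rw [integral_add i1 i2, w, add_zero] at e
  have e1 : ∫ x in dom (∅ : Set (E d)), U x * ((2 * d + 4 * k : ℝ) * pv p x)
      = (2 * d + 4 * k) * ∫ x in dom ∅, U x * pv p x := by
    rw [← integral_const_mul]
    exact integral_congr_ae (Eventually.of_forall fun x => by ring)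
  have e2 : ∫ y, φ y * (2 * pv p (y : E d)) ∂(surf d) = 2 * ∫ y, φ y * pv p (y : E d) ∂(surf d) := by
    rw [← integral_const_mul]
    exact integral_congr_ae (Eventually.of_forall fun x => by ring)
  rw [e1, e2] at e
  linarith

/-! ### Density of harmonic polynomials in `H^{1/2}`. -/

/-- The Hilbert space of triples: function, gradient, trace. -/
abbrev Triple (d : ℕ) : Type :=
  WithLp 2 (Lp ℝ 2 (vol (∅ : Set (E d))) × WithLp 2 (Lp (E d) 2 (vol (∅ : Set (E d))) × Lp ℝ 2 (surf d)))

/-- Weak solutions of Laplace's equation with their gradients and traces. -/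
def solTriple (d : ℕ) : Submodule ℝ (Triple d) where
  carrier := {q | IsWeakSol ∅ (iso fun _ => 1) q.snd.snd q.fst q.snd.fst}
  zero_mem' := isCond_iso_one.isWeakSol_iff.2 ⟨IsExt.zero_Lp ∅, fun Z _ => by simp⟩
  add_mem' := by
    intro a b ha hb
    have ha := isCond_iso_one.isWeakSol_iff.1 ha
    have hb := isCond_iso_one.isWeakSol_iff.1 hb
    refine isCond_iso_one.isWeakSol_iff.2 ⟨ha.1.add_Lp hb.1, fun Z hZ => ?_⟩
    rw [WithLp.add_snd, WithLp.add_fst, map_add, inner_add_left, ha.2 Z hZ, hb.2 Z hZ, add_zero]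
  smul_mem' := by
    intro c a ha
    have ha := isCond_iso_one.isWeakSol_iff.1 ha
    refine isCond_iso_one.isWeakSol_iff.2 ⟨ha.1.smul_Lp c, fun Z hZ => ?_⟩
    rw [WithLp.smul_snd, WithLp.smul_fst, map_smul, inner_smul_left, ha.2 Z hZ, mul_zero]

lemma isClosed_solTriple (d : ℕ) : IsClosed (solTriple d : Set (Triple d)) := by
  have : (solTriple d : Set (Triple d)) = {q | IsExt ∅ q.snd.snd q.fst q.snd.fst} ∩
      ⋂ Z ∈ gradZero (∅ : Set (E d)), {q | ⟪isCond_iso_one.mulOp q.snd.fst, Z⟫_ℝ = 0} := by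
    ext q
    simp only [Set.mem_inter_iff, Set.mem_iInter]
    exact isCond_iso_one.isWeakSol_iff
  rw [this]
  have c1 : Continuous fun q : Triple d => q.fst := by fun_prop
  have c2 : Continuous fun q : Triple d => q.snd.fst := by fun_prop
  have c3 : Continuous fun q : Triple d => q.snd.snd := by fun_prop
  refine IsClosed.inter ((isClosed_isExt ∅).preimage (c1.prodMk (c2.prodMk c3))) ?_
  exact isClosed_biInter fun Z _ => isClosed_eq (by fun_prop) continuous_const

/-- The triple of a polynomial. -/
def polyTriple {d : ℕ} [NeZero d] (p : MvPolynomial (Fin d) ℝ) : Triple d :=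
  WithLp.toLp 2 ((isExt_polyTrace p).h1.memLp.toLp,
    WithLp.toLp 2 ((isExt_polyTrace p).h1.memLp_grad.toLp, (polyTrace d p).toL2))

/-- For a solution with function `U`, all three parts of the inner product with the triple of `p`
are nonnegative multiples of `∫ U p`, with total factor `1 + (k+1)(d+2k) > 0`. Orthogonality
therefore makes the trace orthogonal to every spherical harmonic, hence zero; then the gradient
vanishes by uniqueness and the function by Poincaré. -/
lemma solTriple_eq_zero {d : ℕ} [NeZero d] (hd : 2 ≤ d) {q : Triple d} (hq : q ∈ solTriple d)
    (h : ∀ k, ∀ p ∈ Harm d k, ⟪polyTriple p, q⟫_ℝ = 0) : q = 0 := by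
  have hq : IsWeakSol ∅ (iso fun _ => 1) q.snd.snd q.fst q.snd.fst := hq
  have hφ : q.snd.snd = 0 := eq_zero_of_forall_harm (by omega) fun k p hp => by
    have e := h k p hp
    have hp' := isExt_polyTrace p
    rw [WithLp.prod_inner_apply, WithLp.prod_inner_apply] at e
    change ⟪hp'.h1.memLp.toLp, q.fst⟫_ℝ + (⟪hp'.h1.memLp_grad.toLp, q.snd.fst⟫_ℝ
      + ⟪(polyTrace d p).toL2, q.snd.snd⟫_ℝ) = 0 at e
    rw [inner_Lp_of_ae hp'.h1.memLp.coeFn_toLp (ae_eq_refl _),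
      inner_Lp_of_ae hp'.h1.memLp_grad.coeFn_toLp (ae_eq_refl _),
      inner_Lp_of_ae (polyTrace_ae p) (ae_eq_refl _), hq.ext.integral_pg_harm hp] at e
    have e1 := integral_sol_mul_harm hq hp
    have hpos : (0 : ℝ) < d + 2 * k := by positivity
    have e2 : ∫ x in dom ∅, ⟪pv p x, q.fst x⟫_ℝ = ∫ x in dom ∅, q.fst x * pv p x :=
      integral_congr_ae (Eventually.of_forall fun x => by simp)
    have e3 : ∫ y, ⟪pv p (y : E d), q.snd.snd y⟫_ℝ ∂(surf d) = ∫ y, q.snd.snd y * pv p (y : E d) ∂(surf d) :=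
      integral_congr_ae (Eventually.of_forall fun x => by simp)
    rw [e2, e3] at e
    rw [← e1] at e ⊢
    have : (1 + (k + 1) * (d + 2 * k : ℝ)) * ∫ x in dom ∅, q.fst x * pv p x = 0 := by linarith
    rcases mul_eq_zero.1 this with h0 | h0
    · exact absurd h0 (by positivity)
    · rw [h0, mul_zero]
  rw [hφ] at hq
  have hW : q.snd.fst = 0 := isCond_iso_one.isWeakSol_unique hq
    (isCond_iso_one.isWeakSol_iff.2 ⟨IsExt.zero_Lp ∅, fun Z _ => by simp⟩)
  have hU : q.fst = 0 := by
    have := poincare hd isClosed_empty isStar_empty hq.ext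
    rw [hW, norm_zero] at this
    exact norm_le_zero_iff.1 this
  refine WithLp.ofLp_injective 2 (Prod.ext hU (WithLp.ofLp_injective 2 (Prod.ext hW hφ)))

/-- Traces of harmonic polynomials. -/
def harmTrace (d : ℕ) [NeZero d] : Submodule ℝ (Hhalf d) := ⨆ k, (Harm d k).map (polyTrace d)

lemma norm_sq_triple {d : ℕ} (q : Triple d) :
    ‖q‖ ^ 2 = ‖q.fst‖ ^ 2 + (‖q.snd.fst‖ ^ 2 + ‖q.snd.snd‖ ^ 2) := by
  rw [WithLp.prod_norm_sq_eq_of_L2, WithLp.prod_norm_sq_eq_of_L2]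

/-- The triple norm only adds the `L²` norm of the function to quantities entering the `H^{1/2}`
norm, so approximation of triples gives approximation of traces. -/
lemma Hhalf.norm_le_triple {d : ℕ} {φ : Hhalf d} {q : Triple d} (hq : q ∈ solTriple d)
    (h : q.snd.snd = φ.toL2) : ‖φ‖ ≤ ‖q‖ := by
  have hq : IsWeakSol ∅ (iso fun _ => 1) q.snd.snd q.fst q.snd.fst := hq
  rw [norm_def]
  refine (csInf_le (normSet_bddBelow φ) ⟨q.fst, q.snd.fst, h ▸ hq.ext, rfl⟩).trans ?_
  refine Real.sqrt_le_iff.2 ⟨norm_nonneg _, ?_⟩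
  rw [norm_sq_triple, ← h]
  have : gradNorm q.snd.fst = ‖q.snd.fst‖ := rfl
  rw [this]
  nlinarith [sq_nonneg ‖q.fst‖]

/-- The norm of `Hhalf` is an infimum rather than a given inner product norm. Density is therefore
proved by orthogonal complements in the Hilbert space of triples and then transferred to traces. -/
theorem harmTrace_dense {d : ℕ} [NeZero d] (hd : 2 ≤ d) : (harmTrace d).topologicalClosure = ⊤ := by
  let P : Submodule ℝ (Triple d) :=
    Submodule.span ℝ {q | ∃ k, ∃ p ∈ Harm d k, q = polyTriple p}
  have hPX : P ≤ solTriple d := Submodule.span_le.2 (by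
    rintro _ ⟨k, p, hp, rfl⟩
    exact (isWeakSol_harm hp).toLp)
  let X := P.topologicalClosure
  have hXX : X ≤ solTriple d := P.topologicalClosure_minimal hPX (isClosed_solTriple d)
  have : CompleteSpace X := P.isClosed_topologicalClosure.completeSpace_coe
  have hall : solTriple d ≤ X := fun q hq => by
    obtain ⟨y, hy, z, hz, rfl⟩ := X.exists_add_mem_mem_orthogonal q
    have hzX : z ∈ solTriple d := by
      have := (solTriple d).sub_mem hq (hXX hy)
      rwa [add_sub_cancel_left] at this
    have : z = 0 := solTriple_eq_zero hd hzX fun k p hp =>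
      (Submodule.mem_orthogonal _ _).1 hz _ (P.le_topologicalClosure (Submodule.subset_span ⟨k, p, hp, rfl⟩))
    rwa [this, add_zero]
  have hsnd : ∀ q ∈ P, ∃ χ ∈ harmTrace d, χ.toL2 = q.snd.snd := fun q hq => by
    refine Submodule.span_induction ?_ ?_ ?_ ?_ hq
    · rintro _ ⟨k, p, hp, rfl⟩
      exact ⟨polyTrace d p, Submodule.mem_iSup_of_mem k (Submodule.mem_map_of_mem hp), rfl⟩
    · exact ⟨0, Submodule.zero_mem _, by simp⟩
    · rintro a b _ _ ⟨χ, h1, h2⟩ ⟨χ', h1', h2'⟩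
      exact ⟨χ + χ', Submodule.add_mem _ h1 h1', by simp [h2, h2']⟩
    · rintro c a _ ⟨χ, h1, h2⟩
      exact ⟨c • χ, Submodule.smul_mem _ c h1, by simp [h2]⟩
  rw [Submodule.eq_top_iff']
  intro φ
  obtain ⟨U, G, h⟩ := φ.exists_isExt ∅
  obtain ⟨U', G', h'⟩ := isCond_iso_one.exists_isWeakSol hd isClosed_empty isStar_empty h
  have hz : (WithLp.toLp 2 (U', WithLp.toLp 2 (G', φ.toL2)) : Triple d) ∈ X := hall h'
  refine Metric.mem_closure_iff.2 fun ε hε => ?_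
  obtain ⟨q, hq, hlt⟩ := Metric.mem_closure_iff.1 hz ε hε
  obtain ⟨χ, hχ, e⟩ := hsnd q hq
  refine ⟨χ, hχ, lt_of_le_of_lt ?_ hlt⟩
  rw [dist_eq_norm, dist_eq_norm]
  refine Hhalf.norm_le_triple ((solTriple d).sub_mem (show _ ∈ solTriple d from h') (hPX hq)) ?_
  rw [map_sub, e]
  rfl

end Cloak

end

noncomputable section
namespace Cloak

open MeasureTheory Metric Filter Topology Asymptotics
open scoped ContDiff InnerProductSpace

/-! ### Comparison of Dirichlet-to-Neumann maps that are diagonal in spherical harmonics -/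

/-- Polarisation: `4 B(x,y)` is a difference of two diagonal values, each controlled by `L`, and the
parallelogram identity for the form `L` keeps the constant at `ε`. The identity is used for `L`
only, so the norm need not be Hilbertian; rescaling to unit vectors concludes. -/
lemma abs_apply_le_of_diag {V : Type*} [NormedAddCommGroup V] [NormedSpace ℝ V]
    {B : V →L[ℝ] V →L[ℝ] ℝ} {ε : ℝ} (hs : ∀ x y, B x y = B y x)
    {L : V →L[ℝ] V →L[ℝ] ℝ} (hL : ∀ x, L x x ≤ ‖x‖ ^ 2) (hε : 0 ≤ ε)
    (h : ∀ x, |B x x| ≤ ε * L x x) : ‖B‖ ≤ ε := by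
  have key : ∀ x y, |B x y| ≤ ε / 2 * (‖x‖ ^ 2 + ‖y‖ ^ 2) := fun x y => by
    have e1 : B (x + y) (x + y) - B (x - y) (x - y) = 4 * B x y := by
      simp only [map_add, map_sub, _root_.add_apply, _root_.sub_apply, hs y x]
      ring
    have e2 : L (x + y) (x + y) + L (x - y) (x - y) = 2 * (L x x + L y y) := by
      simp only [map_add, map_sub, _root_.add_apply, _root_.sub_apply]
      ring
    have a1 := h (x + y)
    have a2 := h (x - y)
    have a3 := abs_sub (B (x + y) (x + y)) (B (x - y) (x - y))
    rw [e1, abs_mul, abs_of_pos (by norm_num : (0 : ℝ) < 4)] at a3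
    have a4 : ε * (L x x + L y y) ≤ ε * (‖x‖ ^ 2 + ‖y‖ ^ 2) :=
      mul_le_mul_of_nonneg_left (add_le_add (hL x) (hL y)) hε
    nlinarith
  refine B.opNorm_le_bound₂ hε fun x y => ?_
  rw [Real.norm_eq_abs]
  rcases eq_or_ne x 0 with rfl | hx
  · simp
  rcases eq_or_ne y 0 with rfl | hy
  · simp
  have hx' : ‖x‖ ≠ 0 := norm_ne_zero_iff.2 hx
  have hy' : ‖y‖ ≠ 0 := norm_ne_zero_iff.2 hy
  have := key (‖x‖⁻¹ • x) (‖y‖⁻¹ • y)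
  rw [norm_smul, norm_smul, norm_inv, norm_inv, norm_norm, norm_norm, inv_mul_cancel₀ hx',
    inv_mul_cancel₀ hy', map_smul, map_smul, _root_.smul_apply, smul_eq_mul, smul_eq_mul,
    abs_mul, abs_mul, abs_of_nonneg (inv_nonneg.2 (norm_nonneg x)),
    abs_of_nonneg (inv_nonneg.2 (norm_nonneg y))] at this
  have h2 : |B x y| = ‖x‖ * ‖y‖ * (‖y‖⁻¹ * (‖x‖⁻¹ * |B x y|)) := by field_simp
  rw [h2]
  calc _ ≤ ‖x‖ * ‖y‖ * (ε / 2 * (1 ^ 2 + 1 ^ 2)) :=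
        mul_le_mul_of_nonneg_left this (by positivity)
    _ = ε * ‖x‖ * ‖y‖ := by ring

lemma IsDtN.apply_self_le {d : ℕ} {Λ : Hhalf d →L[ℝ] HnegHalf d} (h : IsDtN ∅ (iso fun _ => 1) Λ)
    (φ : Hhalf d) : Λ φ φ ≤ ‖φ‖ ^ 2 := by
  have h0 := h.nonneg isCond_iso_one φ
  have : √(Λ φ φ) ≤ ‖φ‖ := Hhalf.le_norm fun U G hG => by
    refine Real.sqrt_le_iff.2 ⟨norm_nonneg _, ?_⟩
    simpa using h.apply_le isCond_iso_one hG
  calc Λ φ φ = √(Λ φ φ) ^ 2 := (Real.sq_sqrt h0).symm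
    _ ≤ _ := pow_le_pow_left₀ (Real.sqrt_nonneg _) this 2

/-- A symmetric map that acts on spherical harmonics of degree `k` with eigenvalues relatively
close to `k` is close to the Dirichlet-to-Neumann map of the Laplacian. -/
theorem norm_sub_le_of_eigenvalues {d : ℕ} [NeZero d] (hd : 2 ≤ d) {Λ Λ₁ : Hhalf d →L[ℝ] HnegHalf d}
    (h₁ : IsDtN ∅ (iso fun _ => 1) Λ₁) (hsymm : ∀ φ ψ, Λ φ ψ = Λ ψ φ) {ε : ℝ} (hε : 0 ≤ ε)
    (h : ∀ k, ∀ p ∈ Harm d k, ∃ l : ℝ, |l - k| ≤ ε * k ∧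
      ∀ ψ : Hhalf d, Λ (polyTrace d p) ψ = l * ∫ y, ψ.toL2 y * pv p (y : E d) ∂(surf d)) :
    ‖Λ - Λ₁‖ ≤ ε := by
  have s₁ := h₁.symm isCond_iso_one
  refine abs_apply_le_of_diag (L := Λ₁) (fun φ ψ => ?_) h₁.apply_self_le hε fun φ => ?_
  · simp only [_root_.sub_apply, hsymm φ ψ, s₁ φ ψ]
  have hφ : φ ∈ (harmTrace d).topologicalClosure := by rw [harmTrace_dense hd]; trivial
  refine closure_minimal (s := (harmTrace d : Set (Hhalf d)))
    (t := {φ | |(Λ - Λ₁) φ φ| ≤ ε * Λ₁ φ φ}) ?_ ?_ hφ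
  · intro φ hφ
    obtain ⟨f, hf, rfl⟩ := (Submodule.mem_iSup_iff_exists_finsupp _ _).1 hφ
    choose p hp e using fun k => Submodule.mem_map.1 (hf k)
    choose l hl hl' using fun k => h k (p k) (hp k)
    set I : ℕ → ℕ → ℝ := fun j k => ∫ y, (polyTrace d (p k)).toL2 y * pv (p j) (y : E d) ∂(surf d)
      with hI
    have b₁ : ∀ j k, Λ₁ (f j) (f k) = j * I j k := fun j k => by
      rw [← e j, ← e k, h₁.apply_harm (hp j)]
    have b : ∀ j k, Λ (f j) (f k) = l j * I j k := fun j k => by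
      rw [← e j, ← e k, hl' j]
    have hsI : ∀ j k, I j k = I k j := fun j k => by
      refine integral_congr_ae ?_
      filter_upwards [polyTrace_ae (p j), polyTrace_ae (p k)] with y h1 h2
      rw [h1, h2]; ring
    -- Harmonics of different degrees are orthogonal because they are eigenvectors of the symmetric
    -- map `Λ₁` with different eigenvalues.
    have hI0 : ∀ j k, j ≠ k → I j k = 0 := fun j k hjk => by
      have := s₁ (f j) (f k)
      rw [b₁, b₁, hsI k j] at this
      have h0 : ((j : ℝ) - k) * I j k = 0 := by linarith
      exact (mul_eq_zero.1 h0).resolve_left (sub_ne_zero.2 (by exact_mod_cast hjk))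
    have hI1 : ∀ j, 0 ≤ I j j := fun j => by
      refine integral_nonneg_of_ae ?_
      filter_upwards [polyTrace_ae (p j)] with y h1
      rw [h1]
      exact mul_self_nonneg _
    have hsum : ∀ (B : Hhalf d →L[ℝ] HnegHalf d) (c : ℕ → ℝ), (∀ j k, B (f j) (f k) = c j * I j k) →
        B (f.sum fun _ x => x) (f.sum fun _ x => x) = ∑ j ∈ f.support, c j * I j j := fun B c hB => by
      rw [Finsupp.sum, map_sum]
      refine Finset.sum_congr rfl fun j hj => ?_
      rw [map_sum, _root_.sum_apply]
      simp only [hB]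
      refine Finset.sum_eq_single_of_mem j hj fun k _ hk => ?_
      rw [hI0 k j hk, mul_zero]
    change |(Λ - Λ₁) (f.sum fun _ x => x) (f.sum fun _ x => x)|
      ≤ ε * Λ₁ (f.sum fun _ x => x) (f.sum fun _ x => x)
    rw [hsum (Λ - Λ₁) (fun j => l j - j) (fun j k => by
      simp only [_root_.sub_apply, b, b₁]; ring), hsum Λ₁ (fun j => j) b₁, Finset.mul_sum]
    refine (Finset.abs_sum_le_sum_abs _ _).trans (Finset.sum_le_sum fun j _ => ?_)
    rw [abs_mul, abs_of_nonneg (hI1 j), ← mul_assoc]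
    exact mul_le_mul_of_nonneg_right (hl j) (hI1 j)
  · have c : ∀ B : Hhalf d →L[ℝ] HnegHalf d, Continuous fun φ => B φ φ := fun B =>
      B.continuous.clm_apply continuous_id
    exact isClosed_le (c _).abs (continuous_const.mul (c _))

end Cloak

end

noncomputable section
namespace Cloak

open MeasureTheory Metric Filter Topology Asymptotics
open scoped ContDiff InnerProductSpace

/-! ### Radial profiles of the fields in a coated structure -/

lemma hasDerivAt_pow_div (n : ℕ) {r : ℝ} (hr : r ≠ 0) :
    HasDerivAt (fun t : ℝ => t ^ n) (n * r ^ n / r) r := by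
  refine (hasDerivAt_pow n r).congr_deriv ?_
  rcases n with _ | n
  · simp
  · rw [Nat.add_sub_cancel, pow_succ]; field_simp

lemma hasDerivAt_inv_pow_div (n : ℕ) {r : ℝ} (hr : r ≠ 0) :
    HasDerivAt (fun t : ℝ => (t ^ n)⁻¹) (-(n * (r ^ n)⁻¹ / r)) r := by
  refine (hasDerivAt_pow_div n hr).fun_inv (pow_ne_zero n hr) |>.congr_deriv ?_
  field_simp

/-- The radial part `v` and the potential `c` of the flux of a field of degree `k` in the radial
conductivity `sig` (bounded by `m` and `M`) outside the insulating unit ball in dimension `e + 2`. -/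
structure Profile (k e : ℕ) (sig : ℝ → ℝ) (m M : ℝ) (I : Set ℝ) (v c : ℝ → ℝ) : Prop where
  contV : ContinuousOn v I
  contC : ContinuousOn c I
  one : v 1 = 1 ∧ c 1 = 0
  der : ∃ T : Set ℝ, T.Finite ∧ ∀ r ∈ I, 1 < r → r ∉ T →
    HasDerivAt v (k * (k + e) * c r / (sig r * r ^ e) / r) r ∧
    HasDerivAt c (sig r * r ^ e * v r / r) r ∧
    (∀ᶠ t in 𝓝 r, sig t = sig r) ∧ m ≤ sig r ∧ sig r ≤ M
  pos : ∀ r ∈ I, 0 < v r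
  nonneg : ∀ r ∈ I, 0 ≤ c r
  le : ∀ r ∈ I, (k + e) * c r ≤ M * r ^ e * v r

/-- `v` in a layer of constant conductivity. -/
def layV (k e : ℕ) (A B r : ℝ) : ℝ := A * r ^ k + B * (r ^ (k + e))⁻¹

/-- `c` in a layer of constant conductivity `s`. -/
def layC (k e : ℕ) (s A B r : ℝ) : ℝ := s * (A * r ^ (k + e) / (k + e) - B * (r ^ k)⁻¹ / k)

lemma layC_eq (k e : ℕ) (s A B : ℝ) {r : ℝ} (hr : 0 < r) :
    layC k e s A B r = s * r ^ e * (A * r ^ k / (k + e) - B * (r ^ (k + e))⁻¹ / k) := by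
  have : r ^ e ≠ 0 := (pow_pos hr e).ne'
  have : r ^ k ≠ 0 := (pow_pos hr k).ne'
  rw [layC, pow_add]
  field_simp

lemma hasDerivAt_layV {k e : ℕ} (hk : 0 < k) {s : ℝ} (hs : 0 < s) (A B : ℝ) {r : ℝ} (hr : 0 < r) :
    HasDerivAt (layV k e A B) (k * (k + e) * layC k e s A B r / (s * r ^ e) / r) r := by
  refine (((hasDerivAt_pow_div k hr.ne').const_mul A).add
    ((hasDerivAt_inv_pow_div (k + e) hr.ne').const_mul B)).congr_deriv ?_
  have : r ^ e ≠ 0 := (pow_pos hr e).ne'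
  have : (k : ℝ) ≠ 0 := by positivity
  have : (k + e : ℝ) ≠ 0 := by positivity
  rw [layC_eq k e s A B hr]
  push_cast
  field_simp
  ring

lemma hasDerivAt_layC {k e : ℕ} (hk : 0 < k) (s A B : ℝ) {r : ℝ} (hr : 0 < r) :
    HasDerivAt (layC k e s A B) (s * r ^ e * layV k e A B r / r) r := by
  refine ((((hasDerivAt_pow_div (k + e) hr.ne').const_mul A).div_const (k + e : ℝ)).sub
    (((hasDerivAt_inv_pow_div k hr.ne').const_mul B).div_const (k : ℝ))).const_mul s |>.congr_deriv ?_
  have : r ^ e ≠ 0 := (pow_pos hr e).ne'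
  have : r ^ k ≠ 0 := (pow_pos hr k).ne'
  have : (k : ℝ) ≠ 0 := by positivity
  have : (k + e : ℝ) ≠ 0 := by positivity
  rw [layV, pow_add]
  push_cast
  field_simp
  ring

/-- The transmission conditions at an interface are continuity of `v` and `c`. They form an
invertible `2 × 2` linear system for the coefficients of the next layer, solved here explicitly. -/
lemma exists_lay {k e : ℕ} (hk : 0 < k) {s R : ℝ} (hs : 0 < s) (hR : 0 < R) (v₀ c₀ : ℝ) :
    ∃ A B, layV k e A B R = v₀ ∧ layC k e s A B R = c₀ := by
  have h1 : R ^ e ≠ 0 := (pow_pos hR e).ne'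
  have h2 : R ^ k ≠ 0 := (pow_pos hR k).ne'
  have h3 : (k : ℝ) ≠ 0 := by positivity
  have h4 : (k + e : ℝ) ≠ 0 := by positivity
  have h5 : (k + e + k : ℝ) ≠ 0 := by positivity
  refine ⟨(v₀ / k + c₀ / (s * R ^ e)) * (k * (k + e) / (k + e + k)) / R ^ k,
    (v₀ / (k + e) - c₀ / (s * R ^ e)) * (k * (k + e) / (k + e + k)) * R ^ (k + e), ?_, ?_⟩
  · rw [layV]
    have h6 : R ^ (k + e) ≠ 0 := (pow_pos hR _).ne'
    field_simp
    ring
  · rw [layC_eq k e s _ _ hR]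
    have h6 : R ^ (k + e) ≠ 0 := (pow_pos hR _).ne'
    field_simp
    ring

/-- The common shape of the invariants: across a layer the growing part `a₀` increases to `a` while
the decaying part shrinks by `θ ≤ 1`. The new value is at least `θ(α a₀ + β b₀) + (1 - θ) α a₀`, and
both terms are nonnegative. -/
lemma comb_nonneg {α β a₀ b₀ a θ : ℝ} (hα : 0 ≤ α) (h0 : 0 ≤ α * a₀ + β * b₀) (ha0 : 0 ≤ a₀)
    (ha : a₀ ≤ a) (hθ : 0 ≤ θ) (hθ1 : θ ≤ 1) : 0 ≤ α * a + β * (θ * b₀) := by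
  have h1 : α * a₀ ≤ α * a := mul_le_mul_of_nonneg_left ha hα
  have h2 : 0 ≤ θ * (α * a₀ + β * b₀) := mul_nonneg hθ h0
  have h3 : 0 ≤ (1 - θ) * (α * a₀) := mul_nonneg (by linarith) (mul_nonneg hα ha0)
  nlinarith

/-- The sign conditions propagate through a layer. -/
lemma lay_invariants {k e : ℕ} (hk : 0 < k) {s M R A B r : ℝ} (hs : 0 < s) (hsM : s ≤ M) (hR : 0 < R)
    (hr : R ≤ r) (hv : 0 < layV k e A B R) (hc : 0 ≤ layC k e s A B R)
    (hle : (k + e) * layC k e s A B R ≤ M * R ^ e * layV k e A B R) :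
    0 < layV k e A B r ∧ 0 ≤ layC k e s A B r ∧
      (k + e) * layC k e s A B r ≤ M * r ^ e * layV k e A B r := by
  have hr0 : 0 < r := hR.trans_le hr
  have hk' : (0 : ℝ) < k := by positivity
  have hke : (0 : ℝ) < k + e := by positivity
  have hRe : 0 < R ^ e := pow_pos hR e
  have hre : 0 < r ^ e := pow_pos hr0 e
  have hRke : 0 < R ^ (k + e) := pow_pos hR _
  have hrke : 0 < r ^ (k + e) := pow_pos hr0 _
  set a₀ := A * R ^ k with ha₀
  set b₀ := B * (R ^ (k + e))⁻¹ with hb₀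
  set θ := R ^ (k + e) / r ^ (k + e) with hθ
  have hθ0 : 0 ≤ θ := by positivity
  have hθ1 : θ ≤ 1 := (div_le_one hrke).2 (pow_le_pow_left₀ hR.le hr _)
  have hb : B * (r ^ (k + e))⁻¹ = θ * b₀ := by rw [hθ, hb₀]; field_simp
  rw [layC_eq k e s A B hR] at hc hle
  rw [layC_eq k e s A B hr0]
  rw [layV, ← ha₀, ← hb₀] at hv hle
  rw [← ha₀, ← hb₀] at hc
  rw [layV, hb]
  have hc1 : 0 ≤ a₀ / (k + e) - b₀ / k := nonneg_of_mul_nonneg_right hc (by positivity)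
  -- Adding `v / k > 0` to the normalised `c ≥ 0` cancels the decaying part, leaving a positive
  -- multiple of the growing one.
  have ha0 : 0 < a₀ := by
    have : 0 < (a₀ + b₀) / k + (a₀ / (k + e) - b₀ / k) := by positivity
    have e1 : (a₀ + b₀) / k + (a₀ / (k + e) - b₀ / k) = a₀ * (1 / k + 1 / (k + e)) := by
      field_simp; ring
    rw [e1] at this
    exact pos_of_mul_pos_left this (by positivity)
  have hA : 0 < A := pos_of_mul_pos_left ha0 (by positivity)
  have ha : a₀ ≤ A * r ^ k := mul_le_mul_of_nonneg_left (pow_le_pow_left₀ hR.le hr k) hA.le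
  -- The third invariant rewritten as a combination of the growing and decaying parts. The
  -- coefficient of the growing part is nonnegative precisely because `s ≤ M`.
  have hle1 : 0 ≤ (M - s) * a₀ + (M + s * (k + e) / k) * b₀ := by
    have e1 : M * R ^ e * (a₀ + b₀) - (k + e) * (s * R ^ e * (a₀ / (k + e) - b₀ / k))
        = R ^ e * ((M - s) * a₀ + (M + s * (k + e) / k) * b₀) := by
      field_simp; ring
    exact nonneg_of_mul_nonneg_right (by linarith : 0 ≤ R ^ e * _) hRe
  refine ⟨?_, ?_, ?_⟩
  · have := comb_nonneg (α := 1) (β := 1) zero_le_one (by linarith : (0 : ℝ) ≤ 1 * a₀ + 1 * b₀) ha0.le ha hθ0 hθ1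
    rcases hθ1.eq_or_lt with h | h
    · rw [h]; linarith
    · nlinarith [mul_nonneg hθ0 hv.le, mul_pos (sub_pos.2 h) ha0]
  · refine mul_nonneg (by positivity) ?_
    have := comb_nonneg (α := 1 / (k + e)) (β := -(1 / k)) (b₀ := b₀) (by positivity)
      (by rw [show (1 : ℝ) / (k + e) * a₀ + -(1 / k) * b₀ = a₀ / (k + e) - b₀ / k by ring]; exact hc1) ha0.le ha hθ0 hθ1
    linarith [show (1 : ℝ) / (k + e) * (A * r ^ k) + -(1 / k) * (θ * b₀)
      = A * r ^ k / (k + e) - θ * b₀ / k by ring]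
  · have := comb_nonneg (sub_nonneg.2 hsM) hle1 ha0.le ha hθ0 hθ1
    have e1 : M * r ^ e * (A * r ^ k + θ * b₀) - (k + e) * (s * r ^ e * (A * r ^ k / (k + e) - θ * b₀ / k))
        = r ^ e * ((M - s) * (A * r ^ k) + (M + s * (k + e) / k) * (θ * b₀)) := by
      field_simp; ring
    have := mul_nonneg hre.le this
    linarith

lemma continuousOn_glue {I : Set ℝ} {R : ℝ} {f g : ℝ → ℝ} (hI : ∀ r ∈ I, 1 ≤ r)
    (hf : ContinuousOn f (Set.Icc 1 R)) (hg : ContinuousOn g (Set.Ici R)) (h : f R = g R) :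
    ContinuousOn (fun r => if r ≤ R then f r else g r) I := by
  refine ContinuousOn.if ?_ ?_ ?_
  · intro r hr
    have hr2 : r ∈ frontier (Set.Iic R) := hr.2
    have hr' : r = R := by simpa [frontier_Iic] using hr2
    rw [hr', h]
  · refine hf.mono fun r hr => ⟨hI r hr.1, ?_⟩
    have := hr.2
    exact isClosed_Iic.closure_subset this
  · refine hg.mono fun r hr => ?_
    have := hr.2
    simp only [not_le] at this
    exact isClosed_Ici.closure_subset_iff.2 (fun t ht => le_of_lt ht) this

/-- Extension of a profile through one more layer. -/
lemma Profile.extend {k e : ℕ} (hk : 0 < k) {sig v c : ℝ → ℝ} {m M R s : ℝ} (hR : 1 ≤ R)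
    (h : Profile k e sig m M (Set.Icc 1 R) v c) (hm : m ≤ s) (hs : 0 < s) (hsM : s ≤ M) {I : Set ℝ}
    (hI : ∀ r ∈ I, 1 ≤ r) {T₀ : Set ℝ} (hT₀ : T₀.Finite)
    (hsig : ∀ r ∈ I, R < r → r ∉ T₀ → ∀ᶠ t in 𝓝 r, sig t = s) :
    ∃ v' c' A B, Profile k e sig m M I v' c' ∧
      ∀ r, R ≤ r → v' r = layV k e A B r ∧ c' r = layC k e s A B r := by
  have hR0 : 0 < R := by linarith
  have hRm : R ∈ Set.Icc 1 R := ⟨hR, le_refl R⟩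
  obtain ⟨A, B, hA, hB⟩ := exists_lay (e := e) hk hs hR0 (v R) (c R)
  obtain ⟨T, hT, hder⟩ := h.der
  have eV : ∀ r, R ≤ r → (if r ≤ R then v r else layV k e A B r) = layV k e A B r := fun r hr => by
    split_ifs with h'
    · rw [le_antisymm h' hr, hA]
    · rfl
  have eC : ∀ r, R ≤ r → (if r ≤ R then c r else layC k e s A B r) = layC k e s A B r := fun r hr => by
    split_ifs with h'
    · rw [le_antisymm h' hr, hB]
    · rfl
  have inv : ∀ r, R ≤ r → _ := fun r hr => lay_invariants hk hs hsM hR0 hr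
    (hA.symm ▸ h.pos R hRm) (hB.symm ▸ h.nonneg R hRm) (by rw [hA, hB]; exact h.le R hRm)
  refine ⟨fun r => if r ≤ R then v r else layV k e A B r,
    fun r => if r ≤ R then c r else layC k e s A B r, A, B, ?_, fun r hr => ⟨eV r hr, eC r hr⟩⟩
  constructor
  · exact continuousOn_glue hI h.contV (fun r hr =>
      (hasDerivAt_layV hk hs A B (hR0.trans_le hr)).continuousAt.continuousWithinAt) hA.symm
  · exact continuousOn_glue hI h.contC (fun r hr =>
      (hasDerivAt_layC hk s A B (hR0.trans_le hr)).continuousAt.continuousWithinAt) hB.symm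
  · simp only [if_pos hR]
    exact h.one
  · refine ⟨T ∪ T₀ ∪ {R}, (hT.union hT₀).union (Set.finite_singleton R), fun r hr h1 hrT => ?_⟩
    simp only [Set.mem_union, Set.mem_singleton_iff, not_or] at hrT
    rcases lt_or_gt_of_ne hrT.2 with hlt | hgt
    · obtain ⟨d1, d2, d3⟩ := hder r ⟨h1.le, hlt.le⟩ h1 hrT.1.1
      have ev : ∀ᶠ t in 𝓝 r, t ≤ R := (eventually_lt_nhds hlt).mono fun t ht => ht.le
      simp only [if_pos hlt.le]
      exact ⟨d1.congr_of_eventuallyEq (ev.mono fun t ht => if_pos ht),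
        d2.congr_of_eventuallyEq (ev.mono fun t ht => if_pos ht), d3⟩
    · have hr0 : 0 < r := hR0.trans hgt
      have es := hsig r hr hgt hrT.1.2
      have es' : sig r = s := es.self_of_nhds
      have ev : ∀ᶠ t in 𝓝 r, ¬ t ≤ R := (eventually_gt_nhds hgt).mono fun t ht => not_le.2 ht
      simp only [if_neg (not_le.2 hgt), es']
      exact ⟨(hasDerivAt_layV hk hs A B hr0).congr_of_eventuallyEq (ev.mono fun t ht => if_neg ht),
        (hasDerivAt_layC hk s A B hr0).congr_of_eventuallyEq (ev.mono fun t ht => if_neg ht),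
        es, hm, hsM⟩
  · intro r hr
    rcases le_or_gt r R with h' | h'
    · simp only [if_pos h']; exact h.pos r ⟨hI r hr, h'⟩
    · simp only [if_neg (not_le.2 h')]; exact (inv r h'.le).1
  · intro r hr
    rcases le_or_gt r R with h' | h'
    · simp only [if_pos h']; exact h.nonneg r ⟨hI r hr, h'⟩
    · simp only [if_neg (not_le.2 h')]; exact (inv r h'.le).2.1
  · intro r hr
    rcases le_or_gt r R with h' | h'
    · simp only [if_pos h']; exact h.le r ⟨hI r hr, h'⟩
    · simp only [if_neg (not_le.2 h')]; exact (inv r h'.le).2.2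

/-! ### Profiles of a coating and their outer coefficients. -/

/-- The conductivity of a coating as a function of the radius. -/
def Coating.sigR (S : Coating) (r : ℝ) : ℝ :=
  (if 2 < r then 1 else 0) + ∑ j : Fin S.L, if S.r j.succ < r ∧ r ≤ S.r j.castSucc then S.s j else 0

lemma Coating.sigma_eq (S : Coating) {d : ℕ} (x : E d) : S.sigma x = S.sigR ‖x‖ := by
  simp [Coating.sigma, Coating.sigR, Set.indicator_apply]

lemma Coating.le_two (S : Coating) (j : Fin (S.L + 1)) : S.r j ≤ 2 := by
  rw [← S.r_outer]; exact S.r_anti.antitone (Fin.zero_le j)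

lemma Coating.one_le (S : Coating) (j : Fin (S.L + 1)) : 1 ≤ S.r j := by
  rw [← S.r_core]; exact S.r_anti.antitone (Fin.le_last j)

lemma Coating.sigR_of_two_lt (S : Coating) {r : ℝ} (hr : 2 < r) : S.sigR r = 1 := by
  rw [sigR, if_pos hr, Finset.sum_eq_zero, add_zero]
  intro j _
  exact if_neg fun h => absurd (h.2.trans (S.le_two _)) (not_le.2 hr)

lemma Coating.sigR_of_mem (S : Coating) (j : Fin S.L) {r : ℝ} (h1 : S.r j.succ < r)
    (h2 : r ≤ S.r j.castSucc) : S.sigR r = S.s j := by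
  rw [sigR, if_neg (not_lt.2 (h2.trans (S.le_two _))), zero_add,
    Finset.sum_eq_single_of_mem j (Finset.mem_univ j), if_pos ⟨h1, h2⟩]
  intro i _ hi
  refine if_neg fun h => ?_
  rcases lt_or_gt_of_ne hi with hlt | hgt
  · have : S.r j.castSucc ≤ S.r i.succ := S.r_anti.antitone (by
      rw [Fin.le_def]; simpa using hlt)
    linarith [h.1]
  · have : S.r i.castSucc ≤ S.r j.succ := S.r_anti.antitone (by
      rw [Fin.le_def]; simpa using hgt)
    linarith [h.2]

lemma Coating.exists_bounds (S : Coating) :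
    ∃ m M : ℝ, 0 < m ∧ m ≤ 1 ∧ 1 ≤ M ∧ ∀ j, m ≤ S.s j ∧ S.s j ≤ M := by
  have hpos := S.s_pos
  refine ⟨(1 + ∑ j, (S.s j)⁻¹)⁻¹, 1 + ∑ j, S.s j, ?_, ?_, ?_, fun j => ⟨?_, ?_⟩⟩
  · have : 0 ≤ ∑ j, (S.s j)⁻¹ := Finset.sum_nonneg fun j _ => (inv_pos.2 (hpos j)).le
    positivity
  · exact inv_le_one_of_one_le₀ (by linarith [Finset.sum_nonneg fun j (_ : j ∈ Finset.univ) => (inv_pos.2 (hpos j)).le])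
  · linarith [Finset.sum_nonneg fun j (_ : j ∈ Finset.univ) => (hpos j).le]
  · rw [inv_le_comm₀ (by
      linarith [Finset.sum_nonneg fun j (_ : j ∈ Finset.univ) => (inv_pos.2 (hpos j)).le]) (hpos j)]
    linarith [Finset.single_le_sum (f := fun j => (S.s j)⁻¹) (fun j _ => (inv_pos.2 (hpos j)).le) (Finset.mem_univ j)]
  · linarith [Finset.single_le_sum (f := fun j => S.s j) (fun j _ => (hpos j).le) (Finset.mem_univ j)]

/-- The profile of a coated structure; outside the coating it is explicit. -/
lemma Coating.exists_profile (S : Coating) {m M : ℝ} (hm : m ≤ 1) (hM : 1 ≤ M)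
    (hb : ∀ j, m ≤ S.s j ∧ S.s j ≤ M) {k : ℕ} (hk : 0 < k) (e : ℕ) :
    ∃ v c A B, Profile k e S.sigR m M (Set.Ici 1) v c ∧
      ∀ r, 2 ≤ r → v r = layV k e A B r ∧ c r = layC k e 1 A B r := by
  -- Layers are numbered from the outside, so reverse induction on the index builds the profile
  -- outwards from the core.
  have step : ∀ j : Fin (S.L + 1), ∃ v c, Profile k e S.sigR m M (Set.Icc 1 (S.r j)) v c := by
    intro j
    induction j using Fin.reverseInduction with
    | last =>
      rw [S.r_core]
      refine ⟨fun _ => 1, fun _ => 0, continuousOn_const, continuousOn_const, ⟨rfl, rfl⟩,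
        ⟨∅, Set.finite_empty, fun r hr h1 => absurd hr.2 (not_le.2 h1)⟩, fun _ _ => one_pos,
        fun _ _ => le_refl _, fun r hr => ?_⟩
      have : 0 ≤ r ^ e := pow_nonneg (by linarith [hr.1]) e
      have : 0 ≤ M := by linarith
      simp only [mul_zero, mul_one]; positivity
    | cast j ih =>
      obtain ⟨v, c, h⟩ := ih
      obtain ⟨v', c', -, -, h', -⟩ := h.extend hk (S.one_le _) (hb j).1 (S.s_pos j) (hb j).2
        (I := Set.Icc 1 (S.r j.castSucc)) (fun r hr => hr.1) (Set.finite_singleton (S.r j.castSucc))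
        fun r hr h1 h2 => by
          have hlt : r < S.r j.castSucc := lt_of_le_of_ne hr.2 h2
          filter_upwards [eventually_gt_nhds h1, eventually_lt_nhds hlt] with t h3 h4
          exact S.sigR_of_mem j h3 h4.le
      exact ⟨v', c', h'⟩
  obtain ⟨v, c, h⟩ := step 0
  rw [S.r_outer] at h
  obtain ⟨v', c', A, B, h', hout⟩ := h.extend hk one_le_two hm one_pos hM (I := Set.Ici 1)
    (fun r hr => hr) Set.finite_empty fun r _ h1 _ => by
      filter_upwards [eventually_gt_nhds h1] with t ht
      exact S.sigR_of_two_lt ht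
  exact ⟨v', c', A, B, h', hout⟩

/-- The outer coefficients of a profile. -/
lemma lay_coeff {k e : ℕ} (hk : 0 < k) {A B : ℝ} (hv : 0 < layV k e A B 2)
    (hc : 0 ≤ layC k e 1 A B 2) : 0 < A ∧ |B| ≤ 2 ^ (2 * k + e) * A := by
  have hk' : (0 : ℝ) < k := by positivity
  have hke : (0 : ℝ) < k + e := by positivity
  rw [layC_eq k e 1 A B two_pos] at hc
  rw [layV] at hv
  have hc1 : 0 ≤ A * 2 ^ k / (k + e) - B * (2 ^ (k + e))⁻¹ / k := nonneg_of_mul_nonneg_right hc (by positivity)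
  set a₀ := A * 2 ^ k with ha₀
  set b₀ := B * (2 ^ (k + e))⁻¹ with hb₀
  have ha0 : 0 < a₀ := by
    have : 0 < (a₀ + b₀) / k + (a₀ / (k + e) - b₀ / k) := by positivity
    have e1 : (a₀ + b₀) / k + (a₀ / (k + e) - b₀ / k) = a₀ * (1 / k + 1 / (k + e)) := by
      field_simp; ring
    rw [e1] at this
    exact pos_of_mul_pos_left this (by positivity)
  have hA : 0 < A := pos_of_mul_pos_left ha0 (by positivity)
  refine ⟨hA, ?_⟩
  have hB : B = 2 ^ (k + e) * b₀ := by rw [hb₀]; field_simp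
  -- The upper bound on the decaying part comes from `c ≥ 0`, the lower bound below from `v > 0`.
  -- Undoing the powers of `2` in `a₀` and `b₀` produces the factor `2 ^ (2 * k + e)`.
  have h1 : b₀ ≤ a₀ := by
    have h2 : b₀ / k ≤ a₀ / (k + e) := by linarith
    have h3 : a₀ / (k + e) ≤ a₀ / k := by
      apply div_le_div_of_nonneg_left ha0.le hk'
      linarith [show (0 : ℝ) ≤ e by positivity]
    exact (div_le_div_iff_of_pos_right hk').1 (h2.trans h3)
  have h2 : |b₀| ≤ a₀ := abs_le.2 ⟨by linarith, h1⟩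
  rw [hB, abs_mul, abs_of_pos (by positivity : (0 : ℝ) < 2 ^ (k + e))]
  calc _ ≤ 2 ^ (k + e) * a₀ := mul_le_mul_of_nonneg_left h2 (by positivity)
    _ = _ := by rw [ha₀]; ring

end Cloak

end

noncomputable section
namespace Cloak

open MeasureTheory Metric Filter Topology Asymptotics
open scoped ContDiff InnerProductSpace

/-! ### Radial changes of variables -/

/-- The conductivity with eigenvalue `α` in the radial and `β` in the tangential directions. -/
def radMap {d : ℕ} (α β : ℝ) (x : E d) : E d →L[ℝ] E d :=
  β • ContinuousLinearMap.id ℝ (E d) + ((α - β) * (‖x‖ ^ 2)⁻¹) • (innerSL ℝ x).smulRight x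

lemma radMap_apply {d : ℕ} (α β : ℝ) (x v : E d) :
    radMap α β x v = β • v + ((α - β) * (‖x‖ ^ 2)⁻¹ * ⟪x, v⟫_ℝ) • x := by
  simp [radMap, smul_smul]

/-- The flux of a separated field. -/
lemma radMap_rg {d k : ℕ} {p : MvPolynomial (Fin d) ℝ} (hp : p.IsHomogeneous k) {α β : ℝ}
    {f f' b b' : ℝ → ℝ} {x : E d} (hx : x ≠ 0) (hα : α ≠ 0)
    (h1 : ‖x‖ * f' ‖x‖ + k * f ‖x‖ = k * (k + d - 2) * b ‖x‖ / α)
    (h2 : ‖x‖ * b' ‖x‖ + (k + d - 2) * b ‖x‖ = β * f ‖x‖) :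
    radMap α β x (rg f f' p x) = rj k b b' p x := by
  have hr : ‖x‖ ≠ 0 := norm_ne_zero_iff.2 hx
  have hin : ⟪x, rg f f' p x⟫_ℝ = (‖x‖ * f' ‖x‖ + k * f ‖x‖) * pv p x := by
    rw [rg, inner_add_right, inner_smul_right, inner_smul_right, real_inner_self_eq_norm_sq,
      real_inner_comm, inner_pg_self hp]
    field_simp
    ring
  have h1' : α * (‖x‖ * f' ‖x‖ + k * f ‖x‖) = k * (k + d - 2) * b ‖x‖ := by
    rw [h1]; field_simp
  rw [radMap_apply, hin]
  ext i
  simp only [rg, rj, PiLp.add_apply, PiLp.smul_apply, PiLp.sub_apply, smul_eq_mul]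
  have e1 : (‖x‖ ^ 2)⁻¹ = ‖x‖⁻¹ * ‖x‖⁻¹ := by rw [sq, mul_inv]
  rw [e1]
  have e2 : ‖x‖ * ‖x‖⁻¹ = 1 := mul_inv_cancel₀ hr
  set R := ‖x‖⁻¹
  set r := ‖x‖
  have e3 : (α - β) * (R * R) * ((r * f' r + k * f r) * pv p x)
      = (k * (k + d - 2) * b r - β * (r * f' r) - k * (r * b' r + (k + d - 2) * b r)) * (R * R) * pv p x := by
    rw [h2]
    linear_combination (R * R) * pv p x * h1'
  rw [e3]
  linear_combination (-(pg p x i)) * h2 + (-(b' r) * r * pg p x i - β * f' r * R * pv p x * x i - k * b' r * R * pv p x * x i) * e2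

/-- A change `τ` of the radial variable of `[a, R]`, starting from the core, with logarithmic
derivative `κ`. -/
structure Stretch (a R : ℝ) (τ κ : ℝ → ℝ) : Prop where
  a_pos : 0 < a
  lt : a < R
  cont : ContinuousOn τ (Set.Icc a R)
  one : τ a = 1
  mono : StrictMonoOn τ (Set.Icc a R)
  der : ∃ T : Set ℝ, T.Finite ∧ ∀ r ∈ Set.Ioo a R, r ∉ T →
    HasDerivAt τ (κ r * τ r / r) r ∧ ∀ᶠ t in 𝓝 r, κ t = κ r
  bound : ∃ K, ∀ r, |κ r| ≤ K

/-! ### Transport of a profile by a change of the radial variable. -/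

section Transport

variable (k e : ℕ) (ρ : ℝ) (sig v c τ κ : ℝ → ℝ)

/-- The transported field. -/
def tf (r : ℝ) : ℝ := ρ ^ k * v (τ r) / r ^ k

/-- The transported potential of the flux. -/
def tb (r : ℝ) : ℝ := ρ ^ (k + e) * c (τ r) / r ^ (k + e)

/-- The geometric mean of the transported conductivities. -/
def ts (r : ℝ) : ℝ := sig (τ r) * (ρ * τ r / r) ^ e

/-- The derivative of the transported field. -/
def tf' (r : ℝ) : ℝ := (k * (k + e) * tb k e ρ c τ r / (ts e ρ sig τ r / κ r) - k * tf k ρ v τ r) / r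

/-- The derivative of the transported potential of the flux. -/
def tb' (r : ℝ) : ℝ := (κ r * ts e ρ sig τ r * tf k ρ v τ r - (k + e) * tb k e ρ c τ r) / r

variable {k e ρ sig v c τ κ} {a R m M : ℝ}

lemma Stretch.one_lt (hτ : Stretch a R τ κ) {r : ℝ} (hr : r ∈ Set.Ioc a R) : 1 < τ r := by
  rw [← hτ.one]
  exact hτ.mono ⟨le_refl a, hτ.lt.le⟩ ⟨hr.1.le, hr.2⟩ hr.1

lemma Stretch.one_le (hτ : Stretch a R τ κ) {r : ℝ} (hr : r ∈ Set.Icc a R) : 1 ≤ τ r := by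
  rw [← hτ.one]
  exact hτ.mono.monotoneOn ⟨le_refl a, hτ.lt.le⟩ hr hr.1

/-- Away from finitely many radii, the transported profile satisfies the transported equations. -/
lemma Profile.transport (hP : Profile k e sig m M (Set.Ici 1) v c) (hτ : Stretch a R τ κ)
    (hm : 0 < m) (hρ : 0 < ρ) : ∃ T : Set ℝ, T.Finite ∧ ∀ r ∈ Set.Ioo a R, r ∉ T →
      (HasDerivAt (tf k ρ v τ) (tf' k e ρ sig v c τ κ r) r ∧ ContinuousAt (tf' k e ρ sig v c τ κ) r) ∧
      (HasDerivAt (tb k e ρ c τ) (tb' k e ρ sig v c τ κ r) r ∧ ContinuousAt (tb' k e ρ sig v c τ κ) r) ∧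
      m ≤ sig (τ r) ∧ sig (τ r) ≤ M := by
  obtain ⟨T, hT, hd⟩ := hP.der
  obtain ⟨T', hT', hd'⟩ := hτ.der
  -- Exceptional radii are the breaks of `τ` and the preimages of the breaks of the profile; the
  -- latter are finite in number because `τ` is injective.
  refine ⟨T' ∪ (Set.Icc a R ∩ τ ⁻¹' T), hT'.union ?_, fun r hr hrT => ?_⟩
  · refine Set.Finite.of_finite_image (f := τ) (hT.subset ?_) (hτ.mono.injOn.mono Set.inter_subset_left)
    rintro _ ⟨r, hr, rfl⟩
    exact hr.2
  simp only [Set.mem_union, not_or] at hrT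
  have hrI : r ∈ Set.Icc a R := ⟨hr.1.le, hr.2.le⟩
  have h1 := hτ.one_lt ⟨hr.1, hr.2.le⟩
  have hr0 : 0 < r := hτ.a_pos.trans hr.1
  obtain ⟨d1, ek⟩ := hd' r hr hrT.1
  obtain ⟨d2, d3, es, s1, s2⟩ := hd (τ r) h1.le h1 fun h => hrT.2 ⟨hrI, h⟩
  have hτ0 : 0 < τ r := by linarith
  have hs0 : 0 < sig (τ r) := hm.trans_le s1
  have hκc : ContinuousAt κ r := continuousAt_const.congr (ek.mono fun t ht => ht.symm)
  have hsc : ContinuousAt (fun t => sig (τ t)) r :=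
    continuousAt_const.congr ((d1.continuousAt.eventually es).mono fun t ht => ht.symm)
  have hgc : ContinuousAt (ts e ρ sig τ) r :=
    hsc.mul (((continuousAt_const.mul d1.continuousAt).div continuousAt_id hr0.ne').pow e)
  have hg0 : ts e ρ sig τ r ≠ 0 := by unfold ts; positivity
  have e1 : τ r ^ e ≠ 0 := (pow_pos hτ0 e).ne'
  have e2 : r ^ k ≠ 0 := (pow_pos hr0 k).ne'
  have e3 : r ^ e ≠ 0 := (pow_pos hr0 e).ne'
  have e4 : ρ ^ e ≠ 0 := (pow_pos hρ e).ne'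
  have hf : HasDerivAt (tf k ρ v τ) (tf' k e ρ sig v c τ κ r) r := by
    refine (((d2.comp r d1).const_mul (ρ ^ k)).mul (hasDerivAt_inv_pow_div k hr0.ne')).congr_deriv ?_
    simp only [tf', tf, tb, ts, Function.comp, div_pow, mul_pow, pow_add]
    field_simp
    ring
  have hb : HasDerivAt (tb k e ρ c τ) (tb' k e ρ sig v c τ κ r) r := by
    refine (((d3.comp r d1).const_mul (ρ ^ (k + e))).mul
      (hasDerivAt_inv_pow_div (k + e) hr0.ne')).congr_deriv ?_
    simp only [tb', tf, tb, ts, Function.comp, div_pow, mul_pow, pow_add]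
    push_cast
    field_simp
    ring
  have hk' : tf' k e ρ sig v c τ κ = fun r => (k * (k + e) * tb k e ρ c τ r * κ r / ts e ρ sig τ r
      - k * tf k ρ v τ r) / r := by
    funext t; rw [tf', div_div_eq_mul_div]
  refine ⟨⟨hf, ?_⟩, ⟨hb, ?_⟩, s1, s2⟩
  · rw [hk']
    exact ((((continuousAt_const.mul hb.continuousAt).mul hκc).div hgc hg0).sub
      (continuousAt_const.mul hf.continuousAt)).div continuousAt_id hr0.ne'
  · exact (((hκc.mul hgc).mul hf.continuousAt).sub
      (continuousAt_const.mul hb.continuousAt)).div continuousAt_id hr0.ne'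

lemma Profile.continuousOn_tf (hP : Profile k e sig m M (Set.Ici 1) v c) (hτ : Stretch a R τ κ) :
    ContinuousOn (tf k ρ v τ) (Set.Icc a R) :=
  (continuousOn_const.mul (hP.contV.comp hτ.cont fun _ hr => hτ.one_le hr)).div
    (continuousOn_id.pow k) fun _ hr => (pow_pos (hτ.a_pos.trans_le hr.1) k).ne'

lemma Profile.continuousOn_tb (hP : Profile k e sig m M (Set.Ici 1) v c) (hτ : Stretch a R τ κ) :
    ContinuousOn (tb k e ρ c τ) (Set.Icc a R) :=
  (continuousOn_const.mul (hP.contC.comp hτ.cont fun _ hr => hτ.one_le hr)).div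
    (continuousOn_id.pow (k + e)) fun _ hr => (pow_pos (hτ.a_pos.trans_le hr.1) (k + e)).ne'

lemma Stretch.continuousOn_ratio (hτ : Stretch a R τ κ) :
    ContinuousOn (fun r => (ρ * τ r / r) ^ e) (Set.Icc a R) :=
  ((continuousOn_const.mul hτ.cont).div continuousOn_id
    fun _ hr => (hτ.a_pos.trans_le hr.1).ne').pow e

/-- Only `κ` and `sig` may be discontinuous in the derivatives, and they are bounded by `K`, `m` and
`M`. The remaining factors are continuous on a compact interval bounded away from `0`. -/
lemma Profile.isPW (hP : Profile k e sig m M (Set.Ici 1) v c) (hτ : Stretch a R τ κ)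
    (hm : 0 < m) (hρ : 0 < ρ) :
    IsPW (fun r => tf k ρ v τ (max a (min r R))) ((Set.Ioo a R).indicator (tf' k e ρ sig v c τ κ)) ∧
    IsPW (fun r => tb k e ρ c τ (max a (min r R))) ((Set.Ioo a R).indicator (tb' k e ρ sig v c τ κ)) := by
  obtain ⟨T, hT, hd⟩ := hP.transport hτ hm hρ
  obtain ⟨K, hK⟩ := hτ.bound
  have cf := hP.continuousOn_tf (ρ := ρ) hτ
  have cb := hP.continuousOn_tb (ρ := ρ) hτ
  have cg := hτ.continuousOn_ratio (ρ := ρ) (e := e)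
  have hg : ∀ r ∈ Set.Icc a R, 0 < (ρ * τ r / r) ^ e := fun r hr => by
    have := hτ.one_le hr
    have := hτ.a_pos.trans_le hr.1
    positivity
  have cr : ContinuousOn (fun r : ℝ => r) (Set.Icc a R) := continuousOn_id
  have hr0 : ∀ r ∈ Set.Icc a R, r ≠ 0 := fun r hr => (hτ.a_pos.trans_le hr.1).ne'
  obtain ⟨C1, h1⟩ := isCompact_Icc.exists_bound_of_continuousOn
    (((continuousOn_const (c := (k * (k + e) : ℝ))).mul cb).div (cg.mul cr)
      fun r hr => mul_ne_zero (hg r hr).ne' (hr0 r hr))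
  obtain ⟨C2, h2⟩ := isCompact_Icc.exists_bound_of_continuousOn
    (((continuousOn_const (c := (k : ℝ))).mul cf).div cr hr0)
  obtain ⟨C3, h3⟩ := isCompact_Icc.exists_bound_of_continuousOn ((cg.mul cf).div cr hr0)
  obtain ⟨C4, h4⟩ := isCompact_Icc.exists_bound_of_continuousOn
    (((continuousOn_const (c := (k + e : ℝ))).mul cb).div cr hr0)
  constructor
  · refine isPW_clamp (M := C1 * (K / m) + C2) hτ.lt cf hT (fun r hr => (hd r hr.1 hr.2).1) fun r hr => ?_
    have hrI : r ∈ Set.Icc a R := ⟨hr.1.1.le, hr.1.2.le⟩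
    obtain ⟨-, -, s1, s2⟩ := hd r hr.1 hr.2
    have hs0 : 0 < sig (τ r) := hm.trans_le s1
    have := hr0 r hrI
    have := (hg r hrI).ne'
    have e1 : tf' k e ρ sig v c τ κ r = (k * (k + e) * tb k e ρ c τ r / ((ρ * τ r / r) ^ e * r))
        * (κ r / sig (τ r)) - k * tf k ρ v τ r / r := by
      rw [tf', ts, div_div_eq_mul_div, sub_div]
      congr 1
      field_simp
    rw [e1]
    refine (abs_sub _ _).trans (add_le_add ?_ (h2 r hrI))
    rw [abs_mul]
    refine mul_le_mul (h1 r hrI) ?_ (abs_nonneg _) ((norm_nonneg _).trans (h1 r hrI))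
    rw [abs_div, abs_of_pos hs0]
    exact div_le_div₀ ((abs_nonneg _).trans (hK r)) (hK r) hm s1
  · refine isPW_clamp (M := K * M * C3 + C4) hτ.lt cb hT (fun r hr => (hd r hr.1 hr.2).2.1) fun r hr => ?_
    have hrI : r ∈ Set.Icc a R := ⟨hr.1.1.le, hr.1.2.le⟩
    obtain ⟨-, -, s1, s2⟩ := hd r hr.1 hr.2
    have hs0 : 0 < sig (τ r) := hm.trans_le s1
    have e1 : tb' k e ρ sig v c τ κ r = κ r * sig (τ r) * ((ρ * τ r / r) ^ e * tf k ρ v τ r / r)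
        - (k + e) * tb k e ρ c τ r / r := by
      rw [tb', ts, sub_div]
      congr 1
      ring
    rw [e1]
    refine (abs_sub _ _).trans (add_le_add ?_ (h4 r hrI))
    rw [abs_mul, abs_mul, abs_of_pos hs0]
    have hK0 := (abs_nonneg _).trans (hK r)
    exact mul_le_mul (mul_le_mul (hK r) s2 hs0.le hK0) (h3 r hrI) (abs_nonneg _)
      (mul_nonneg hK0 (hs0.le.trans s2))

/-- The transported conductivity maps the gradient of the transported field to its flux. -/
lemma radMap_transport {d : ℕ} (hde : d = e + 2) {p : MvPolynomial (Fin d) ℝ} (hp : p.IsHomogeneous k)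
    {x : E d} (hx : ‖x‖ ∈ Set.Ioo a R) (ha : 0 < a) (hs : ts e ρ sig τ ‖x‖ ≠ 0) (hκ : κ ‖x‖ ≠ 0) :
    radMap (ts e ρ sig τ ‖x‖ / κ ‖x‖) (κ ‖x‖ * ts e ρ sig τ ‖x‖) x
      (rg (fun r => tf k ρ v τ (max a (min r R))) ((Set.Ioo a R).indicator (tf' k e ρ sig v c τ κ)) p x)
    = rj k (fun r => tb k e ρ c τ (max a (min r R)))
        ((Set.Ioo a R).indicator (tb' k e ρ sig v c τ κ)) p x := by
  have hr0 : 0 < ‖x‖ := ha.trans hx.1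
  have hcl : max a (min ‖x‖ R) = ‖x‖ := by
    rw [min_eq_left hx.2.le, max_eq_right hx.1.le]
  refine radMap_rg hp (norm_pos_iff.1 hr0) (div_ne_zero hs hκ) ?_ ?_
  · simp only [hcl, Set.indicator_of_mem hx, tf', hde]
    push_cast
    field_simp
    ring
  · simp only [hcl, Set.indicator_of_mem hx, tb', hde]
    push_cast
    field_simp
    ring

end Transport

lemma stretch_id {R : ℝ} (hR : 1 < R) : Stretch 1 R (fun r => r) (fun _ => 1) where
  a_pos := one_pos
  lt := hR
  cont := continuousOn_id
  one := rfl
  mono := strictMonoOn_id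
  der := ⟨∅, Set.finite_empty, fun r hr _ => ⟨(hasDerivAt_id' r).congr_deriv (by
    have : r ≠ 0 := by linarith [hr.1]
    field_simp), Eventually.of_forall fun _ => rfl⟩⟩
  bound := ⟨1, fun _ => by simp⟩

end Cloak

end

noncomputable section
namespace Cloak

open MeasureTheory Metric Filter Topology Asymptotics
open scoped ContDiff InnerProductSpace

/-! ### The field of a coated structure in a homogeneous background -/

lemma exists_abs_pv_le {d k : ℕ} {p : MvPolynomial (Fin d) ℝ} (hp : p.IsHomogeneous k) :
    ∃ C, ∀ x : E d, |pv p x| ≤ C * ‖x‖ ^ k := by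
  refine ⟨∑ m ∈ p.support, |p.coeff m|, fun x => ?_⟩
  rw [pv, MvPolynomial.eval_eq', Finset.sum_mul]
  refine (Finset.abs_sum_le_sum_abs _ _).trans (Finset.sum_le_sum fun m hm => ?_)
  rw [abs_mul]
  refine mul_le_mul_of_nonneg_left ?_ (abs_nonneg _)
  have hk : ∑ i, m i = k := by
    have := hp (MvPolynomial.mem_support_iff.1 hm)
    rwa [Finsupp.weight_apply, Finsupp.sum_fintype _ _ (by simp),
      Finset.sum_congr rfl fun i _ => by rw [Pi.one_apply, smul_eq_mul, mul_one]] at this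
  rw [Finset.abs_prod, ← hk, ← Finset.prod_pow_eq_pow_sum]
  refine Finset.prod_le_prod (fun i _ => abs_nonneg _) fun i _ => ?_
  rw [abs_pow]
  exact pow_le_pow_left₀ (abs_nonneg _) (PiLp.norm_apply_le x i) _

lemma IsH1.congr {d : ℕ} {Ω : Set (E d)} (hΩ : MeasurableSet Ω) {u u' : E d → ℝ} {G G' : E d → E d}
    (h : IsH1 Ω u G) (hu : ∀ x ∈ Ω, u x = u' x) (hG : ∀ x ∈ Ω, G x = G' x) : IsH1 Ω u' G' := by
  refine ⟨h.memLp.ae_eq ((ae_restrict_iff' hΩ).2 (Eventually.of_forall hu)),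
    h.memLp_grad.ae_eq ((ae_restrict_iff' hΩ).2 (Eventually.of_forall hG)), fun ψ hψ hs v => ?_⟩
  have e1 : ∫ x in Ω, u' x * fderiv ℝ ψ x v = ∫ x in Ω, u x * fderiv ℝ ψ x v :=
    setIntegral_congr_fun hΩ fun x hx => by simp only [hu x hx]
  have e2 : ∫ x in Ω, ⟪G' x, v⟫_ℝ * ψ x = ∫ x in Ω, ⟪G x, v⟫_ℝ * ψ x :=
    setIntegral_congr_fun hΩ fun x hx => by simp only [hG x hx]
  rw [e1, e2, h.weak_grad ψ hψ hs v]

lemma radMap_self {d : ℕ} (s : ℝ) (x v : E d) : radMap s s x v = s • v := by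
  rw [radMap_apply, sub_self, zero_mul, zero_mul, zero_smul, add_zero]

lemma cgptFactor_ne_zero (d : ℕ) {m : ℕ} (hm : 0 < m) : cgptFactor d m ≠ 0 := by
  unfold cgptFactor
  have : (0 : ℝ) < m := by exact_mod_cast hm
  split_ifs
  · exact div_ne_zero (by norm_num) (by positivity)
  · positivity

section Field

variable {d k e : ℕ} {S : Coating} {m M A B : ℝ} {v c : ℝ → ℝ}

lemma ts_pos {sig : ℝ → ℝ} (hsig : ∀ r, 1 < r → 0 < sig r) {τ κ : ℝ → ℝ} {a R ρ : ℝ}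
    (hρ : 0 < ρ) (hτ : Stretch a R τ κ) {r : ℝ} (hr : r ∈ Set.Ioo a R) : 0 < ts e ρ sig τ r := by
  have h1 := hτ.one_lt ⟨hr.1, hr.2.le⟩
  have h0 : 0 < r := hτ.a_pos.trans hr.1
  have := hsig _ h1
  unfold ts
  positivity

lemma Coating.exists_layer (S : Coating) {r : ℝ} (h1 : 1 < r) (h2 : r ≤ 2) :
    ∃ j : Fin S.L, S.r j.succ < r ∧ r ≤ S.r j.castSucc := by
  by_contra! hno
  have : ∀ j : Fin (S.L + 1), r ≤ S.r j := fun j => by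
    induction j using Fin.induction with
    | zero => rw [S.r_outer]; exact h2
    | succ j ih =>
      by_contra hlt
      exact absurd ih (not_le.2 (hno j (not_le.1 hlt)))
  have := this (Fin.last S.L)
  rw [S.r_core] at this
  linarith

lemma Coating.sigR_bounds (S : Coating) {m M : ℝ} (hm : m ≤ 1) (hM : 1 ≤ M)
    (hb : ∀ j, m ≤ S.s j ∧ S.s j ≤ M) {r : ℝ} (hr : 1 < r) : m ≤ S.sigR r ∧ S.sigR r ≤ M := by
  rcases le_or_gt r 2 with h | h
  · obtain ⟨j, h1, h2⟩ := S.exists_layer hr h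
    rw [S.sigR_of_mem j h1 h2]
    exact hb j
  · rw [S.sigR_of_two_lt h]
    exact ⟨hm, hM⟩

lemma Coating.sigR_pos (S : Coating) {r : ℝ} (hr : 1 < r) : 0 < S.sigR r := by
  obtain ⟨m, M, h0, h1, h2, h3⟩ := S.exists_bounds
  exact h0.trans_le (S.sigR_bounds h1 h2 h3 hr).1

/-- The radial field of a profile. -/
def profField (k : ℕ) (v : ℝ → ℝ) (p : MvPolynomial (Fin d) ℝ) (x : E d) : ℝ :=
  tf k 1 v (fun r => r) ‖x‖ * pv p x

/-- The gradient of the radial field of a profile. -/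
def profGrad (k e : ℕ) (sig v c : ℝ → ℝ) (p : MvPolynomial (Fin d) ℝ) : E d → E d :=
  rg (tf k 1 v fun r => r) (tf' k e 1 sig v c (fun r => r) fun _ => 1) p

lemma profGrad_eq (k e : ℕ) (sig v c : ℝ → ℝ) (p : MvPolynomial (Fin d) ℝ) {R : ℝ} {x : E d}
    (hx : ‖x‖ ∈ Set.Ioo 1 R) :
    rg (fun r => tf k 1 v (fun r => r) (max 1 (min r R)))
      ((Set.Ioo 1 R).indicator (tf' k e 1 sig v c (fun r => r) fun _ => 1)) p x
      = profGrad k e sig v c p x := by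
  have hcl : max 1 (min ‖x‖ R) = ‖x‖ := by
    rw [min_eq_left hx.2.le, max_eq_right hx.1.le]
  simp only [profGrad, rg, hcl, Set.indicator_of_mem hx]

lemma Profile.isH1_field [NeZero d] (hP : Profile k e S.sigR m M (Set.Ici 1) v c) (hm : 0 < m)
    (p : MvPolynomial (Fin d) ℝ) (R : ℝ) :
    IsH1 (ball 0 R \ closedBall 0 1) (profField k v p) (profGrad k e S.sigR v c p) := by
  have hΩ : MeasurableSet (ball (0 : E d) R \ closedBall 0 1) :=
    measurableSet_ball.diff measurableSet_closedBall
  have hR : (1 : ℝ) < max R 2 := lt_of_lt_of_le one_lt_two (le_max_right _ _)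
  have h := (hP.isPW (stretch_id hR) hm one_pos).1.isH1 p hΩ Set.sdiff_subset
  have hmem : ∀ x ∈ ball (0 : E d) R \ closedBall 0 1, ‖x‖ ∈ Set.Ioo 1 (max R 2) := fun x hx =>
    ⟨by simpa using hx.2, lt_of_lt_of_le (by simpa using hx.1) (le_max_left _ _)⟩
  refine h.congr hΩ (fun x hx => ?_) fun x hx => profGrad_eq k e S.sigR v c p (hmem x hx)
  have hcl : max 1 (min ‖x‖ (max R 2)) = ‖x‖ := by
    rw [min_eq_left (hmem x hx).2.le, max_eq_right (hmem x hx).1.le]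
  simp only [profField, hcl]

/-- The unscaled structure is the trivial transport `τ(r) = r`, `κ = 1`, `ρ = 1`. The transported
conductivity is then multiplication by `σ`, so the flux is one of the divergence free fields `rj`;
the clamping radius is taken beyond the support of `ψ`. -/
lemma Profile.flux_field [NeZero d] (hde : d = e + 2) (hP : Profile k e S.sigR m M (Set.Ici 1) v c)
    (hm : 0 < m) {p : MvPolynomial (Fin d) ℝ} (hp : p ∈ Harm d k) {ψ : E d → ℝ} (hψ : IsTest ψ) :
    ∫ x in (closedBall (0 : E d) 1)ᶜ, S.sigma x * fderiv ℝ ψ x (profGrad k e S.sigR v c p x) = 0 := by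
  obtain ⟨R₀, hR₀⟩ := hψ.2.isCompact.isBounded.subset_ball (0 : E d)
  have hR : (1 : ℝ) < max R₀ 2 := lt_of_lt_of_le one_lt_two (le_max_right _ _)
  set R := max R₀ 2
  have hst := stretch_id hR
  have h0 : ∀ r ≤ (1 : ℝ), tb k e 1 c (fun r => r) (max 1 (min r R)) = 0 := fun r hr => by
    rw [max_eq_left ((min_le_left _ _).trans hr), tb, hP.one.2]; simp
  rw [← (hP.isPW hst hm one_pos).2.integral_flux_test one_pos h0 (Harm.homog ⟨p, hp⟩)
    (Harm.lap ⟨p, hp⟩) hψ]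
  refine setIntegral_congr_fun measurableSet_closedBall.compl fun x hx => ?_
  have hx1 : 1 < ‖x‖ := by simpa using hx
  rcases lt_or_ge ‖x‖ R with hlt | hge
  · have hxI : ‖x‖ ∈ Set.Ioo 1 R := ⟨hx1, hlt⟩
    have hs : ts e 1 S.sigR (fun r => r) ‖x‖ = S.sigma x := by
      have : ‖x‖ ≠ 0 := by linarith
      rw [S.sigma_eq, ts, one_mul, div_self this, one_pow, mul_one]
    have := radMap_transport (ρ := 1) (κ := fun _ => 1) (c := c) (v := v) hde (Harm.homog ⟨p, hp⟩) hxI one_pos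
      (ts_pos (fun r hr => S.sigR_pos hr) one_pos hst hxI).ne' one_ne_zero
    rw [profGrad_eq k e S.sigR v c p hxI, div_one, one_mul, radMap_self, hs] at this
    simp only [← this, map_smul, smul_eq_mul]
  · have : fderiv ℝ ψ x = 0 := image_eq_zero_of_notMem_tsupport fun hn => by
      have h2 := hR₀ (tsupport_fderiv_subset ℝ hn)
      rw [mem_ball_zero_iff] at h2
      exact absurd (h2.trans_le (le_max_left _ _)) (not_lt.2 hge)
    simp [this]

lemma profField_outer (hA : A ≠ 0) (hv : ∀ r, 2 ≤ r → v r = layV k e A B r)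
    (p : MvPolynomial (Fin d) ℝ) {x : E d} (hx : 2 ≤ ‖x‖) :
    profField k v (A⁻¹ • p) x = pv p x + B / A * (pv p x / ‖x‖ ^ (2 * k + e)) := by
  have hr : ‖x‖ ≠ 0 := by linarith
  rw [profField, tf, hv _ hx, layV, pv_smul, show 2 * k + e = k + (k + e) by ring, pow_add ‖x‖ k (k + e), one_pow]
  field_simp

/-- A structure with vanishing polarization tensors does not scatter the background field. -/
theorem GPTVanishing.coeff_eq_zero {N : ℕ} (hS : GPTVanishing S d N) (hde : d = e + 2)
    (hP : Profile k e S.sigR m M (Set.Ici 1) v c) (hm : 0 < m) (hA : A ≠ 0)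
    (hv : ∀ r, 2 ≤ r → v r = layV k e A B r) (hk : 0 < k) (hkN : k ≤ N)
    {p : MvPolynomial (Fin d) ℝ} (hp : p ∈ Harm d k) : B = 0 ∨ p = 0 := by
  have : NeZero d := ⟨by omega⟩
  have hp' : A⁻¹ • p ∈ Harm d k := (Harm d k).smul_mem _ hp
  have hlarge : ∀ᶠ x in Bornology.cobounded (E d), 2 ≤ ‖x‖ :=
    tendsto_norm_cobounded_atTop.eventually (eventually_ge_atTop 2)
  have hsol : IsFieldSol S (harmVal ⟨p, hp⟩) (profField k v (A⁻¹ • p)) := by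
    refine ⟨profGrad k e S.sigR v c (A⁻¹ • p), hP.isH1_field hm _,
      fun ψ hψ => hP.flux_field hde hm hp' hψ, ?_, ?_⟩
    · have hn : ContinuousOn (fun x : E d => ‖x‖) {x | 2 < ‖x‖} := continuous_norm.continuousOn
      refine ContinuousOn.mul ?_ (contDiff_pv _).continuous.continuousOn
      refine ContinuousOn.div (continuousOn_const.mul (hP.contV.comp hn fun x hx => ?_)) (hn.pow k)
        fun x hx => ?_
      · have : (2 : ℝ) < ‖x‖ := hx
        simp only [Set.mem_Ici]; linarith
      · have : (2 : ℝ) < ‖x‖ := hx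
        positivity
    · obtain ⟨C, hC⟩ := exists_abs_pv_le (Harm.homog ⟨p, hp⟩)
      refine IsBigO.of_bound (|B / A| * C) (hlarge.mono fun x hx => ?_)
      have hr : 0 < ‖x‖ := by linarith
      rw [harmVal_eq, profField_outer hA hv p hx, add_sub_cancel_left, norm_mul, mul_assoc,
        Real.norm_eq_abs]
      refine mul_le_mul_of_nonneg_left ?_ (abs_nonneg _)
      rw [norm_div, norm_pow, norm_norm, norm_inv, norm_norm, Real.norm_eq_abs,
        div_le_iff₀ (pow_pos hr _)]
      refine (hC x).trans ?_
      have hC0 : 0 ≤ C := nonneg_of_mul_nonneg_left ((abs_nonneg _).trans (hC x)) (pow_pos hr k)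
      rw [mul_assoc]
      refine mul_le_mul_of_nonneg_left ?_ hC0
      rw [show 2 * k + e = (2 * k + e - 1) + 1 by omega, pow_succ', ← mul_assoc,
        inv_mul_cancel₀ hr.ne', one_mul]
      exact pow_le_pow_right₀ (by linarith) (by omega)
  -- The scattered field is `(B/A) p / |x|^{2k+e}`, so its multipole expansion has a single term, of
  -- order `k`. Only the diagonal block of order `(k, k)` is therefore used.
  let h : ∀ j, Harm d j := Pi.single k ((B / A / cgptFactor d k) • (⟨p, hp⟩ : Harm d k))
  have hmul : IsMultipole (fun x => profField k v (A⁻¹ • p) x - harmVal ⟨p, hp⟩ x) h := by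
    refine hlarge.mono fun x hx => ?_
    have hterm : profField k v (A⁻¹ • p) x - harmVal ⟨p, hp⟩ x
        = cgptFactor d (k - 1 + 1) * (harmVal (h (k - 1 + 1)) x / ‖x‖ ^ (2 * (k - 1) + d)) := by
      have e1 : ∀ j, j = k → harmVal (h j) x = B / A / cgptFactor d k * pv p x := by
        rintro j rfl
        rw [harmVal_eq]
        simp only [h, Pi.single_eq_same, Submodule.coe_smul, pv_smul]
      have hc := cgptFactor_ne_zero d hk
      rw [e1 (k - 1 + 1) (by omega), show k - 1 + 1 = k by omega,
        show 2 * (k - 1) + d = 2 * k + e by omega, harmVal_eq, profField_outer hA hv p hx]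
      field_simp
      ring
    beta_reduce
    rw [hterm]
    -- The series is indexed from `0` for order `1`, so order `k ≥ 1` sits at index `k - 1`; there
    -- the power `2(k-1) + d` equals `2k + e`.
    refine hasSum_single (k - 1) fun j hj => ?_
    have : h (j + 1) = 0 := Pi.single_eq_of_ne (by omega) _
    rw [this, harmVal_eq]
    simp
  have := hS k k hk hkN hk hkN ⟨p, hp⟩ _ hsol h hmul
  simp only [h, Pi.single_eq_same, LinearMap.zero_apply, smul_eq_zero, div_eq_zero_iff, hA,
    cgptFactor_ne_zero d hk, or_false] at this
  exact this.imp id fun h => congrArg Subtype.val h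

end Field

end Cloak

end

noncomputable section
namespace Cloak

open MeasureTheory Metric Filter Topology Asymptotics
open scoped ContDiff InnerProductSpace

/-! ### The conductivity of the cloak -/

lemma radMap_symm {d : ℕ} (α β : ℝ) (x v w : E d) :
    ⟪radMap α β x v, w⟫_ℝ = ⟪v, radMap α β x w⟫_ℝ := by
  rw [radMap_apply, radMap_apply, inner_add_left, inner_add_right, inner_smul_left, inner_smul_right,
    inner_smul_left, inner_smul_right, real_inner_comm x v]
  simp only [conj_trivial]
  ring

lemma adjoint_radMap {d : ℕ} (α β : ℝ) (x : E d) :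
    ContinuousLinearMap.adjoint (radMap α β x) = radMap α β x :=
  ((ContinuousLinearMap.eq_adjoint_iff _ _).2 fun v w => radMap_symm α β x v w).symm

lemma radMap_smul_right {d : ℕ} (α β : ℝ) {t : ℝ} (ht : t ≠ 0) (x : E d) :
    radMap α β (t • x) = radMap α β x := by
  ext1 v
  rw [radMap_apply, radMap_apply, norm_smul, mul_pow, Real.norm_eq_abs, sq_abs, inner_smul_left,
    smul_smul]
  congr 2
  simp only [conj_trivial, mul_inv]
  field_simp

lemma radMap_comp {d : ℕ} (α β γ δ : ℝ) {x : E d} (hx : x ≠ 0) :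
    radMap α β x ∘L radMap γ δ x = radMap (α * γ) (β * δ) x := by
  have hr : ‖x‖ ≠ 0 := norm_ne_zero_iff.2 hx
  ext1 v
  rw [ContinuousLinearMap.comp_apply, radMap_apply γ, radMap_apply, radMap_apply, inner_add_right,
    inner_smul_right, inner_smul_right, real_inner_self_eq_norm_sq, smul_add, smul_smul, smul_smul,
    add_assoc, ← add_smul]
  congr 2
  field_simp
  ring

lemma smul_radMap {d : ℕ} (s α β : ℝ) (x : E d) : s • radMap α β x = radMap (s * α) (s * β) x := by
  ext1 v
  rw [_root_.smul_apply, radMap_apply, radMap_apply, smul_add, smul_smul, smul_smul]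
  congr 2
  ring

lemma iso_eq_radMap {d : ℕ} (γ : E d → ℝ) (x z : E d) : iso γ x = radMap (γ x) (γ x) z := by
  ext1 v
  rw [radMap_self]
  rfl

/-- The map is `β` times a rank-one perturbation of the identity, whose determinant is explicit. The
power `β^{d-1}` is written `β ^ d / β` to avoid a truncated exponent. -/
lemma det_radMap {d : ℕ} {α β : ℝ} (hβ : β ≠ 0) {x : E d} (hx : x ≠ 0) :
    (radMap α β x).det = α * β ^ d / β := by
  have hr : ‖x‖ ≠ 0 := norm_ne_zero_iff.2 hx
  have e : ((radMap α β x : E d →L[ℝ] E d) : E d →ₗ[ℝ] E d) = β • LinearMap.transvection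
      ((((α - β) * (‖x‖ ^ 2)⁻¹ * β⁻¹) • innerSL ℝ x : StrongDual ℝ (E d)) : E d →ₗ[ℝ] ℝ) x := by
    refine LinearMap.ext fun v => ?_
    change radMap α β x v = β • (v + ((α - β) * (‖x‖ ^ 2)⁻¹ * β⁻¹ * ⟪x, v⟫_ℝ) • x)
    rw [radMap_apply, smul_add, smul_smul]
    congr 2
    field_simp
  rw [ContinuousLinearMap.det, e, LinearMap.det_smul, LinearMap.transvection.det,
    finrank_euclideanSpace_fin]
  change β ^ d * (1 + (α - β) * (‖x‖ ^ 2)⁻¹ * β⁻¹ * ⟪x, x⟫_ℝ) = _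
  rw [real_inner_self_eq_norm_sq]
  field_simp
  ring

/-- With `t` the squared radial part of `v`, the quadratic form is `α t + β (‖v‖² - t)`, and both
weights are nonnegative. -/
lemma le_inner_radMap {d : ℕ} {α β m : ℝ} (hα : m ≤ α) (hβ : m ≤ β) {x : E d} (hx : x ≠ 0) (v : E d) :
    m * ‖v‖ ^ 2 ≤ ⟪radMap α β x v, v⟫_ℝ := by
  have hr : 0 < ‖x‖ ^ 2 := by have := norm_pos_iff.2 hx; positivity
  rw [radMap_apply, inner_add_left, inner_smul_left, inner_smul_left, real_inner_self_eq_norm_sq]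
  simp only [conj_trivial]
  have h1 : ⟪x, v⟫_ℝ ^ 2 ≤ ‖x‖ ^ 2 * ‖v‖ ^ 2 := by
    rw [← mul_pow, ← sq_abs ⟪x, v⟫_ℝ]
    exact pow_le_pow_left₀ (abs_nonneg _) (abs_real_inner_le_norm x v) 2
  set t := (‖x‖ ^ 2)⁻¹ * ⟪x, v⟫_ℝ ^ 2 with ht
  have h2 : t ≤ ‖v‖ ^ 2 := by rw [ht, inv_mul_le_iff₀ hr]; exact h1
  have h3 : 0 ≤ t := by positivity
  have e : (α - β) * (‖x‖ ^ 2)⁻¹ * ⟪x, v⟫_ℝ * ⟪x, v⟫_ℝ = (α - β) * t := by rw [ht]; ring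
  rw [e]
  nlinarith [mul_le_mul_of_nonneg_right hα h3, mul_le_mul_of_nonneg_right hβ (sub_nonneg.2 h2)]

lemma norm_radMap_le {d : ℕ} {α β M : ℝ} (hα0 : 0 ≤ α) (hα : α ≤ M) (hβ0 : 0 ≤ β) (hβ : β ≤ M)
    {x : E d} (hx : x ≠ 0) : ‖radMap α β x‖ ≤ M + M := by
  have hr : ‖x‖ ≠ 0 := norm_ne_zero_iff.2 hx
  rw [radMap]
  refine (norm_add_le _ _).trans (add_le_add ?_ ?_)
  · rw [norm_smul, Real.norm_eq_abs, abs_of_nonneg hβ0]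
    exact (mul_le_of_le_one_right hβ0 ContinuousLinearMap.norm_id_le).trans hβ
  · rw [norm_smul, ContinuousLinearMap.norm_smulRight_apply, innerSL_apply_norm, norm_mul, norm_inv,
      norm_pow, norm_norm]
    have : ‖α - β‖ * (‖x‖ ^ 2)⁻¹ * (‖x‖ * ‖x‖) = ‖α - β‖ := by field_simp
    rw [this, Real.norm_eq_abs, abs_le]
    constructor <;> linarith

lemma hasFDerivAt_radial_smul {d : ℕ} {h : ℝ → ℝ} {h' : ℝ} {x : E d} (hx : x ≠ 0)
    (hh : HasDerivAt h h' ‖x‖) :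
    HasFDerivAt (fun z : E d => h ‖z‖ • z) (radMap (h ‖x‖ + ‖x‖ * h') (h ‖x‖) x) x := by
  have hr : ‖x‖ ≠ 0 := norm_ne_zero_iff.2 hx
  refine ((hh.comp_hasFDerivAt x (hasFDerivAt_norm' hx)).smul (hasFDerivAt_id x)).congr_fderiv ?_
  ext1 v
  rw [radMap_apply]
  simp only [_root_.add_apply, _root_.smul_apply, ContinuousLinearMap.id_apply,
    ContinuousLinearMap.smulRight_apply, innerSL_apply_apply, smul_eq_mul, Function.comp, id]
  congr 2
  field_simp
  ring

/-! ### The blow-up map, its inverse and its push-forward. -/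

section Cloak

variable {ρ : ℝ}

lemma blowExp_pos (h0 : 0 < ρ) (h1 : ρ < 1 / 2) : 0 < blowExp ρ :=
  div_pos (Real.log_pos (by norm_num)) (sub_pos.2 (Real.log_lt_log h0 (by linarith)))

/-- The restriction `ρ < 1/2` gives `(3/4)/ρ ≥ 3/2`, so the blow-up is a compression in logarithmic
radius. -/
lemma blowExp_le_one (h0 : 0 < ρ) (h1 : ρ < 1 / 2) : blowExp ρ ≤ 1 := by
  refine (div_le_one (sub_pos.2 (Real.log_lt_log h0 (by linarith)))).2 ?_
  rw [← Real.log_div (by norm_num) h0.ne']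
  refine Real.log_le_log (by norm_num) ?_
  rw [le_div_iff₀ h0]
  linarith

/-- The radial variable of the unscaled structure as a function of that of the cloak. -/
def cloakTau (ρ s : ℝ) : ℝ := if s ≤ 3 / 4 then (2 * s) ^ (blowExp ρ)⁻¹ else s / ρ

/-- The logarithmic derivative of `cloakTau`. -/
def cloakKappa (ρ s : ℝ) : ℝ := if s ≤ 3 / 4 then (blowExp ρ)⁻¹ else 1

/-- The exponent `α(ρ)` is defined exactly so that the two branches meet at radius `3/4`. -/
lemma cloakTau_mid (h0 : 0 < ρ) :
    (2 * (3 / 4) : ℝ) ^ (blowExp ρ)⁻¹ = 3 / 4 / ρ := by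
  have hl : Real.log (3 / 2) ≠ 0 := (Real.log_pos (by norm_num)).ne'
  rw [show (2 * (3 / 4) : ℝ) = 3 / 2 by norm_num, blowExp, inv_div,
    Real.rpow_def_of_pos (by norm_num), mul_div_cancel₀ _ hl, ← Real.log_div (by norm_num) h0.ne',
    Real.exp_log (by positivity)]

lemma continuous_cloakTau (h0 : 0 < ρ) (h1 : ρ < 1 / 2) : Continuous (cloakTau ρ) := by
  refine Continuous.if_le ?_ (continuous_id.div_const ρ) continuous_id continuous_const fun s hs => ?_
  · exact (continuous_const.mul continuous_id).rpow_const fun _ =>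
      Or.inr (inv_nonneg.2 (blowExp_pos h0 h1).le)
  · rw [show s = 3 / 4 from hs]
    exact cloakTau_mid h0

lemma cloakKappa_bounds (h0 : 0 < ρ) (h1 : ρ < 1 / 2) (s : ℝ) :
    1 ≤ cloakKappa ρ s ∧ cloakKappa ρ s ≤ (blowExp ρ)⁻¹ := by
  have := (one_le_inv₀ (blowExp_pos h0 h1)).2 (blowExp_le_one h0 h1)
  unfold cloakKappa
  split_ifs
  · exact ⟨this, le_refl _⟩
  · exact ⟨le_refl _, this⟩

lemma stretch_cloak (h0 : 0 < ρ) (h1 : ρ < 1 / 2) :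
    Stretch (1 / 2) 1 (cloakTau ρ) (cloakKappa ρ) where
  a_pos := by norm_num
  lt := by norm_num
  cont := (continuous_cloakTau h0 h1).continuousOn
  one := by rw [cloakTau, if_pos (by norm_num)]; norm_num
  mono := by
    have hα := inv_pos.2 (blowExp_pos h0 h1)
    have hm : ∀ {x y : ℝ}, 0 ≤ x → x < y → (2 * x) ^ (blowExp ρ)⁻¹ < (2 * y) ^ (blowExp ρ)⁻¹ :=
      fun hx hxy => Real.rpow_lt_rpow (by linarith) (by linarith) hα
    intro x hx y hy hxy
    have hx0 : 0 ≤ x := by linarith [hx.1]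
    unfold cloakTau
    split_ifs with h2 h3 h3
    · exact hm hx0 hxy
    · rw [not_le] at h3
      have : 3 / 4 / ρ < y / ρ := div_lt_div_of_pos_right h3 h0
      rcases h2.eq_or_lt with h4 | h4
      · rw [h4, cloakTau_mid h0]; exact this
      · have h5 := hm hx0 h4
        rw [cloakTau_mid h0] at h5
        exact h5.trans this
    · exact absurd (hxy.le.trans h3) h2
    · exact div_lt_div_of_pos_right hxy h0
  der := by
    refine ⟨{3 / 4}, Set.finite_singleton _, fun r hr hr' => ?_⟩
    have hr0 : 0 < r := by linarith [hr.1]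
    rcases lt_or_gt_of_ne (show r ≠ 3 / 4 from hr') with h | h
    · have ev : ∀ᶠ t in 𝓝 r, t ≤ 3 / 4 := (eventually_lt_nhds h).mono fun t ht => ht.le
      refine ⟨?_, ev.mono fun t ht => by rw [cloakKappa, cloakKappa, if_pos ht, if_pos h.le]⟩
      refine HasDerivAt.congr_of_eventuallyEq ?_ (ev.mono fun t ht => if_pos ht)
      rw [cloakTau, cloakKappa, if_pos h.le, if_pos h.le]
      have h2 : HasDerivAt (fun t : ℝ => 2 * t) 2 r := by simpa using (hasDerivAt_id' r).const_mul 2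
      refine (h2.rpow_const (p := (blowExp ρ)⁻¹) (Or.inl (by positivity))).congr_deriv ?_
      rw [Real.rpow_sub_one (by positivity)]
      field_simp
    · have ev : ∀ᶠ t in 𝓝 r, ¬ t ≤ 3 / 4 := (eventually_gt_nhds h).mono fun t ht => not_le.2 ht
      refine ⟨?_, ev.mono fun t ht => by rw [cloakKappa, cloakKappa, if_neg ht, if_neg (not_le.2 h)]⟩
      refine HasDerivAt.congr_of_eventuallyEq ?_ (ev.mono fun t ht => if_neg ht)
      rw [cloakTau, cloakKappa, if_neg (not_le.2 h), if_neg (not_le.2 h)]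
      refine ((hasDerivAt_id' r).div_const ρ).congr_deriv ?_
      field_simp
  bound := ⟨(blowExp ρ)⁻¹, fun r => by
    obtain ⟨h2, h3⟩ := cloakKappa_bounds h0 h1 r
    rw [abs_of_nonneg (by linarith)]; exact h3⟩

lemma cloakTau_one (ρ : ℝ) : cloakTau ρ 1 = 1 / ρ := if_neg (by norm_num)

/-- The radius of the preimage under the blow-up map. -/
lemma blowProfile_eq_iff (h0 : 0 < ρ) (h1 : ρ < 1 / 2) {s t : ℝ} (hs : 1 / 2 < s) (ht : 0 ≤ t) :
    blowProfile ρ t = s ↔ t = ρ * cloakTau ρ s := by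
  have hα := blowExp_pos h0 h1
  have hmid := cloakTau_mid h0
  constructor
  · intro h
    unfold blowProfile at h
    split_ifs at h with h2 h3
    · rw [div_eq_iff (by positivity)] at h
      nlinarith
    · have ht0 : 0 < t := h0.trans (not_le.1 h2)
      have e1 : (2 * s) ^ (blowExp ρ)⁻¹ = t / ρ := by
        rw [← h, ← mul_assoc, show (2 : ℝ) * (1 / 2) = 1 by norm_num, one_mul,
          Real.rpow_rpow_inv (by positivity) hα.ne']
      have hs3 : s ≤ 3 / 4 := by
        by_contra hlt
        have h4 : (2 * (3 / 4) : ℝ) ^ (blowExp ρ)⁻¹ < (2 * s) ^ (blowExp ρ)⁻¹ :=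
          Real.rpow_lt_rpow (by norm_num) (by linarith) (inv_pos.2 hα)
        rw [hmid, e1] at h4
        exact absurd h3 (not_le.2 ((div_lt_div_iff_of_pos_right h0).1 h4))
      rw [cloakTau, if_pos hs3, e1]
      field_simp
    · rw [← h, cloakTau, if_neg h3]
      field_simp
  · rintro rfl
    unfold cloakTau
    split_ifs with h2
    · have e1 : 1 < (2 * s) ^ (blowExp ρ)⁻¹ := Real.one_lt_rpow (by linarith) (inv_pos.2 hα)
      have e2 : (2 * s) ^ (blowExp ρ)⁻¹ ≤ 3 / 4 / ρ := by
        rw [← hmid]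
        exact Real.rpow_le_rpow (by linarith) (by linarith) (inv_pos.2 hα).le
      rw [blowProfile, if_neg (not_le.2 (by nlinarith)), if_pos (by
        rw [le_div_iff₀ h0] at e2; linarith), mul_div_cancel_left₀ _ h0.ne',
        Real.rpow_inv_rpow (by linarith) hα.ne']
      ring
    · rw [not_le] at h2
      rw [mul_div_cancel₀ _ h0.ne', blowProfile, if_neg (not_le.2 (by linarith)), if_neg (not_le.2 h2)]

lemma hasDerivAt_blowProfile (h0 : 0 < ρ) {t : ℝ} (ht : ρ < t) (ht' : t ≠ 3 / 4) :
    HasDerivAt (blowProfile ρ) ((if t ≤ 3 / 4 then blowExp ρ else 1) * blowProfile ρ t / t) t := by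
  have ht0 : 0 < t := h0.trans ht
  rcases lt_or_gt_of_ne ht' with h | h
  · have ev : blowProfile ρ =ᶠ[𝓝 t] fun t => 1 / 2 * (t / ρ) ^ blowExp ρ := by
      filter_upwards [eventually_gt_nhds ht, eventually_lt_nhds h] with r h1 h2
      rw [blowProfile, if_neg (not_le.2 h1), if_pos h2.le]
    rw [ev.eq_of_nhds, if_pos h.le]
    refine HasDerivAt.congr_of_eventuallyEq ?_ ev
    refine ((((hasDerivAt_id' t).div_const ρ).rpow_const (p := blowExp ρ)
      (Or.inl (by positivity))).const_mul (1 / 2)).congr_deriv ?_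
    rw [Real.rpow_sub_one (by positivity)]
    field_simp
  · have ev : ∀ᶠ r in 𝓝 t, blowProfile ρ r = r := by
      filter_upwards [eventually_gt_nhds ht, eventually_gt_nhds h] with r h1 h2
      rw [blowProfile, if_neg (not_le.2 h1), if_neg (not_le.2 h2)]
    rw [ev.self_of_nhds, if_neg (not_le.2 h), one_mul, div_self ht0.ne']
    exact (hasDerivAt_id' t).congr_of_eventuallyEq ev

/-- `Function.invFunOn` picks some preimage in the closed ball. Outside the inner half ball it is
unique, since the blow-up map keeps directions and its profile determines the radius. -/
lemma invFunOn_blowUp {d : ℕ} (h0 : 0 < ρ) (h1 : ρ < 1 / 2) {y : E d} (hy : 1 / 2 < ‖y‖) (hy1 : ‖y‖ ≤ 1) :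
    Function.invFunOn (blowUp ρ) (closedBall 0 1) y = (ρ * cloakTau ρ ‖y‖ / ‖y‖) • y := by
  have hτ := stretch_cloak h0 h1
  have hτ1 := hτ.one_le ⟨hy.le, hy1⟩
  have hτle : cloakTau ρ ‖y‖ ≤ 1 / ρ := by
    rw [← cloakTau_one]
    exact hτ.mono.monotoneOn ⟨hy.le, hy1⟩ ⟨by norm_num, le_refl _⟩ hy1
  have hs0 : 0 < ‖y‖ := by linarith
  have ht0 : 0 < ρ * cloakTau ρ ‖y‖ := by positivity
  have hn : ‖(ρ * cloakTau ρ ‖y‖ / ‖y‖) • y‖ = ρ * cloakTau ρ ‖y‖ := by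
    rw [norm_smul, norm_div, norm_norm, Real.norm_of_nonneg ht0.le]
    field_simp
  have hex : ∃ x ∈ closedBall (0 : E d) 1, blowUp ρ x = y := by
    refine ⟨(ρ * cloakTau ρ ‖y‖ / ‖y‖) • y, ?_, ?_⟩
    · rw [mem_closedBall_zero_iff, hn]
      rw [le_div_iff₀ h0] at hτle
      linarith
    · rw [blowUp, hn, (blowProfile_eq_iff h0 h1 hy ht0.le).2 rfl, smul_smul]
      have : ‖y‖ / (ρ * cloakTau ρ ‖y‖) * (ρ * cloakTau ρ ‖y‖ / ‖y‖) = 1 := by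
        field_simp
      rw [this, one_smul]
  have hx := Function.invFunOn_eq hex
  set x := Function.invFunOn (blowUp ρ) (closedBall 0 1) y
  have hx0 : ‖x‖ ≠ 0 := fun h => by
    have : x = 0 := norm_eq_zero.1 h
    rw [this, blowUp, smul_zero] at hx
    rw [← hx, norm_zero] at hs0
    exact lt_irrefl _ hs0
  have hpos : 0 ≤ blowProfile ρ ‖x‖ := by
    unfold blowProfile
    split_ifs <;> positivity
  have hnorm : blowProfile ρ ‖x‖ = ‖y‖ := by
    rw [← hx, blowUp, norm_smul, norm_div, norm_norm, Real.norm_of_nonneg hpos]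
    field_simp
  have ht := (blowProfile_eq_iff h0 h1 hy (norm_nonneg x)).1 hnorm
  rw [← ht]
  conv_rhs => rw [← hx, blowUp, hnorm, smul_smul]
  have : ‖x‖ / ‖blowUp ρ x‖ * (‖y‖ / ‖x‖) = 1 := by
    rw [hx]; field_simp
  rw [blowUp, hnorm] at this
  rw [this, one_smul]

/-- The conductivity of the cloak. -/
lemma pushForward_blowUp {d e : ℕ} (hde : d = e + 2) (S : Coating) (h0 : 0 < ρ) (h1 : ρ < 1 / 2)
    {y : E d} (hy : ‖y‖ ∈ Set.Ioo (1 / 2) 1) (hy3 : ‖y‖ ≠ 3 / 4) :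
    pushForward (blowUp ρ) (iso (scaledSigma S ρ)) y
      = radMap (ts e ρ S.sigR (cloakTau ρ) ‖y‖ / cloakKappa ρ ‖y‖)
          (cloakKappa ρ ‖y‖ * ts e ρ S.sigR (cloakTau ρ) ‖y‖) y := by
  have hτ := stretch_cloak h0 h1
  have hτ1 := hτ.one_lt ⟨hy.1, hy.2.le⟩
  have hs0 : 0 < ‖y‖ := by linarith [hy.1]
  have hα := blowExp_pos h0 h1
  set s := ‖y‖ with hs
  set t := ρ * cloakTau ρ s with ht
  have ht0 : 0 < t := by positivity
  have htρ : ρ < t := by rw [ht]; nlinarith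
  have hts : t / s ≠ 0 := by positivity
  have hy0 : y ≠ 0 := norm_pos_iff.1 hs0
  have hn : ‖(t / s) • y‖ = t := by
    rw [norm_smul, norm_div, ← hs, Real.norm_of_nonneg ht0.le, Real.norm_of_nonneg hs0.le]
    field_simp
  have hx0 : (t / s) • y ≠ 0 := smul_ne_zero hts hy0
  have hg : blowProfile ρ t = s := (blowProfile_eq_iff h0 h1 hy.1 ht0.le).2 rfl
  have h34 : t ≤ 3 / 4 ↔ s ≤ 3 / 4 := by
    have hm : 3 / 4 = ρ * cloakTau ρ (3 / 4) := by
      rw [cloakTau, if_pos (le_refl _), cloakTau_mid h0]; field_simp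
    rw [hm, ht, mul_le_mul_iff_right₀ h0, ← hm]
    exact hτ.mono.le_iff_le ⟨hy.1.le, hy.2.le⟩ ⟨by norm_num, by norm_num⟩
  have ht3 : t ≠ 3 / 4 := fun h => by
    have h3 : blowProfile ρ (3 / 4) = 3 / 4 := by
      refine (blowProfile_eq_iff h0 h1 (by norm_num) (by norm_num)).2 ?_
      rw [cloakTau, if_pos (le_refl _), cloakTau_mid h0]; field_simp
    rw [h, h3] at hg
    exact hy3 hg.symm
  have hκ : (if t ≤ 3 / 4 then blowExp ρ else 1) = (cloakKappa ρ s)⁻¹ := by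
    rw [cloakKappa]
    by_cases h : s ≤ 3 / 4
    · rw [if_pos h, if_pos (h34.2 h), inv_inv]
    · rw [if_neg h, if_neg (fun h' => h (h34.1 h')), inv_one]
  have hκ0 : 0 < cloakKappa ρ s := by linarith [(cloakKappa_bounds h0 h1 s).1]
  have hd := hasDerivAt_blowProfile h0 htρ ht3
  rw [hκ, hg] at hd
  have hF : HasFDerivAt (blowUp ρ) (radMap ((cloakKappa ρ s)⁻¹ * s / t) (s / t) y) ((t / s) • y) := by
    have hd' : HasDerivAt (fun r => blowProfile ρ r / r)
        (((cloakKappa ρ s)⁻¹ * s / t * t - blowProfile ρ t * 1) / t ^ 2) ‖(t / s) • y‖ := by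
      rw [hn]; exact hd.div (hasDerivAt_id' t) ht0.ne'
    refine (hasFDerivAt_radial_smul hx0 hd').congr_fderiv ?_
    rw [radMap_smul_right _ _ hts, hn, hg]
    congr 1
    field_simp
    ring
  have hσ : scaledSigma S ρ ((t / s) • y) = S.sigR (cloakTau ρ s) := by
    rw [scaledSigma, S.sigma_eq, norm_smul, hn, norm_inv, Real.norm_of_nonneg h0.le, ht]
    congr 1
    field_simp
  simp only [pushForward]
  -- The differential has radial eigenvalue `κ⁻¹ s/t` and tangential eigenvalue `s/t`. Squaring them
  -- and dividing by the determinant leaves `σ κ⁻¹ (t/s)^e` in the radial direction and `σ κ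
  -- (t/s)^e` in the tangential ones.
  rw [invFunOn_blowUp h0 h1 hy.1 hy.2.le, ← hs, ← ht, hF.fderiv, adjoint_radMap,
    iso_eq_radMap _ _ y, hσ, radMap_comp _ _ _ _ hy0, radMap_comp _ _ _ _ hy0, smul_radMap,
    det_radMap (by positivity) hy0]
  have e0 : s ^ e ≠ 0 := (pow_pos hs0 e).ne'
  have e1 : t ^ e ≠ 0 := (pow_pos ht0 e).ne'
  congr 1
  · rw [ts, ← ht, hde, div_pow, div_pow, pow_add, pow_add]
    field_simp
  · rw [ts, ← ht, hde, div_pow, div_pow, pow_add, pow_add]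
    field_simp

/-! ### Measurability and ellipticity of the cloak. -/

lemma Coating.measurable_sigR (S : Coating) : Measurable S.sigR := by
  refine Measurable.add ?_ (Finset.measurable_sum _ fun j _ => ?_)
  · exact Measurable.ite measurableSet_Ioi measurable_const measurable_const
  · exact Measurable.ite measurableSet_Ioc measurable_const measurable_const

lemma measurable_cloakKappa (ρ : ℝ) : Measurable (cloakKappa ρ) :=
  Measurable.ite measurableSet_Iic measurable_const measurable_const

lemma pushForward_ae {d e : ℕ} [NeZero d] (hde : d = e + 2) (S : Coating) (h0 : 0 < ρ) (h1 : ρ < 1 / 2) :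
    ∀ᵐ y ∂vol (closedBall (0 : E d) (1 / 2)), ‖y‖ ∈ Set.Ioo (1 / 2) 1 ∧
      pushForward (blowUp ρ) (iso (scaledSigma S ρ)) y
      = radMap (ts e ρ S.sigR (cloakTau ρ) ‖y‖ / cloakKappa ρ ‖y‖)
          (cloakKappa ρ ‖y‖ * ts e ρ S.sigR (cloakTau ρ) ‖y‖) y := by
  rw [vol, ae_restrict_iff' (measurableSet_dom isClosed_closedBall)]
  filter_upwards [ae_norm_notMem (d := d) (Set.finite_singleton (3 / 4))] with y hy hyd
  have hyI : ‖y‖ ∈ Set.Ioo (1 / 2) 1 := ⟨by simpa using hyd.2, by simpa using hyd.1⟩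
  exact ⟨hyI, pushForward_blowUp hde S h0 h1 hyI hy⟩

/-- The bounds come from `ρ ≤ t/s ≤ 2` for preimage radius `t` and radius `s`, together with those
of `σ` and `κ`. They depend on `ρ`, which is harmless: they only serve well-posedness at fixed `ρ`
and do not enter the final constant. -/
lemma exists_isCond_cloak {d e : ℕ} [NeZero d] (hde : d = e + 2) (S : Coating) (h0 : 0 < ρ) (h1 : ρ < 1 / 2) :
    ∃ m M, IsCond (closedBall (0 : E d) (1 / 2)) (pushForward (blowUp ρ) (iso (scaledSigma S ρ))) m M := by
  obtain ⟨m, M, hm, hm1, hM, hb⟩ := S.exists_bounds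
  have hτ := stretch_cloak h0 h1
  have hα := blowExp_pos h0 h1
  have hα1 := blowExp_le_one h0 h1
  have hae := pushForward_ae hde S h0 h1
  have bounds : ∀ s ∈ Set.Ioo (1 / 2 : ℝ) 1,
      (m * ρ ^ e * blowExp ρ ≤ ts e ρ S.sigR (cloakTau ρ) s / cloakKappa ρ s ∧
        ts e ρ S.sigR (cloakTau ρ) s / cloakKappa ρ s ≤ M * 2 ^ e * (blowExp ρ)⁻¹) ∧
      (m * ρ ^ e * blowExp ρ ≤ cloakKappa ρ s * ts e ρ S.sigR (cloakTau ρ) s ∧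
        cloakKappa ρ s * ts e ρ S.sigR (cloakTau ρ) s ≤ M * 2 ^ e * (blowExp ρ)⁻¹) := by
    intro s hs
    have hs0 : 0 < s := by linarith [hs.1]
    have t1 := hτ.one_lt ⟨hs.1, hs.2.le⟩
    have t2 : cloakTau ρ s ≤ 1 / ρ := by
      rw [← cloakTau_one]
      exact hτ.mono.monotoneOn ⟨hs.1.le, hs.2.le⟩ ⟨by norm_num, le_refl _⟩ hs.2.le
    rw [le_div_iff₀ h0] at t2
    obtain ⟨s1, s2⟩ := S.sigR_bounds hm1 hM hb t1
    obtain ⟨k1, k2⟩ := cloakKappa_bounds h0 h1 s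
    have g1 : ρ ≤ ρ * cloakTau ρ s / s := by
      rw [le_div_iff₀ hs0]; nlinarith [hs.2]
    have g2 : ρ * cloakTau ρ s / s ≤ 2 := by
      rw [div_le_iff₀ hs0]; linarith [hs.1]
    have p1 : m * ρ ^ e ≤ ts e ρ S.sigR (cloakTau ρ) s :=
      mul_le_mul s1 (pow_le_pow_left₀ h0.le g1 e) (by positivity) (hm.le.trans s1)
    have p2 : ts e ρ S.sigR (cloakTau ρ) s ≤ M * 2 ^ e :=
      mul_le_mul s2 (pow_le_pow_left₀ (h0.le.trans g1) g2 e) (pow_nonneg (h0.le.trans g1) e) (by linarith)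
    have p0 : 0 < m * ρ ^ e := by positivity
    have hκ0 : 0 < cloakKappa ρ s := by linarith
    have hκi : blowExp ρ ≤ (cloakKappa ρ s)⁻¹ := by
      rw [le_inv_comm₀ hα hκ0]; exact k2
    have hi1 : (cloakKappa ρ s)⁻¹ ≤ (blowExp ρ)⁻¹ :=
      (inv_le_one_of_one_le₀ k1).trans ((one_le_inv₀ hα).2 hα1)
    refine ⟨⟨?_, ?_⟩, ?_, ?_⟩
    · rw [div_eq_mul_inv]
      exact mul_le_mul p1 hκi hα.le (p0.le.trans p1)
    · rw [div_eq_mul_inv]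
      exact mul_le_mul p2 hi1 (inv_pos.2 hκ0).le ((p0.le.trans p1).trans p2)
    · rw [mul_comm (cloakKappa ρ s)]
      exact mul_le_mul p1 (hα1.trans k1) hα.le (p0.le.trans p1)
    · rw [mul_comm (cloakKappa ρ s)]
      exact mul_le_mul p2 k2 hκ0.le ((p0.le.trans p1).trans p2)
  have hpos : 0 < m * ρ ^ e * blowExp ρ := by positivity
  have hne : ∀ y : E d, ‖y‖ ∈ Set.Ioo (1 / 2) 1 → y ≠ 0 := fun y hy =>
    norm_pos_iff.1 (by linarith [hy.1])
  refine ⟨m * ρ ^ e * blowExp ρ, M * 2 ^ e * (blowExp ρ)⁻¹ + M * 2 ^ e * (blowExp ρ)⁻¹, hpos, ?_, ?_, ?_, ?_⟩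
  · have hts : Measurable (ts e ρ S.sigR (cloakTau ρ)) := by
      have := (continuous_cloakTau h0 h1).measurable
      exact (S.measurable_sigR.comp this).mul (((measurable_const.mul this).div measurable_id).pow_const e)
    have hκ := measurable_cloakKappa ρ
    have m1 : Measurable fun y : E d => ts e ρ S.sigR (cloakTau ρ) ‖y‖ / cloakKappa ρ ‖y‖ :=
      (hts.div hκ).comp measurable_norm
    have m2 : Measurable fun y : E d => cloakKappa ρ ‖y‖ * ts e ρ S.sigR (cloakTau ρ) ‖y‖ :=
      (hκ.mul hts).comp measurable_norm
    have m3 : Measurable fun y : E d => (‖y‖ ^ 2)⁻¹ := (measurable_norm.pow_const 2).inv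
    have c4 : Continuous fun y : E d => (innerSL ℝ y).smulRight y := by fun_prop
    have : AEStronglyMeasurable (fun y : E d => radMap (ts e ρ S.sigR (cloakTau ρ) ‖y‖ / cloakKappa ρ ‖y‖)
        (cloakKappa ρ ‖y‖ * ts e ρ S.sigR (cloakTau ρ) ‖y‖) y) (vol (closedBall (0 : E d) (1 / 2))) :=
      (m2.aestronglyMeasurable.smul aestronglyMeasurable_const).add
        (((m1.sub m2).mul m3).aestronglyMeasurable.smul c4.aestronglyMeasurable)
    exact this.congr (hae.mono fun y hy => hy.2.symm)
  · filter_upwards [hae] with y hy v w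
    rw [hy.2]
    exact radMap_symm _ _ y v w
  · filter_upwards [hae] with y hy v
    rw [hy.2]
    obtain ⟨b1, b2⟩ := bounds _ hy.1
    exact le_inner_radMap b1.1 b2.1 (hne y hy.1) v
  · filter_upwards [hae] with y hy
    rw [hy.2]
    obtain ⟨b1, b2⟩ := bounds _ hy.1
    exact norm_radMap_le (hpos.le.trans b1.1) b1.2 (hpos.le.trans b2.1) b2.2 (hne y hy.1)

end Cloak

end Cloak

end

noncomputable section
namespace Cloak

open MeasureTheory Metric Filter Topology Asymptotics
open scoped ContDiff InnerProductSpace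

/-! ### Eigenvalues of the Dirichlet-to-Neumann map of the cloak -/

section Eigenvalues

variable {d k e : ℕ} {S : Coating} {m M ρ : ℝ} {v c : ℝ → ℝ}

/-- The Dirichlet-to-Neumann map of the cloak is diagonal in spherical harmonics. -/
lemma IsDtN.apply_cloak [NeZero d] (hde : d = e + 2) (h0 : 0 < ρ) (h1 : ρ < 1 / 2)
    {Λ : Hhalf d →L[ℝ] HnegHalf d}
    (hΛ : IsDtN (closedBall 0 (1 / 2)) (pushForward (blowUp ρ) (iso (scaledSigma S ρ))) Λ)
    (hP : Profile k e S.sigR m M (Set.Ici 1) v c) (hm : 0 < m)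
    {p : MvPolynomial (Fin d) ℝ} (hp : p ∈ Harm d k) (ψ : Hhalf d) :
    Λ (polyTrace d p) ψ = k * (k + e) * (ρ ^ e * c (1 / ρ) / v (1 / ρ)) *
      ∫ y, ψ.toL2 y * pv p (y : E d) ∂(surf d) := by
  have hτ := stretch_cloak h0 h1
  have hv : 0 < v (1 / ρ) := hP.pos _ (by
    rw [Set.mem_Ici, le_div_iff₀ h0]; linarith)
  have hcl : max (1 / 2) (min 1 1) = (1 : ℝ) := by norm_num
  have hf1 : tf k ρ v (cloakTau ρ) 1 = ρ ^ k * v (1 / ρ) := by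
    rw [tf, cloakTau_one, one_pow, div_one]
  have hb1 : tb k e ρ c (cloakTau ρ) 1 = ρ ^ (k + e) * c (1 / ρ) := by
    rw [tb, cloakTau_one, one_pow, div_one]
  have hf0 : ρ ^ k * v (1 / ρ) ≠ 0 := by positivity
  -- The radial factor of the transported field equals `ρ^k v(1/ρ)` on the unit sphere; dividing by
  -- it makes the trace equal to `p`.
  set q : MvPolynomial (Fin d) ℝ := (ρ ^ k * v (1 / ρ))⁻¹ • p with hq
  have hqH : q ∈ Harm d k := (Harm d k).smul_mem _ hp
  obtain ⟨pf, pb⟩ := hP.isPW (ρ := ρ) hτ hm h0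
  have hext := pf.isExt q (φ := (polyTrace d p).toL2) (by
    filter_upwards [polyTrace_ae p] with y hy
    rw [hy, hcl, hf1, hq, pv_smul, mul_inv_cancel_left₀ hf0]) (closedBall 0 (1 / 2))
  set G := rg (fun r => tf k ρ v (cloakTau ρ) (max (1 / 2) (min r 1)))
    ((Set.Ioo (1 / 2) 1).indicator (tf' k e ρ S.sigR v c (cloakTau ρ) (cloakKappa ρ))) q with hG
  have hb0 : ∀ r ≤ (1 / 2 : ℝ), tb k e ρ c (cloakTau ρ) (max (1 / 2) (min r 1)) = 0 := fun r hr => by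
    rw [max_eq_left ((min_le_left _ _).trans hr), tb, hτ.one, hP.one.2, mul_zero, zero_div]
  -- One formula serves twice: with `χ = 0` it is the weak equation, including the natural condition
  -- on the core, and with `χ` the trace of `ψ` it gives the eigenvalue.
  have hflux : ∀ (χ : Lp ℝ 2 (surf d)) w Z, IsExt (closedBall 0 (1 / 2)) χ w Z →
      ∫ x in dom (closedBall 0 (1 / 2)), ⟪pushForward (blowUp ρ) (iso (scaledSigma S ρ)) x (G x), Z x⟫_ℝ
        = k * (k + e) * (ρ ^ (k + e) * c (1 / ρ)) * ∫ y, χ y * pv q (y : E d) ∂(surf d) := by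
    intro χ w Z hZ
    have := pb.integral_flux (by norm_num) hb0 (Harm.homog ⟨q, hqH⟩) (Harm.lap ⟨q, hqH⟩) hZ
    rw [hcl, hb1, show (k + d - 2 : ℝ) = k + e by rw [hde]; push_cast; ring] at this
    rw [← this]
    refine integral_congr_ae ?_
    filter_upwards [pushForward_ae hde S h0 h1] with y hy
    have hκ : 0 < cloakKappa ρ ‖y‖ := by linarith [(cloakKappa_bounds h0 h1 ‖y‖).1]
    rw [hy.2, hG, radMap_transport hde (Harm.homog ⟨q, hqH⟩) hy.1 (by norm_num)
      (ts_pos (fun r hr => S.sigR_pos hr) h0 hτ hy.1).ne' hκ.ne']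
  have hsol : IsWeakSol (closedBall 0 (1 / 2)) (pushForward (blowUp ρ) (iso (scaledSigma S ρ)))
      (polyTrace d p).toL2 _ G := ⟨hext, fun w Z hZ => by
    rw [hflux 0 w Z hZ, integral_zero_Lp_mul, mul_zero]⟩
  obtain ⟨U, W, hW⟩ := ψ.exists_isExt (closedBall 0 (1 / 2))
  rw [(hΛ.2 _).2 _ _ hsol ψ _ _ hW, hflux _ _ _ hW]
  have hi : ∫ y, ψ.toL2 y * pv q (y : E d) ∂(surf d)
      = (ρ ^ k * v (1 / ρ))⁻¹ * ∫ y, ψ.toL2 y * pv p (y : E d) ∂(surf d) := by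
    rw [← integral_const_mul]
    refine integral_congr_ae (Eventually.of_forall fun y => ?_)
    simp only [hq, pv_smul]
    ring
  rw [hi, pow_add]
  field_simp

/-- The growing solution alone would give the eigenvalue `k` exactly, so the difference carries a
factor `B`. The denominator is `ρ^k v(1/ρ)`. -/
lemma eigenvalue_sub {A B : ℝ} (hk : 0 < k) (h0 : 0 < ρ) (hv : 0 < layV k e A B (1 / ρ)) :
    k * (k + e) * (ρ ^ e * layC k e 1 A B (1 / ρ) / layV k e A B (1 / ρ)) - k
      = -((2 * k + e) * (B * ρ ^ (2 * k + e))) / (A + B * ρ ^ (2 * k + e)) := by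
  have hk' : (k : ℝ) ≠ 0 := by positivity
  have hke : (k + e : ℝ) ≠ 0 := by positivity
  have hρ : ρ ≠ 0 := h0.ne'
  have e1 : layV k e A B (1 / ρ) = (A + B * ρ ^ (2 * k + e)) / ρ ^ k := by
    rw [layV, show 2 * k + e = k + (k + e) by ring, pow_add ρ k]
    simp only [one_div, inv_pow, inv_inv]
    field_simp
  have e2 : ρ ^ e * layC k e 1 A B (1 / ρ) = (A / (k + e) - B * ρ ^ (2 * k + e) / k) / ρ ^ k := by
    rw [layC, show 2 * k + e = k + (k + e) by ring, pow_add ρ k]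
    simp only [one_div, inv_pow, inv_inv, pow_add]
    field_simp
  have hD : A + B * ρ ^ (2 * k + e) ≠ 0 := by
    rw [e1] at hv
    exact (pos_of_mul_pos_left (by simpa [div_eq_mul_inv] using hv) (by positivity)).ne'
  rw [e1, e2]
  field_simp
  ring

/-- The eigenvalues of the Dirichlet-to-Neumann map of the cloak are close to those of the
Laplacian. -/
lemma abs_eigenvalue_sub_le {A B : ℝ} {N : ℕ} (hk : 0 < k) (h0 : 0 < ρ) (h1 : ρ < 1 / 2)
    (hP : Profile k e S.sigR m M (Set.Ici 1) v c) (hM : 1 ≤ M)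
    (hout : ∀ r, 2 ≤ r → v r = layV k e A B r ∧ c r = layC k e 1 A B r)
    (hB : k ≤ N → B = 0) :
    |k * (k + e) * (ρ ^ e * c (1 / ρ) / v (1 / ρ)) - k|
      ≤ (2 * (e + 2) * 2 ^ (2 * N + e + 2) + M * 4 ^ (2 * N + e + 2)) * ρ ^ (2 * N + e + 2) * k := by
  have hk' : (1 : ℝ) ≤ k := by exact_mod_cast hk
  have h2 : (2 : ℝ) ≤ 1 / ρ := by rw [le_div_iff₀ h0]; linarith
  have hmem : (1 / ρ) ∈ Set.Ici (1 : ℝ) := by rw [Set.mem_Ici]; linarith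
  have hpv := hP.pos _ hmem
  have hc0 := hP.nonneg _ hmem
  have hle := hP.le _ hmem
  have hpow : 0 < ρ ^ (2 * N + e + 2) := by positivity
  have t1 : 0 ≤ 2 * ((e : ℝ) + 2) * 2 ^ (2 * N + e + 2) * ρ ^ (2 * N + e + 2) * k := by positivity
  have t2 : 0 ≤ M * 4 ^ (2 * N + e + 2) * ρ ^ (2 * N + e + 2) * k := by
    have : 0 ≤ M := by linarith
    positivity
  have split : (2 * ((e : ℝ) + 2) * 2 ^ (2 * N + e + 2) + M * 4 ^ (2 * N + e + 2)) * ρ ^ (2 * N + e + 2) * k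
      = 2 * (e + 2) * 2 ^ (2 * N + e + 2) * ρ ^ (2 * N + e + 2) * k
        + M * 4 ^ (2 * N + e + 2) * ρ ^ (2 * N + e + 2) * k := by ring
  rw [split]
  -- For `ρ ≤ 1/4` the decaying term is at most half of `A`, so the explicit quotient can be
  -- bounded. For `ρ` near `1/2` this margin is lost, and a crude bound on the eigenvalue is enough.
  rcases le_or_gt ρ (1 / 4) with hρ | hρ
  · refine le_trans ?_ (le_add_of_nonneg_right t2)
    obtain ⟨hv2, hc2⟩ := hout 2 (le_refl _)
    obtain ⟨hA, hBA⟩ := lay_coeff hk (hv2 ▸ hP.pos 2 (by norm_num)) (hc2 ▸ hP.nonneg 2 (by norm_num))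
    rw [(hout _ h2).1, (hout _ h2).2]
    rw [(hout _ h2).1] at hpv
    rw [eigenvalue_sub hk h0 hpv]
    rcases Nat.lt_or_ge N k with hN | hN
    · have hsmall : |B * ρ ^ (2 * k + e)| ≤ (2 * ρ) ^ (2 * k + e) * A := by
        rw [abs_mul, abs_of_pos (pow_pos h0 _), mul_pow]
        calc _ ≤ 2 ^ (2 * k + e) * A * ρ ^ (2 * k + e) :=
              mul_le_mul_of_nonneg_right hBA (pow_pos h0 _).le
          _ = _ := by ring
      have hhalf : (2 * ρ) ^ (2 * k + e) ≤ 1 / 2 :=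
        (pow_le_of_le_one (by positivity) (by linarith) (by omega)).trans (by linarith)
      have hden : A / 2 ≤ A + B * ρ ^ (2 * k + e) := by
        have := (abs_le.1 hsmall).1
        nlinarith
      have hdpos : 0 < A + B * ρ ^ (2 * k + e) := by linarith
      -- The first degree not cancelled is `k = N + 1`, and `2(N+1) + e = 2N + d`: this is where the
      -- exponent of the theorem comes from.
      have hmono : (2 * ρ) ^ (2 * k + e) ≤ (2 * ρ) ^ (2 * N + e + 2) :=
        pow_le_pow_of_le_one (by positivity) (by linarith) (by omega)
      rw [abs_div, abs_neg, abs_mul, abs_of_pos hdpos, abs_of_pos (by positivity : (0 : ℝ) < 2 * k + e),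
        div_le_iff₀ hdpos]
      have hke : (2 * k + e : ℝ) ≤ (e + 2) * k := by nlinarith [show (0 : ℝ) ≤ e by positivity]
      calc (2 * k + e : ℝ) * |B * ρ ^ (2 * k + e)|
          ≤ ((e + 2) * k) * ((2 * ρ) ^ (2 * N + e + 2) * A) :=
            mul_le_mul hke (hsmall.trans (mul_le_mul_of_nonneg_right hmono hA.le)) (abs_nonneg _) (by positivity)
        _ = 2 * (e + 2) * 2 ^ (2 * N + e + 2) * ρ ^ (2 * N + e + 2) * k * (A / 2) := by
            rw [mul_pow]; ring
        _ ≤ _ := mul_le_mul_of_nonneg_left hden t1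
    · rw [hB hN]
      simpa using t1
  · refine le_trans ?_ (le_add_of_nonneg_left t1)
    -- Since `4ρ > 1`, the factor `4 ^ (2 * N + e + 2)` in the constant compensates the power of
    -- `ρ`, and `|λ_k - k| ≤ M k` suffices.
    have hone : (1 : ℝ) ≤ 4 ^ (2 * N + e + 2) * ρ ^ (2 * N + e + 2) := by
      rw [← mul_pow]
      exact one_le_pow₀ (by linarith)
    have hq : (k + e) * (ρ ^ e * c (1 / ρ) / v (1 / ρ)) ≤ M := by
      rw [← mul_div_assoc, div_le_iff₀ hpv]
      have := mul_le_mul_of_nonneg_left hle (pow_pos h0 e).le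
      have e3 : ρ ^ e * (M * (1 / ρ) ^ e * v (1 / ρ)) = M * v (1 / ρ) := by
        rw [one_div, inv_pow]; field_simp
      linarith
    have hq0 : 0 ≤ (k + e) * (ρ ^ e * c (1 / ρ) / v (1 / ρ)) := by positivity
    have : |k * (k + e) * (ρ ^ e * c (1 / ρ) / v (1 / ρ)) - k| ≤ k * M := by
      rw [mul_assoc, abs_le]
      constructor <;> nlinarith
    refine this.trans ?_
    have hMk : 0 ≤ M * k := by positivity
    nlinarith

end Eigenvalues

/-- Enhanced cloaking: in every dimension `d ≥ 2`, a structure whose polarization tensors vanish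
up to order `N` is cloaked up to an error of order `ρ ^ (2 * N + d)`. -/
theorem exists_dtn_bound {d : ℕ} (hd : 2 ≤ d) {N : ℕ} {S : Coating} (hS : GPTVanishing S d N) :
    ∃ Λ₁ : Hhalf d →L[ℝ] HnegHalf d, IsDtN ∅ (iso fun _ => 1) Λ₁ ∧
      ∃ C : ℝ, ∀ ρ : ℝ, 0 < ρ → ρ < 1 / 2 → ∃ Λ : Hhalf d →L[ℝ] HnegHalf d,
        IsDtN (closedBall 0 (1 / 2)) (pushForward (blowUp ρ) (iso (scaledSigma S ρ))) Λ ∧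
        ‖Λ - Λ₁‖ ≤ C * ρ ^ (2 * N + d) := by
  obtain ⟨e, hde⟩ : ∃ e, d = e + 2 := ⟨d - 2, by omega⟩
  have : NeZero d := ⟨by omega⟩
  obtain ⟨Λ₁, h₁⟩ := isCond_iso_one.exists_isDtN hd isClosed_empty isStar_empty
  obtain ⟨m, M, hm, hm1, hM, hb⟩ := S.exists_bounds
  refine ⟨Λ₁, h₁, 2 * (e + 2) * 2 ^ (2 * N + e + 2) + M * 4 ^ (2 * N + e + 2), fun ρ h0 h1 => ?_⟩
  obtain ⟨m', M', hA⟩ := exists_isCond_cloak hde S h0 h1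
  obtain ⟨Λ, hΛ⟩ := hA.exists_isDtN hd isClosed_closedBall (isStar_closedBall _)
  refine ⟨Λ, hΛ, ?_⟩
  rw [show 2 * N + d = 2 * N + e + 2 by omega]
  have hε : 0 ≤ (2 * ((e : ℝ) + 2) * 2 ^ (2 * N + e + 2) + M * 4 ^ (2 * N + e + 2)) * ρ ^ (2 * N + e + 2) := by
    have : 0 ≤ M := by linarith
    positivity
  refine norm_sub_le_of_eigenvalues hd h₁ (hΛ.symm hA) hε fun k p hp => ?_
  rcases Nat.eq_zero_or_pos k with rfl | hk
  -- In degree `0` the data are constant; constants solve both problems with zero flux, so there is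
  -- no error whatever the structure.
  · refine ⟨0, by simp, fun ψ => ?_⟩
    have hpc : p = MvPolynomial.C (MvPolynomial.coeff 0 p) := by
      rw [← MvPolynomial.totalDegree_eq_zero_iff_eq_C, MvPolynomial.totalDegree_zero_iff_isHomogeneous]
      exact Harm.homog ⟨p, hp⟩
    have hpg : ∀ x : E d, pg p x = 0 := fun x => by
      ext i
      rw [pg_apply, hpc, MvPolynomial.pderiv_C, pv_zero]
      rfl
    have hsol : IsWeakSol (closedBall 0 (1 / 2)) (pushForward (blowUp ρ) (iso (scaledSigma S ρ)))
        (polyTrace d p).toL2 (pv p) (pg p) :=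
      ⟨(isExt_polyTrace p).restrict, fun w Z _ => by simp [hpg]⟩
    obtain ⟨U, W, hW⟩ := ψ.exists_isExt (closedBall 0 (1 / 2))
    rw [(hΛ.2 _).2 _ _ hsol ψ _ _ hW]
    simp [hpg]
  · obtain ⟨v, c, A, B, hP, hout⟩ := S.exists_profile hm1 hM hb hk e
    obtain ⟨hv2, hc2⟩ := hout 2 (le_refl _)
    obtain ⟨hApos, -⟩ := lay_coeff hk (hv2 ▸ hP.pos 2 (by norm_num)) (hc2 ▸ hP.nonneg 2 (by norm_num))
    -- The vanishing tensors force `B = 0` only when tested on a nonzero harmonic polynomial; for `p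
    -- = 0` any eigenvalue will do.
    by_cases hp0 : p = 0
    · refine ⟨k, by simpa using mul_nonneg hε (Nat.cast_nonneg k), fun ψ => ?_⟩
      simp [hp0]
    · refine ⟨_, abs_eigenvalue_sub_le hk h0 h1 hP hM hout fun hkN => ?_,
        hΛ.apply_cloak hde h0 h1 hP hm hp⟩
      exact (hS.coeff_eq_zero hde hP hm hApos.ne' (fun r hr => (hout r hr).1) hk hkN hp).resolve_right hp0

end Cloak

end

theorem theorem3p1 (d : ℕ) (hd : d = 2 ∨ d = 3) (N : ℕ) (S : Cloak.Coating)
    (hS : Cloak.GPTVanishing S d N) :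
    ∃ Λ₁ : Cloak.Hhalf d →L[ℝ] Cloak.HnegHalf d,
      Cloak.IsDtN ∅ (Cloak.iso fun _ => 1) Λ₁ ∧
      ∃ C : ℝ, ∀ ρ : ℝ, 0 < ρ → ρ < 1 / 2 →
        ∃ Λ : Cloak.Hhalf d →L[ℝ] Cloak.HnegHalf d,
          Cloak.IsDtN (Metric.closedBall 0 (1 / 2))
            (Cloak.pushForward (Cloak.blowUp ρ) (Cloak.iso (Cloak.scaledSigma S ρ))) Λ ∧
          ‖Λ - Λ₁‖ ≤ C * ρ ^ (2 * N + d) :=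
  Cloak.exists_dtn_bound (by omega) hS
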